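/- Let $h:\mathbb R^n\to\mathbb R^{n-q}$ be smooth, let $\mathcal X=\{x\in\mathbb R^n: h(x)=0\}$, let $0$ be a regular value of $h$ (that is, $Dh(x)$ is onto for every $x\in\mathcal X$, so $T_x\mathcal X=\ker Dh(x)$), and suppose that the embedded $q$-dimensional submanifold $\mathcal X$ carries a Lie group structure. Consider the control-affine system $$\dot x=f(x)+B(x)u+B_w(x)w,\qquad z=g(x,u),$$ with $x\in\mathcal X$, $u\in\mathbb R^m$, $w\in\mathbb R^p$, $z\in\mathbb R^l$, where $f,B,B_w,g$ are continuously differentiable (on a neighbourhood of $\mathcal X$, respectively $\mathcal X\times\mathbb R^m$), $B(x)$ and $B_w(x)$ have full column rank for $x\in\mathcal X$, and the vectors $f(x)$, the columns $b_i(x)$ of $B(x)$ and the columns $b_{w,j}(x)$ of $B_w(x)$ are tangent to $\mathcal X$, i.e. annihilated by $Dh(x)$, for all $x\in\mathcal X$. Let $S(x)\in\mathbb R^{n\times q}$ depend smoothly on $x$ near $\mathcal X$, with columns forming a basis of $T_x\mathcal X$ for each $x\in\mathcal X$ and with $S^\top S\preceq\sigma I_q$ on $\mathcal X$ for some constant $\sigma$.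 Put $P_S=S(S^\top S)^{-1}$, $E=P_S^\top B$, $E_w=P_S^\top B_w$ (so $B=SE$ and $B_w=SE_w$ on $\mathcal X$). Let $\mathcal M(x)\in\mathbb R^{q\times q}$ be symmetric, continuously differentiable, and satisfy $\underline m I_q\preceq\mathcal M(x)\preceq\overline m I_q$ for all $x\in\mathcal X$ with constants $\underline m,\overline m>0$. Let $k(x,x^*)\in\mathbb R^m$ be continuously differentiable near $\mathcal X\times\mathcal X$ with $k(x,x)=0$ for $x\in\mathcal X$, and let $\alpha,\lambda,\mu>0$. For $x,x^*\in\mathcal X$, $u^*\in\mathbb R^m$, $w\in\mathbb R^p$ put $u=k(x,x^*)+u^*$, $\dot x=f(x)+B(x)u+B_w(x)w$, $K=\frac{\partial k}{\partial x}(x,x^*)$, $A=\frac{\partial f}{\partial x}+\sum_i u_i\frac{\partial b_i}{\partial x}+\sum_j w_j\frac{\partial b_{w,j}}{\partial x}$, $$\mathcal A=\big(\partial_{\dot x}P_S^\top+P_S^\top A+EK\big)S,\qquad \mathcal C=\Big(\frac{\partial g}{\partial x}(x,u)+\frac{\partial g}{\partial u}(x,u)K\Big)S,$$ where $\partial_v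 Q=\sum_j\frac{\partial Q}{\partial x_j}v_j$. Suppose that for all $x,x^*\in\mathcal X$, $u^*\in\mathbb R^m$, $w\in\mathbb R^p$ $$R_1=\begin{bmatrix}\partial_{\dot x}\mathcal M+\mathcal M\mathcal A+(\mathcal M\mathcal A)^\top+2\lambda\mathcal M&\mathcal M E_w\\ E_w^\top\mathcal M&-\mu I_p\end{bmatrix}\preceq 0,\qquad R_2=\begin{bmatrix}2\lambda\mathcal M-\alpha^{-1}\mathcal C^\top\mathcal C&0\\0&(\alpha-\mu)I_p\end{bmatrix}\succeq0 .$$ For $a,b\in\mathcal X$ let $\mathcal E(a,b)\in[0,\infty]$ be the infimum of $\int_0^1 v(s)^\top\mathcal M(c(s))v(s)\,ds$ over all smooth paths $c:[0,1]\to\mathcal X$ with $c(0)=a$, $c(1)=b$, where $c'(s)=S(c(s))v(s)$ (and $\mathcal E(a,b)=\infty$ if there is no such path), and let $\beta(a,b)=2\alpha\lambda\,\mathcal E(a,b)$. Then the closed loop with $u=k(x,x^*)+u^*$ has the universal $\mathcal L_\infty$ gain bound $\alpha$ from $w-w^*$ to $z-z^*$ with offset $\beta$: one has $\beta(x,x)=0$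 for all $x\in\mathcal X$, and for every $T>0$, every solution $(x^*,u^*,w^*,z^*)$ of the system on $[0,T]$, every $w$ with $\sup_{0\le t\le T}\|w(t)\|<\infty$ and every solution $(x,u,w,z)$ on $[0,T]$ with $u(t)=k(x(t),x^*(t))+u^*(t)$ (with arbitrary initial value $x(0)\in\mathcal X$), $$\sup_{0\le t\le T}\|z(t)-z^*(t)\|^2\le\alpha^2\sup_{0\le t\le T}\|w(t)-w^*(t)\|^2+\beta(x(0),x^*(0)).$$ Here solutions are in the sense of Carathéodory, with values in $\mathcal X$ and integrable inputs. Moreover $\beta(a,b)<\infty$ whenever $a,b$ lie in the same connected component of $\mathcal X$; in particular $\beta$ is real-valued if $\mathcal X$ is connected. -/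

import Mathlib

open Set MeasureTheory
open scoped ContDiff Manifold ENNReal Matrix

noncomputable section

namespace LieRCCM

/-- `ℝᵈ` with the Euclidean norm. -/
abbrev Vec (d : ℕ) : Type := EuclideanSpace ℝ (Fin d)

/-- Matrix-vector product on Euclidean vectors. -/
def act {a b : ℕ} (A : Matrix (Fin a) (Fin b) ℝ) (v : Vec b) : Vec a :=
  WithLp.toLp 2 (A *ᵥ v.ofLp)

/-- The `i`-th column of a matrix function, as a vector field. -/
def colField {d a b : ℕ} (Q : Vec d → Matrix (Fin a) (Fin b) ℝ) (i : Fin b) (x : Vec d) : Vec a :=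
  WithLp.toLp 2 (fun r => Q x r i)

/-- Jacobian matrix `∂F/∂x`. -/
def jac {a b : ℕ} (F : Vec b → Vec a) (x : Vec b) : Matrix (Fin a) (Fin b) ℝ :=
  Matrix.of fun i j => fderiv ℝ F x (EuclideanSpace.single j 1) i

/-- Directional derivative `∂_v Q (x) = ∑ⱼ (∂Q/∂xⱼ) vⱼ` of a matrix function, entry by entry. -/
def dirDeriv {d a b : ℕ} (Q : Vec d → Matrix (Fin a) (Fin b) ℝ) (v x : Vec d) :
    Matrix (Fin a) (Fin b) ℝ :=
  Matrix.of fun i j => fderiv ℝ (fun y => Q y i j) x v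

/-- The matrix function `Q` is `C^r` on a neighbourhood of the point `x` (entry by entry). -/
def MatContDiffAt {d a b : ℕ} (r : WithTop ℕ∞) (Q : Vec d → Matrix (Fin a) (Fin b) ℝ)
    (x : Vec d) : Prop :=
  ∀ i j, ContDiffAt ℝ r (fun y => Q y i j) x

/-- `⟨A⟩ = A + Aᵀ`. -/
def symPart {a : ℕ} (A : Matrix (Fin a) (Fin a) ℝ) : Matrix (Fin a) (Fin a) ℝ := A + Aᵀ

/-- Control-affine system `x' = f(x) + B(x) u + B_w(x) w`, `z = g(x, u)`. -/
structure System (n m p l : ℕ) where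
  /-- drift -/
  f : Vec n → Vec n
  /-- control matrix -/
  B : Vec n → Matrix (Fin n) (Fin m) ℝ
  /-- disturbance matrix -/
  Bw : Vec n → Matrix (Fin n) (Fin p) ℝ
  /-- output map -/
  g : Vec n → Vec m → Vec l

/-- Right-hand side of the state equation. -/
def System.rhs {n m p l : ℕ} (sys : System n m p l) (x : Vec n) (u : Vec m) (w : Vec p) : Vec n :=
  sys.f x + act (sys.B x) u + act (sys.Bw x) w

/-- The state space `{x ∈ ℝⁿ | h(x) = 0}`. -/
def stateSpace {n r : ℕ} (h : Vec n → Vec r) : Set (Vec n) := {x | h x = 0}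

/-- `X ⊆ ℝⁿ`, with the subspace topology, carries the structure of a `q`-dimensional Lie group
whose inclusion into `ℝⁿ` is a smooth immersion. -/
def IsEmbeddedLieGroup {n : ℕ} (q : ℕ) (X : Set (Vec n)) : Prop :=
  ∃ (_ : Group X) (_ : ChartedSpace (Vec q) X),
    LieGroup (𝓡 q) ∞ X ∧
    ContMDiff (𝓡 q) (𝓡 n) ∞ (Subtype.val : X → Vec n) ∧
    ∀ x : X, Function.Injective (mfderiv (𝓡 q) (𝓡 n) (Subtype.val : X → Vec n) x)

/-- Standing assumptions on the system, on the constraint function `h` that cuts out the state space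
and on the matrix `S` of tangent vector fields. Regularity of a function "on `X`" means regularity
on a neighbourhood in `ℝⁿ` of each point of `X`. As `0` is a regular value of `h`, the tangent space
of `X` at `x` is the kernel of `Dh(x)`. -/
structure LieSystem {n m p l q : ℕ} (h : Vec n → Vec (n - q)) (sys : System n m p l)
    (S : Vec n → Matrix (Fin n) (Fin q) ℝ) : Prop where
  h_smooth : ContDiff ℝ ∞ h
  h_regular : ∀ x ∈ stateSpace h, Function.Surjective (fderiv ℝ h x)
  lieGroup : IsEmbeddedLieGroup q (stateSpace h)
  f_C1 : ∀ x ∈ stateSpace h, ContDiffAt ℝ 1 sys.f x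
  B_C1 : ∀ x ∈ stateSpace h, MatContDiffAt 1 sys.B x
  Bw_C1 : ∀ x ∈ stateSpace h, MatContDiffAt 1 sys.Bw x
  g_C1 : ∀ x ∈ stateSpace h, ∀ u : Vec m, ContDiffAt ℝ 1 (fun a : Vec n × Vec m => sys.g a.1 a.2) (x, u)
  B_rank : ∀ x ∈ stateSpace h, Function.Injective (act (sys.B x))
  Bw_rank : ∀ x ∈ stateSpace h, Function.Injective (act (sys.Bw x))
  f_tangent : ∀ x ∈ stateSpace h, fderiv ℝ h x (sys.f x) = 0
  B_tangent : ∀ x ∈ stateSpace h, ∀ i, fderiv ℝ h x (colField sys.B i x) = 0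
  Bw_tangent : ∀ x ∈ stateSpace h, ∀ j, fderiv ℝ h x (colField sys.Bw j x) = 0
  S_smooth : ∀ x ∈ stateSpace h, MatContDiffAt ∞ S x
  S_indep : ∀ x ∈ stateSpace h, Function.Injective (act (S x))
  S_span : ∀ x ∈ stateSpace h, ∀ y : Vec n, fderiv ℝ h x y = 0 ↔ ∃ v : Vec q, y = act (S x) v
  S_bounded : ∃ σ : ℝ, ∀ x ∈ stateSpace h,
    (σ • (1 : Matrix (Fin q) (Fin q) ℝ) - (S x)ᵀ * S x).PosSemidef

/-- `P_S = S (SᵀS)⁻¹`; so `P_Sᵀ S = I` wherever `S` has full column rank. -/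
def proj {n q : ℕ} (S : Vec n → Matrix (Fin n) (Fin q) ℝ) (x : Vec n) : Matrix (Fin n) (Fin q) ℝ :=
  S x * ((S x)ᵀ * S x)⁻¹

/-- A metric on intrinsic tangent coordinates: continuously differentiable, symmetric and uniformly
bounded between two positive multiples of the identity on `X`. -/
structure IsUniformMetric {n q : ℕ} (X : Set (Vec n)) (M : Vec n → Matrix (Fin q) (Fin q) ℝ) :
    Prop where
  C1 : ∀ x ∈ X, MatContDiffAt 1 M x
  symm : ∀ x ∈ X, (M x).IsSymm
  bounded : ∃ m₁ m₂ : ℝ, 0 < m₁ ∧ 0 < m₂ ∧ ∀ x ∈ X,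
    (M x - m₁ • (1 : Matrix (Fin q) (Fin q) ℝ)).PosSemidef ∧
    (m₂ • (1 : Matrix (Fin q) (Fin q) ℝ) - M x).PosSemidef

/-- Admissible feedback terms `k` in `u = k(x, x*) + u*`. -/
structure IsFeedback {n m : ℕ} (X : Set (Vec n)) (k : Vec n → Vec n → Vec m) : Prop where
  C1 : ∀ x ∈ X, ∀ y ∈ X, ContDiffAt ℝ 1 (fun a : Vec n × Vec n => k a.1 a.2) (x, y)
  diag : ∀ x ∈ X, k x x = 0

section LMI

variable {n m p l q : ℕ}

/-- `A(x,u,w) = ∂f/∂x + ∑ᵢ uᵢ ∂bᵢ/∂x + ∑ⱼ wⱼ ∂b_{w,j}/∂x`. -/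
def matA (sys : System n m p l) (x : Vec n) (u : Vec m) (w : Vec p) : Matrix (Fin n) (Fin n) ℝ :=
  jac sys.f x + ∑ i, u i • jac (colField sys.B i) x + ∑ j, w j • jac (colField sys.Bw j) x

/-- `E`, the unique solution of `B = S E` when the columns of `B` are tangent. -/
def matE (sys : System n m p l) (S : Vec n → Matrix (Fin n) (Fin q) ℝ) (x : Vec n) :
    Matrix (Fin q) (Fin m) ℝ := (proj S x)ᵀ * sys.B x

/-- `E_w`, the unique solution of `B_w = S E_w` when the columns of `B_w` are tangent. -/
def matEw (sys : System n m p l) (S : Vec n → Matrix (Fin n) (Fin q) ℝ) (x : Vec n) :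
    Matrix (Fin q) (Fin p) ℝ := (proj S x)ᵀ * sys.Bw x

/-- `K = ∂k/∂x` at `(x, x*)`. -/
def matK (k : Vec n → Vec n → Vec m) (x xs : Vec n) : Matrix (Fin m) (Fin n) ℝ :=
  jac (fun y => k y xs) x

/-- `𝒜 = (∂_{x'} P_Sᵀ + P_Sᵀ A + E K) S`, at `u = k(x,x*) + u*` and `x' = f + B u + B_w w`. -/
def calA (sys : System n m p l) (S : Vec n → Matrix (Fin n) (Fin q) ℝ) (k : Vec n → Vec n → Vec m)
    (x xs : Vec n) (us : Vec m) (w : Vec p) : Matrix (Fin q) (Fin q) ℝ :=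
  (dirDeriv (fun y => (proj S y)ᵀ) (sys.rhs x (k x xs + us) w) x
    + (proj S x)ᵀ * matA sys x (k x xs + us) w + matE sys S x * matK k x xs) * S x

/-- `𝒞 = (∂g/∂x + ∂g/∂u K) S`, at `u = k(x,x*) + u*`. -/
def calC (sys : System n m p l) (S : Vec n → Matrix (Fin n) (Fin q) ℝ) (k : Vec n → Vec n → Vec m)
    (x xs : Vec n) (us : Vec m) : Matrix (Fin l) (Fin q) ℝ :=
  (jac (fun y => sys.g y (k x xs + us)) x
    + jac (fun u => sys.g x u) (k x xs + us) * matK k x xs) * S x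

/-- The block matrix `R₁`. -/
def R₁ (sys : System n m p l) (S : Vec n → Matrix (Fin n) (Fin q) ℝ) (k : Vec n → Vec n → Vec m)
    (M : Vec n → Matrix (Fin q) (Fin q) ℝ) (lam μ : ℝ)
    (x xs : Vec n) (us : Vec m) (w : Vec p) : Matrix (Fin q ⊕ Fin p) (Fin q ⊕ Fin p) ℝ :=
  Matrix.fromBlocks
    (dirDeriv M (sys.rhs x (k x xs + us) w) x + symPart (M x * calA sys S k x xs us w)
      + (2 * lam) • M x)
    (M x * matEw sys S x)
    ((matEw sys S x)ᵀ * M x)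
    (-(μ • (1 : Matrix (Fin p) (Fin p) ℝ)))

/-- The block matrix `R₂`. -/
def R₂ (sys : System n m p l) (S : Vec n → Matrix (Fin n) (Fin q) ℝ) (k : Vec n → Vec n → Vec m)
    (M : Vec n → Matrix (Fin q) (Fin q) ℝ) (α lam μ : ℝ)
    (x xs : Vec n) (us : Vec m) : Matrix (Fin q ⊕ Fin p) (Fin q ⊕ Fin p) ℝ :=
  Matrix.fromBlocks
    ((2 * lam) • M x - α⁻¹ • ((calC sys S k x xs us)ᵀ * calC sys S k x xs us))
    0 0
    ((α - μ) • (1 : Matrix (Fin p) (Fin p) ℝ))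

end LMI

/-- `Γ_X(a,b)`: smooth paths `[0,1] → X` from `a` to `b`. -/
def paths {n : ℕ} (X : Set (Vec n)) (a b : Vec n) : Set (ℝ → Vec n) :=
  {c | ContDiffOn ℝ ∞ c (Icc 0 1) ∧ (∀ s ∈ Icc (0 : ℝ) 1, c s ∈ X) ∧ c 0 = a ∧ c 1 = b}

/-- Intrinsic velocity `v = P_Sᵀ c'(s)` of a path, that is `c'(s) = S(c(s)) v` for a path in `X`. -/
def intrinsicVelocity {n q : ℕ} (S : Vec n → Matrix (Fin n) (Fin q) ℝ) (c : ℝ → Vec n) (s : ℝ) :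
    Vec q :=
  act (proj S (c s))ᵀ (derivWithin c (Icc 0 1) s)

/-- Riemannian energy `∫₀¹ vᵀ M(c(s)) v ds` of a path. -/
def energy {n q : ℕ} (S : Vec n → Matrix (Fin n) (Fin q) ℝ) (M : Vec n → Matrix (Fin q) (Fin q) ℝ)
    (c : ℝ → Vec n) : ℝ :=
  ∫ s in (0 : ℝ)..1,
    (intrinsicVelocity S c s).ofLp ⬝ᵥ (M (c s) *ᵥ (intrinsicVelocity S c s).ofLp)

/-- Minimal Riemannian energy between two points (`∞` when no path in `X` joins them). -/
def minEnergy {n q : ℕ} (X : Set (Vec n)) (S : Vec n → Matrix (Fin n) (Fin q) ℝ)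
    (M : Vec n → Matrix (Fin q) (Fin q) ℝ) (a b : Vec n) : ℝ≥0∞ :=
  ⨅ c ∈ paths X a b, ENNReal.ofReal (energy S M c)

/-- `(x,u,w,z)` is a (Carathéodory) solution of the system on `[0,T]` in the state space `X`, with
integrable inputs: `x` is continuous and satisfies the state equation in integrated form. -/
structure IsSolution {n m p l : ℕ} (X : Set (Vec n)) (sys : System n m p l) (T : ℝ)
    (x : ℝ → Vec n) (u : ℝ → Vec m) (w : ℝ → Vec p) (z : ℝ → Vec l) : Prop where
  mem : ∀ t ∈ Icc 0 T, x t ∈ X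
  cont : ContinuousOn x (Icc 0 T)
  u_int : IntervalIntegrable u volume 0 T
  w_int : IntervalIntegrable w volume 0 T
  state : ∀ t ∈ Icc 0 T, x t = x 0 + ∫ τ in (0 : ℝ)..t, sys.rhs (x τ) (u τ) (w τ)
  output : ∀ t ∈ Icc 0 T, z t = sys.g (x t) (u t)

/-- Truncated norm `sup_{0 ≤ t ≤ T} ‖y(t)‖`, with values in `[0,∞]`. -/
def supNorm {d : ℕ} (T : ℝ) (y : ℝ → Vec d) : ℝ≥0∞ := ⨆ t ∈ Icc (0 : ℝ) T, ‖y t‖ₑ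

/-- The system with feedback `u = k(x,x*) + u*` has the universal `L∞` gain bound `α` from `w - w*`
to `z - z*`, with offset function `β`. Solutions are only required to exist on `[0,T]`. -/
def HasUniversalGain {n m p l : ℕ} (X : Set (Vec n)) (sys : System n m p l)
    (k : Vec n → Vec n → Vec m) (α : ℝ) (β : Vec n → Vec n → ℝ≥0∞) : Prop :=
  (∀ x ∈ X, β x x = 0) ∧
  ∀ T : ℝ, 0 < T →
  ∀ (xs : ℝ → Vec n) (us : ℝ → Vec m) (ws : ℝ → Vec p) (zs : ℝ → Vec l),
    IsSolution X sys T xs us ws zs →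
  ∀ (x : ℝ → Vec n) (w : ℝ → Vec p) (z : ℝ → Vec l),
    supNorm T w < ⊤ →
    IsSolution X sys T x (fun t => k (x t) (xs t) + us t) w z →
    supNorm T (fun t => z t - zs t) ^ 2
      ≤ ENNReal.ofReal α ^ 2 * supNorm T (fun t => w t - ws t) ^ 2 + β (x 0) (xs 0)

end LieRCCM

end

noncomputable section

namespace LieRCCM

open Filter Topology

/-! ### Absolutely continuous curves and an almost-everywhere Grönwall estimate. -/

section AbsolutelyContinuous

variable {E F : Type*} [NormedAddCommGroup E] [NormedSpace ℝ E]
  [NormedAddCommGroup F] [NormedSpace ℝ F] {a b : ℝ}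

/-! The classical argument joins `x(0)` to `x*(0)` by a path, flows every point of the path with
interpolated disturbances, and integrates the differential energy inequality over the path. That
needs a family of solutions that is differentiable in its parameter and exists up to time `T`. Here
the family is replaced by a finite chain of `N + 1` trajectories, and derivatives in the parameter
by chords between neighbours.

The closed loop is written `x' = G(x, x*) v` with `v = (1, u*, w)` and `G` linear in `v`
(`inputField`); since `k(x*, x*) = 0`, the reference solution obeys the same equation. The metric
becomes the form `Q = P_S M P_Sᵀ` on all of `ℝⁿ` (`metricForm`), which can be evaluated on chords.
Testing `R₁` on `(P_Sᵀ ξ, w')` gives `(Q ξ ξ)' ≤ -2λ Q ξ ξ + μ ‖w'‖²` for tangent `ξ`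
(`LieSystem.contraction`), and testing `R₂` on `(P_Sᵀ ξ, 0)` bounds the squared output derivative by
`2αλ Q ξ ξ` (`LieSystem.output_bound`).

Chords of `X = {h = 0}` are tangent up to `o(length)`, uniformly on compact sets. Hence both
inequalities, and coercivity of `Q`, hold for short chords up to an error `ε`
(`exists_delta_output_bound`, `exists_delta_coercive`, `exists_delta_energy_rate`). Grönwall then
gives each link the energy bound `exp(ε a) (initial energy + (μ + ε)(D/N)²/(2λ))` with `D` a bound
for `‖w - w*‖`. By Cauchy–Schwarz the squared output distance is at most `N` times the sum of the
squared link contributions. The initial energies, multiplied by `N`, form a Riemann sum of the path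
energy. Large `N`, and then `ε → 0`, give `‖z - z*‖² ≤ αμD² + 2αλ · energy`
(`ContractingSystem.sq_norm_output_sub_le`). The lower block of `R₂` gives `μ ≤ α`, and the infimum
over paths concludes.

The interpolating trajectories are not given. `exists_trajectory` solves a cut-off equation that
preserves `h`, and `ContractingSystem.chain_bound` shows by continuation that the chain never leaves
the compact set on which the cutoff is inactive. Finiteness of the energy on components is separate:
points joined by smooth paths form a clopen set. -/

theorem absolutelyContinuous_of_dist_le {X Y : Type*} [PseudoMetricSpace X] [PseudoMetricSpace Y]
    {r : ℝ → X} {f : ℝ → Y} (C : ℝ) (hr : AbsolutelyContinuousOnInterval r a b)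
    (h : ∀ s ∈ uIcc a b, ∀ t ∈ uIcc a b, dist (f s) (f t) ≤ C * dist (r s) (r t)) :
    AbsolutelyContinuousOnInterval f a b := by
  have h1 := (Tendsto.const_mul C hr)
  rw [mul_zero] at h1
  refine squeeze_zero' (Eventually.of_forall fun t => Finset.sum_nonneg fun i _ => dist_nonneg)
    ?_ h1
  refine eventually_inf_principal.2 (Eventually.of_forall fun p hp => ?_)
  rw [Finset.mul_sum]
  exact Finset.sum_le_sum fun i hi => h _ (hp.1 i hi).1 _ (hp.1 i hi).2

/-- `γ` is absolutely continuous between `a` and `b`, with derivative `γ'` almost everywhere. -/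
structure HasAEDeriv (a b : ℝ) (γ γ' : ℝ → E) : Prop where
  ac : AbsolutelyContinuousOnInterval γ a b
  deriv : ∀ᵐ t, t ∈ uIcc a b → HasDerivAt γ (γ' t) t

theorem ae_mem_uIoo (a b : ℝ) : ∀ᵐ t : ℝ, t ∈ uIcc a b → t ∈ Ioo (min a b) (max a b) := by
  have h1 : ∀ᵐ t : ℝ, t ≠ min a b := by simp [ae_iff, measure_singleton]
  have h2 : ∀ᵐ t : ℝ, t ≠ max a b := by simp [ae_iff, measure_singleton]
  filter_upwards [h1, h2] with t h1 h2 ht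
  exact ⟨lt_of_le_of_ne ht.1 (Ne.symm h1), lt_of_le_of_ne ht.2 h2⟩

namespace HasAEDeriv

variable {γ γ' : ℝ → E}

theorem continuousOn (h : HasAEDeriv a b γ γ') : ContinuousOn γ (uIcc a b) := h.ac.continuousOn

/-- Increments of `γ` are dominated by those of the real primitive of `‖g‖`, which is absolutely
continuous; the derivative comes from Lebesgue differentiation. -/
theorem of_integral {g : ℝ → E} [CompleteSpace E] (hg : IntervalIntegrable g volume a b)
    (h : ∀ t ∈ uIcc a b, γ t = γ a + ∫ τ in a..t, g τ) : HasAEDeriv a b γ g := by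
  refine ⟨?_, ?_⟩
  · refine absolutelyContinuous_of_dist_le 1
      (hg.norm.absolutelyContinuousOnInterval_intervalIntegral (c := a) left_mem_uIcc) ?_
    intro s hs t ht
    have hgs : IntervalIntegrable g volume a s := hg.mono_set (uIcc_subset_uIcc_left hs)
    have hgt : IntervalIntegrable g volume a t := hg.mono_set (uIcc_subset_uIcc_left ht)
    rw [h s hs, h t ht, dist_add_left, dist_eq_norm, one_mul, Real.dist_eq,
      intervalIntegral.integral_interval_sub_left hgs hgt,
      intervalIntegral.integral_interval_sub_left hgs.norm hgt.norm]
    exact intervalIntegral.norm_integral_le_abs_integral_norm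
  · filter_upwards [hg.ae_hasDerivAt_integral, ae_mem_uIoo a b] with t h1 h2 ht
    have h3 := (h1 ht a left_mem_uIcc).const_add (γ a)
    refine h3.congr_of_eventuallyEq ?_
    filter_upwards [isOpen_Ioo.mem_nhds (h2 ht)] with s hs
    exact h s (Ioo_subset_Icc_self hs)

/-- Compactness of the image of the curve upgrades the local Lipschitz bounds of a `C¹` map to a
single constant, which preserves absolute continuity. -/
theorem comp {φ : E → F} (h : HasAEDeriv a b γ γ')
    (hφ : ∀ t ∈ uIcc a b, ContDiffAt ℝ 1 φ (γ t)) :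
    HasAEDeriv a b (fun t => φ (γ t)) (fun t => fderiv ℝ φ (γ t) (γ' t)) := by
  refine ⟨?_, ?_⟩
  · have hK : IsCompact (γ '' uIcc a b) := isCompact_uIcc.image_of_continuousOn h.continuousOn
    have hL : LocallyLipschitzOn (γ '' uIcc a b) φ := by
      rintro _ ⟨t, ht, rfl⟩
      obtain ⟨K, s, hs, hK⟩ := (hφ t ht).exists_lipschitzOnWith
      exact ⟨K, s, mem_nhdsWithin_of_mem_nhds hs, hK⟩
    obtain ⟨C, hC⟩ := hL.exists_lipschitzOnWith_of_compact hK
    exact absolutelyContinuous_of_dist_le C h.ac fun s hs t ht =>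
      hC.dist_le_mul _ (mem_image_of_mem _ hs) _ (mem_image_of_mem _ ht)
  · filter_upwards [h.deriv] with t h1 ht
    exact (((hφ t ht).differentiableAt one_ne_zero).hasFDerivAt).comp_hasDerivAt t (h1 ht)

theorem prodMk {η η' : ℝ → F} (h : HasAEDeriv a b γ γ') (h' : HasAEDeriv a b η η') :
    HasAEDeriv a b (fun t => (γ t, η t)) (fun t => (γ' t, η' t)) := by
  refine ⟨?_, ?_⟩
  · have h1 := Tendsto.add h.ac h'.ac
    rw [add_zero] at h1
    refine squeeze_zero (fun t => Finset.sum_nonneg fun i _ => dist_nonneg) (fun t => ?_) h1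
    rw [← Finset.sum_add_distrib]
    refine Finset.sum_le_sum fun i _ => ?_
    rw [Prod.dist_eq]
    exact max_le_add_of_nonneg dist_nonneg dist_nonneg
  · filter_upwards [h.deriv, h'.deriv] with t h1 h2 ht
    exact (h1 ht).prodMk (h2 ht)

theorem mono {c d : ℝ} (h : HasAEDeriv a b γ γ') (hs : uIcc c d ⊆ uIcc a b) :
    HasAEDeriv c d γ γ' :=
  ⟨h.ac.mono hs, h.deriv.mono fun _ h1 ht => h1 (hs ht)⟩

theorem eq_left_of_deriv_eq_zero (h : HasAEDeriv a b γ γ')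
    (h0 : ∀ᵐ t, t ∈ uIcc a b → γ' t = 0) : ∀ t ∈ uIcc a b, γ t = γ a := by
  obtain ⟨C, hC⟩ := h.ac.const_of_ae_hasDerivAt_zero (by
    filter_upwards [h.deriv, h0] with t h1 h2 ht
    have := h1 ht
    rwa [h2 ht] at this)
  intro t ht
  rw [hC t ht, hC a left_mem_uIcc]

theorem le_left_of_deriv_nonpos {f f' : ℝ → ℝ} (hab : a ≤ b) (h : HasAEDeriv a b f f')
    (h0 : ∀ᵐ t, t ∈ uIcc a b → f' t ≤ 0) : f b ≤ f a := by
  have h1 := h.ac.integral_deriv_eq_sub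
  have h2 : 0 ≤ ∫ t in a..b, -_root_.deriv f t := by
    refine intervalIntegral.integral_nonneg_of_ae_restrict hab ?_
    rw [EventuallyLE, ae_restrict_iff' measurableSet_Icc]
    filter_upwards [h.deriv, h0] with t h1 h2 ht
    have ht' : t ∈ uIcc a b := by rwa [uIcc_of_le hab]
    rw [(h1 ht').deriv]
    simpa using h2 ht'
  rw [intervalIntegral.integral_neg] at h2
  linarith

theorem add_const_mul {f f' g g' : ℝ → ℝ} (h : HasAEDeriv a b f f') (h' : HasAEDeriv a b g g')
    (c : ℝ) : HasAEDeriv a b (fun t => f t + c * g t) (fun t => f' t + c * g' t) := by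
  refine ⟨h.ac.add (h'.ac.const_mul c), ?_⟩
  filter_upwards [h.deriv, h'.deriv] with t h1 h2 ht
  exact (h1 ht).add ((h2 ht).const_mul c)

theorem mul {f f' g g' : ℝ → ℝ} (h : HasAEDeriv a b f f') (h' : HasAEDeriv a b g g') :
    HasAEDeriv a b (fun t => f t * g t) (fun t => f' t * g t + f t * g' t) := by
  refine ⟨h.ac.mul h'.ac, ?_⟩
  filter_upwards [h.deriv, h'.deriv] with t h1 h2 ht
  exact (h1 ht).mul (h2 ht)

end HasAEDeriv

/-- Grönwall estimate for `U' ≤ (-c + ρ) U + κ`. -/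
theorem gronwall_of_ae_deriv_le {T c κ : ℝ} (hT : 0 ≤ T) (hc : 0 < c) (hκ : 0 ≤ κ)
    {U U' ρ : ℝ → ℝ} (hU : HasAEDeriv 0 T U U') (hρ : IntervalIntegrable ρ volume 0 T)
    (hρ0 : ∀ t ∈ Icc 0 T, 0 ≤ ρ t)
    (h : ∀ᵐ t, t ∈ Icc 0 T → U' t ≤ (-c + ρ t) * U t + κ) (hU0 : 0 ≤ U 0) :
    U T ≤ Real.exp (∫ t in (0 : ℝ)..T, ρ t) * (U 0 + κ / c) := by
  set r : ℝ → ℝ := fun t => ∫ τ in (0 : ℝ)..t, ρ τ with hr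
  have hr0 : ∀ t ∈ Icc 0 T, 0 ≤ r t := fun t ht =>
    intervalIntegral.integral_nonneg ht.1 fun s hs => hρ0 s ⟨hs.1, hs.2.trans ht.2⟩
  have huIcc : uIcc 0 T = Icc 0 T := uIcc_of_le hT
  have h1 : HasAEDeriv 0 T r ρ := HasAEDeriv.of_integral hρ fun t _ => by simp [hr]
  have h2 : HasAEDeriv 0 T (fun t : ℝ => t) (fun _ => 1) :=
    HasAEDeriv.of_integral intervalIntegrable_const fun t _ => by simp
  have h3 : HasAEDeriv 0 T (fun t => Real.exp (c * t)) (fun t => Real.exp (c * t) * c) := by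
    have := h2.comp (φ := fun t : ℝ => Real.exp (c * t)) fun t _ => by fun_prop
    convert this using 2 with t
    have : HasDerivAt (fun t : ℝ => Real.exp (c * t)) (Real.exp (c * t) * (c * 1)) t :=
      ((hasDerivAt_id t).const_mul c).exp
    rw [fderiv_apply_one_eq_deriv, this.deriv, mul_one]
  have h4 : HasAEDeriv 0 T (fun t => Real.exp (-(r t)))
      (fun t => Real.exp (-(r t)) * -(ρ t)) := by
    have := h1.comp (φ := fun t : ℝ => Real.exp (-t)) fun t _ => by fun_prop
    convert this using 2 with t
    have : HasDerivAt (fun t : ℝ => Real.exp (-t)) (Real.exp (-(r t)) * (-1)) (r t) :=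
      ((hasDerivAt_id (r t)).neg).exp
    rw [this.hasFDerivAt.fderiv]
    simp [mul_comm]
  -- The monotone quantity is `exp(ct) (exp(-r) U - κ/c)`: its derivative is nonpositive because
  -- `exp(-r) ≤ 1` and `κ ≥ 0`.
  have h5 := ((h3.mul h4).mul hU).add_const_mul h3 (-(κ / c))
  have h6 := h5.le_left_of_deriv_nonpos hT (by
    filter_upwards [h] with t ht htt
    rw [huIcc] at htt
    have e1 : 0 < Real.exp (c * t) := Real.exp_pos _
    have e2 : 0 < Real.exp (-(r t)) := Real.exp_pos _
    have e3 : Real.exp (-(r t)) ≤ 1 := by simpa using hr0 t htt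
    have e4 := ht htt
    have e5 : Real.exp (-(r t)) * U' t ≤ Real.exp (-(r t)) * ((-c + ρ t) * U t + κ) := by gcongr
    have e6 : Real.exp (-(r t)) * κ ≤ κ := mul_le_of_le_one_left hκ e3
    have e7 : κ / c * (Real.exp (c * t) * c) = Real.exp (c * t) * κ := by field_simp
    have e8 : (Real.exp (c * t) * c * Real.exp (-r t) +
        Real.exp (c * t) * (Real.exp (-r t) * -ρ t)) * U t +
        Real.exp (c * t) * Real.exp (-r t) * U' t + -(κ / c) * (Real.exp (c * t) * c)
        = Real.exp (c * t) * (Real.exp (-r t) * U' t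
          - Real.exp (-r t) * ((-c + ρ t) * U t + κ) + (Real.exp (-r t) * κ - κ)) := by
      rw [neg_mul (κ / c), e7]; ring
    rw [e8]
    exact mul_nonpos_of_nonneg_of_nonpos e1.le (by linarith))
  have hr00 : r 0 = 0 := by simp [hr]
  simp only [hr00, mul_zero, neg_zero, Real.exp_zero, one_mul, mul_one] at h6
  -- Since `U 0 ≥ 0`, the bare `U 0` may be enlarged to `exp(cT) U 0`, after which the factor
  -- `exp(cT)` cancels.
  have e1 : 1 ≤ Real.exp (c * T) := by
    rw [← Real.exp_zero]; exact Real.exp_le_exp.2 (by positivity)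
  have e2 : 0 < Real.exp (-(r T)) := Real.exp_pos _
  have e3 : Real.exp (-(r T)) * U T ≤ U 0 + κ / c := by
    have e4 : Real.exp (c * T) * (Real.exp (-(r T)) * U T) ≤
        Real.exp (c * T) * (U 0 + κ / c) := by
      have : 0 ≤ κ / c := by positivity
      nlinarith
    exact le_of_mul_le_mul_left e4 (by linarith)
  have e5 : Real.exp (r T) * Real.exp (-(r T)) = 1 := by rw [← Real.exp_add]; simp
  calc U T = Real.exp (r T) * (Real.exp (-(r T)) * U T) := by rw [← mul_assoc, e5, one_mul]
    _ ≤ _ := by gcongr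

end AbsolutelyContinuous

/-! ### Uniform first-order estimates on compact sets. -/

section UniformEstimates

variable {E F : Type*} [NormedAddCommGroup E] [NormedSpace ℝ E]
  [NormedAddCommGroup F] [NormedSpace ℝ F]

/-- `δ` is a Lebesgue number of a cover of `K` by open sets on whose squares `P` holds. -/
theorem exists_delta_of_eventually_nhds_prod {X : Type*} [PseudoMetricSpace X] {K : Set X}
    (hK : IsCompact K) {P : X → X → Prop}
    (h : ∀ x ∈ K, ∀ᶠ p in 𝓝 (x, x), P p.1 p.2) :
    ∃ δ > 0, ∀ x ∈ K, ∀ y, dist y x < δ → P x y := by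
  have h' : ∀ x : K, ∃ U : Set X, IsOpen U ∧ (x : X) ∈ U ∧ ∀ y ∈ U, ∀ z ∈ U, P y z := by
    intro x
    have := h x x.2
    rw [nhds_prod_eq] at this
    obtain ⟨p, hp, hpp⟩ := Filter.eventually_prod_self_iff.1 this
    obtain ⟨U, hU, hUo, hxU⟩ := mem_nhds_iff.1 hp
    exact ⟨U, hUo, hxU, fun y hy z hz => hpp y (hU hy) z (hU hz)⟩
  choose U hUo hxU hUP using h'
  obtain ⟨δ, hδ, H⟩ := lebesgue_number_lemma_of_metric hK hUo fun x hx =>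
    mem_iUnion.2 ⟨⟨x, hx⟩, hxU ⟨x, hx⟩⟩
  refine ⟨δ, hδ, fun x hx y hy => ?_⟩
  obtain ⟨i, hi⟩ := H x hx
  exact hUP i x (hi (Metric.mem_ball_self hδ)) y (hi hy)

/-- A function that is `C¹` near a compact set is uniformly differentiable on it. -/
theorem uniformly_differentiable_of_contDiffAt {φ : E → F} {K : Set E} (hK : IsCompact K)
    (hφ : ∀ x ∈ K, ContDiffAt ℝ 1 φ x) {ε : ℝ} (hε : 0 < ε) :
    ∃ δ > 0, ∀ x ∈ K, ∀ y, dist y x < δ →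
      ‖φ y - φ x - fderiv ℝ φ x (y - x)‖ ≤ ε * ‖y - x‖ := by
  refine exists_delta_of_eventually_nhds_prod hK fun x hx => ?_
  -- Strict differentiability controls chords between any two points near `x`, but with the
  -- derivative frozen at `x`; continuity of `fderiv` exchanges it for the derivative at the base
  -- point.
  have h1 : HasStrictFDerivAt φ (fderiv ℝ φ x) x := (hφ x hx).hasStrictFDerivAt one_ne_zero
  have h2 : ContinuousAt (fderiv ℝ φ) x := by
    have := (hφ x hx).fderiv_right (m := 0) (by simp)
    exact this.continuousAt
  have h3 : ∀ᶠ p : E × E in 𝓝 (x, x), ‖fderiv ℝ φ p.1 - fderiv ℝ φ x‖ < ε / 2 := by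
    have : ∀ᶠ y in 𝓝 x, ‖fderiv ℝ φ y - fderiv ℝ φ x‖ < ε / 2 := by
      have := Metric.tendsto_nhds.1 h2 (ε / 2) (by positivity)
      simpa [dist_eq_norm] using this
    exact (continuous_fst.tendsto (x, x)).eventually this
  have h4 := h1.isLittleO.def (half_pos hε)
  have h5 : ∀ᶠ p : E × E in 𝓝 (x, x),
      ‖φ p.2 - φ p.1 - fderiv ℝ φ x (p.2 - p.1)‖ ≤ ε / 2 * ‖p.2 - p.1‖ := by
    have : Tendsto (Prod.swap : E × E → E × E) (𝓝 (x, x)) (𝓝 (x, x)) :=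
      (continuous_swap.tendsto (x, x))
    exact this.eventually h4
  filter_upwards [h3, h5] with p h3 h5
  calc ‖φ p.2 - φ p.1 - fderiv ℝ φ p.1 (p.2 - p.1)‖
      = ‖(φ p.2 - φ p.1 - fderiv ℝ φ x (p.2 - p.1))
          - (fderiv ℝ φ p.1 - fderiv ℝ φ x) (p.2 - p.1)‖ := by
        congr 1; simp
    _ ≤ ε / 2 * ‖p.2 - p.1‖ + ε / 2 * ‖p.2 - p.1‖ := by
        refine (norm_sub_le _ _).trans (add_le_add h5 ?_)
        exact ((fderiv ℝ φ p.1 - fderiv ℝ φ x).le_opNorm _).trans (by gcongr)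
    _ = ε * ‖p.2 - p.1‖ := by ring

theorem exists_norm_fderiv_le {φ : E → F} {K : Set E} (hK : IsCompact K)
    (hφ : ∀ x ∈ K, ContDiffAt ℝ 1 φ x) : ∃ C, 0 ≤ C ∧ ∀ x ∈ K, ‖fderiv ℝ φ x‖ ≤ C := by
  obtain ⟨C, hC⟩ := hK.exists_bound_of_continuousOn (f := fderiv ℝ φ) fun x hx =>
    (((hφ x hx).fderiv_right (m := 0) (by simp)).continuousAt).continuousWithinAt
  exact ⟨max C 0, le_max_right _ _, fun x hx => (hC x hx).trans (le_max_left _ _)⟩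

theorem exists_norm_le_of_continuousOn {E F : Type*} [NormedAddCommGroup E]
    [NormedAddCommGroup F] {φ : E → F} {K : Set E} (hK : IsCompact K)
    (hφ : ContinuousOn φ K) : ∃ C, 0 ≤ C ∧ ∀ x ∈ K, ‖φ x‖ ≤ C := by
  obtain ⟨C, hC⟩ := hK.exists_bound_of_continuousOn hφ
  exact ⟨max C 0, le_max_right _ _, fun x hx => (hC x hx).trans (le_max_left _ _)⟩

end UniformEstimates

/-! ### Global existence of Carathéodory solutions. -/

section Caratheodory

variable {E : Type*} [NormedAddCommGroup E] [NormedSpace ℝ E] [CompleteSpace E]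

/-- The integrand is half the derivative of `exp(∫ 2L)`; this half is the contraction constant of
the Picard operator below. -/
theorem integral_mul_exp_integral {T : ℝ} {L : ℝ → ℝ} (hL : IntervalIntegrable L volume 0 T)
    {t : ℝ} (ht : t ∈ uIcc 0 T) :
    IntervalIntegrable (fun τ => L τ * Real.exp (∫ s in (0 : ℝ)..τ, 2 * L s)) volume 0 t ∧
    ∫ τ in (0 : ℝ)..t, L τ * Real.exp (∫ s in (0 : ℝ)..τ, 2 * L s)
      = (Real.exp (∫ s in (0 : ℝ)..t, 2 * L s) - 1) / 2 := by
  set r : ℝ → ℝ := fun t => ∫ s in (0 : ℝ)..t, 2 * L s with hr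
  have h1 : HasAEDeriv 0 T r (fun s => 2 * L s) :=
    HasAEDeriv.of_integral (hL.const_mul 2) fun t _ => by simp [hr]
  have h2 : HasAEDeriv 0 T (fun t => Real.exp (r t)) (fun t => Real.exp (r t) * (2 * L t)) := by
    have := h1.comp (φ := fun t : ℝ => Real.exp t) fun t _ => by fun_prop
    convert this using 2 with t
    rw [(Real.hasDerivAt_exp (r t)).hasFDerivAt.fderiv]
    simp [mul_comm]
  have hi : IntervalIntegrable (fun τ => L τ * Real.exp (r τ)) volume 0 T :=
    hL.mul_continuousOn h2.continuousOn
  have hit := hi.mono_set (uIcc_subset_uIcc_left ht)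
  refine ⟨hit, ?_⟩
  have h3 : HasAEDeriv 0 T (fun t => ∫ τ in (0 : ℝ)..t, L τ * Real.exp (r τ))
      (fun τ => L τ * Real.exp (r τ)) := HasAEDeriv.of_integral hi fun t _ => by simp
  have h4 := (h3.add_const_mul h2 (-(1 / 2))).eq_left_of_deriv_eq_zero
    (Eventually.of_forall fun t _ => by ring) t ht
  have h5 : r 0 = 0 := by simp [hr]
  simp only [intervalIntegral.integral_same, h5, Real.exp_zero] at h4
  linarith

/-- Existence of Carathéodory solutions for a right-hand side that is Lipschitz in the state with
an integrable Lipschitz constant. -/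
theorem exists_caratheodory_solution {T : ℝ} (hT : 0 ≤ T) {H : ℝ → E → E} {L : ℝ → ℝ}
    (hint : ∀ η : ℝ → E, Continuous η → IntervalIntegrable (fun t => H t (η t)) volume 0 T)
    (hL : IntervalIntegrable L volume 0 T) (hL0 : ∀ t, 0 ≤ L t)
    (hlip : ∀ t x y, ‖H t x - H t y‖ ≤ L t * ‖x - y‖) (y₀ : E) :
    ∃ y : ℝ → E, Continuous y ∧ ∀ t ∈ Icc 0 T, y t = y₀ + ∫ τ in (0 : ℝ)..t, H τ (y τ) := by
  have huIcc : uIcc 0 T = Icc 0 T := uIcc_of_le hT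
  -- Bielecki's weight: in the norm `sup exp(-r) ‖y‖` the Picard operator contracts by `1/2` on the
  -- whole interval, so no patching of short-time solutions is needed.
  set r : ℝ → ℝ := fun t => ∫ s in (0 : ℝ)..t, 2 * L s with hr
  have hrc : ContinuousOn r (Icc 0 T) := by
    rw [← huIcc]
    exact (HasAEDeriv.of_integral (γ := r) (hL.const_mul 2) fun t _ => by simp [hr]).continuousOn
  have hrc' : Continuous fun t : Icc (0 : ℝ) T => r t := continuousOn_iff_continuous_domRestrict.1 hrc
  -- The fixed-point unknown is `η = exp(-r) y`; `lift` recovers `y`, extended continuously to `ℝ`.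
  let lift : C(Icc (0 : ℝ) T, E) → ℝ → E := fun η =>
    IccExtend hT fun t => Real.exp (r t) • η t
  have hlift : ∀ η, Continuous (lift η) := fun η =>
    (((Real.continuous_exp.comp hrc').smul η.continuous)).Icc_extend'
  have hliftI : ∀ η (t : ℝ) (ht : t ∈ Icc 0 T), lift η t = Real.exp (r t) • η ⟨t, ht⟩ :=
    fun η t ht => IccExtend_of_mem hT _ ht
  have hcont : ∀ η, ContinuousOn (fun t => ∫ τ in (0 : ℝ)..t, H τ (lift η τ)) (Icc 0 T) := by
    intro η
    rw [← huIcc]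
    exact (HasAEDeriv.of_integral (hint _ (hlift η)) fun t _ => by simp).continuousOn
  let Φ : C(Icc (0 : ℝ) T, E) → C(Icc (0 : ℝ) T, E) := fun η =>
    ⟨fun t => Real.exp (-(r t)) • (y₀ + ∫ τ in (0 : ℝ)..t, H τ (lift η τ)),
      (Real.continuous_exp.comp hrc'.neg).smul
        (continuous_const.add (continuousOn_iff_continuous_domRestrict.1 (hcont η)))⟩
  have hΦ : ContractingWith (1 / 2) Φ := by
    refine ⟨by rw [← NNReal.coe_lt_coe]; norm_num, LipschitzWith.of_dist_le_mul fun η ζ => ?_⟩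
    rw [ContinuousMap.dist_le (by positivity)]
    intro t
    have ht : (t : ℝ) ∈ uIcc 0 T := by rw [huIcc]; exact t.2
    have hs := uIcc_subset_uIcc_left ht
    have i1 := (hint _ (hlift η)).mono_set hs
    have i2 := (hint _ (hlift ζ)).mono_set hs
    obtain ⟨i3, i4⟩ := integral_mul_exp_integral hL ht
    have e1 : ‖∫ τ in (0 : ℝ)..t, (H τ (lift η τ) - H τ (lift ζ τ))‖
        ≤ ∫ τ in (0 : ℝ)..t, L τ * Real.exp (r τ) * dist η ζ := by
      refine intervalIntegral.norm_integral_le_of_norm_le t.2.1 ?_ (i3.mul_const _)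
      refine Eventually.of_forall fun τ hτ => ?_
      have hτ' : τ ∈ Icc 0 T := ⟨hτ.1.le, hτ.2.trans t.2.2⟩
      refine (hlip _ _ _).trans ?_
      rw [hliftI _ _ hτ', hliftI _ _ hτ', ← smul_sub, norm_smul, Real.norm_eq_abs, Real.abs_exp,
        ← mul_assoc, ← dist_eq_norm]
      exact mul_le_mul_of_nonneg_left (ContinuousMap.dist_apply_le_dist _)
        (mul_nonneg (hL0 τ) (Real.exp_pos _).le)
    rw [intervalIntegral.integral_mul_const, i4, intervalIntegral.integral_sub i1 i2] at e1
    change dist (Real.exp (-(r t)) • (y₀ + ∫ τ in (0 : ℝ)..t, H τ (lift η τ)))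
      (Real.exp (-(r t)) • (y₀ + ∫ τ in (0 : ℝ)..t, H τ (lift ζ τ))) ≤ _
    rw [dist_eq_norm, ← smul_sub, add_sub_add_left_eq_sub, norm_smul, Real.norm_eq_abs,
      Real.abs_exp]
    have e2 : Real.exp (-(r t)) * Real.exp (r t) = 1 := by rw [← Real.exp_add]; simp
    have e3 : 0 < Real.exp (-(r t)) := Real.exp_pos _
    have e4 : 0 ≤ dist η ζ := dist_nonneg
    calc _ ≤ Real.exp (-(r t)) * ((Real.exp (r t) - 1) / 2 * dist η ζ) := by gcongr
      _ = (Real.exp (-(r t)) * Real.exp (r t) - Real.exp (-(r t))) / 2 * dist η ζ := by ring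
      _ ≤ 1 / 2 * dist η ζ := by rw [e2]; gcongr; linarith
      _ = _ := by norm_num
  let η := ContractingWith.fixedPoint Φ hΦ
  have hη : Φ η = η := hΦ.fixedPoint_isFixedPt
  refine ⟨lift η, hlift η, fun t ht => ?_⟩
  rw [hliftI η t ht]
  have h1 : η ⟨t, ht⟩ = Real.exp (-(r t)) • (y₀ + ∫ τ in (0 : ℝ)..t, H τ (lift η τ)) :=
    (DFunLike.congr_fun hη ⟨t, ht⟩).symm
  rw [h1, smul_smul, ← Real.exp_add, add_neg_cancel, Real.exp_zero, one_smul]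

end Caratheodory

/-! ### Chords of a level set: tangency, output bound, coercivity. -/

section StaticEstimates

variable {E F V W : Type*} [NormedAddCommGroup E] [NormedSpace ℝ E]
  [NormedAddCommGroup F] [NormedSpace ℝ F] [NormedAddCommGroup V] [NormedSpace ℝ V]
  [NormedAddCommGroup W] [NormedSpace ℝ W]

/-- Chords of the zero set of `h` are almost tangent: here `R` is a right inverse of `Dh`. -/
theorem exists_delta_tangent_defect {h : E → F} {R : E → F →L[ℝ] E} {K : Set E}
    (hK : IsCompact K) (hh : ∀ x ∈ K, ContDiffAt ℝ 1 h x) (h0 : ∀ x ∈ K, h x = 0)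
    (hRc : ContinuousOn R K) {η : ℝ} (hη : 0 < η) :
    ∃ δ > 0, ∀ x ∈ K, ∀ y ∈ K, dist y x < δ → ‖R x (fderiv ℝ h x (y - x))‖ ≤ η * ‖y - x‖ := by
  obtain ⟨r, hr0, hr⟩ := exists_norm_le_of_continuousOn hK hRc
  obtain ⟨δ, hδ, H⟩ := uniformly_differentiable_of_contDiffAt hK hh
    (ε := η / (r + 1)) (by positivity)
  refine ⟨δ, hδ, fun x hx y hy hxy => ?_⟩
  have h1 := H x hx y hxy
  -- As `h` vanishes at both ends, `Dh(x)(y - x)` is nothing but the Taylor remainder.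
  rw [h0 x hx, h0 y hy, sub_zero, zero_sub, norm_neg] at h1
  calc _ ≤ ‖R x‖ * ‖fderiv ℝ h x (y - x)‖ := (R x).le_opNorm _
    _ ≤ (r + 1) * (η / (r + 1) * ‖y - x‖) := by
      gcongr
      linarith [hr x hx]
    _ = η * ‖y - x‖ := by field_simp

/-- The difference is `B ξ (ξ - ζ) + B (ξ - ζ) ζ`; the constant is `3 = 1 + 2` because `‖ζ‖ ≤ 2‖ξ‖`.
-/
theorem abs_bilin_sub_le (B : E →L[ℝ] E →L[ℝ] ℝ) {ξ ζ : E} {η : ℝ}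
    (hη : η ≤ 1)
    (h : ‖ξ - ζ‖ ≤ η * ‖ξ‖) : |B ξ ξ - B ζ ζ| ≤ 3 * ‖B‖ * η * ‖ξ‖ ^ 2 := by
  have e1 : ‖ζ‖ ≤ 2 * ‖ξ‖ := by
    have : ‖ζ‖ ≤ ‖ξ‖ + ‖ξ - ζ‖ := by
      calc ‖ζ‖ = ‖ξ - (ξ - ζ)‖ := by congr 1; abel
        _ ≤ _ := norm_sub_le _ _
    nlinarith [norm_nonneg ξ]
  have e2 : B ξ ξ - B ζ ζ = B ξ (ξ - ζ) + B (ξ - ζ) ζ := by simp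
  have e0 : 0 ≤ η * ‖ξ‖ := (norm_nonneg _).trans h
  rw [e2]
  calc |B ξ (ξ - ζ) + B (ξ - ζ) ζ| ≤ ‖B ξ (ξ - ζ)‖ + ‖B (ξ - ζ) ζ‖ := abs_add_le _ _
    _ ≤ ‖B‖ * ‖ξ‖ * ‖ξ - ζ‖ + ‖B‖ * ‖ξ - ζ‖ * ‖ζ‖ :=
        add_le_add (B.le_opNorm₂ _ _) (B.le_opNorm₂ _ _)
    _ ≤ ‖B‖ * ‖ξ‖ * (η * ‖ξ‖) + ‖B‖ * (η * ‖ξ‖) * (2 * ‖ξ‖) := by gcongr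
    _ = _ := by ring

/-- The bound `‖DΓ(x) ξ‖² ≤ κ Q(x)(ξ, ξ)` on tangent vectors passes to short chords. -/
theorem exists_delta_output_bound {h : E → F} {R : E → F →L[ℝ] E} {K : Set E}
    (hK : IsCompact K) (hh : ∀ x ∈ K, ContDiffAt ℝ 1 h x) (h0 : ∀ x ∈ K, h x = 0)
    (hRc : ContinuousOn R K) (hR : ∀ x ∈ K, ∀ y, fderiv ℝ h x (R x y) = y)
    {Q : E → E →L[ℝ] E →L[ℝ] ℝ} (hQ : ContinuousOn Q K) {Γ : E → W}
    (hΓ : ∀ x ∈ K, ContDiffAt ℝ 1 Γ x) {κ : ℝ} (hκ : 0 ≤ κ)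
    (hb : ∀ x ∈ K, ∀ ξ, fderiv ℝ h x ξ = 0 → ‖fderiv ℝ Γ x ξ‖ ^ 2 ≤ κ * Q x ξ ξ)
    {ε : ℝ} (hε : 0 < ε) :
    ∃ δ > 0, ∀ x ∈ K, ∀ y ∈ K, dist y x < δ →
      ‖Γ y - Γ x‖ ^ 2 ≤ κ * Q x (y - x) (y - x) + ε * ‖y - x‖ ^ 2 := by
  obtain ⟨q, hq0, hq⟩ := exists_norm_le_of_continuousOn (F := E →L[ℝ] E →L[ℝ] ℝ) hK hQ
  obtain ⟨g, hg0, hg⟩ := exists_norm_fderiv_le hK hΓ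
  -- `C` dominates the coefficients of `η ‖ξ‖²` in the errors `h5` and `h9`, so `η C ≤ ε` suffices.
  set C := 3 * κ * q + (2 * g + g + 1) * (g + 1) + 4 * g * (g + 1) + 1 with hC
  have hCpos : 0 < C := by positivity
  set η := min 1 (ε / C) with hηdef
  have hη : 0 < η := by positivity
  have hη1 : η ≤ 1 := min_le_left _ _
  have hηC : η * C ≤ ε := by
    calc η * C ≤ ε / C * C := by gcongr; exact min_le_right _ _
      _ = ε := by field_simp
  obtain ⟨δ₁, hδ₁, H₁⟩ := exists_delta_tangent_defect hK hh h0 hRc hη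
  obtain ⟨δ₂, hδ₂, H₂⟩ := uniformly_differentiable_of_contDiffAt hK hΓ hη
  refine ⟨min δ₁ δ₂, lt_min hδ₁ hδ₂, fun x hx y hy hxy => ?_⟩
  have h1 := H₁ x hx y hy (hxy.trans_le (min_le_left _ _))
  have h2 := H₂ x hx y (hxy.trans_le (min_le_right _ _))
  set ξ := y - x with hξ
  -- The tangential part of the chord: the tangent-space hypothesis applies to it, and it lies
  -- within `η ‖ξ‖` of `ξ`.
  set ζ := ξ - R x (fderiv ℝ h x ξ) with hζ
  have hξζ : ‖ξ - ζ‖ ≤ η * ‖ξ‖ := by simpa [hζ] using h1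
  have hker : fderiv ℝ h x ζ = 0 := by rw [hζ, map_sub, hR x hx, sub_self]
  have h3 := hb x hx ζ hker
  have h4 := abs_bilin_sub_le (Q x) hη1 hξζ
  have h5 : κ * Q x ζ ζ ≤ κ * Q x ξ ξ + 3 * κ * q * η * ‖ξ‖ ^ 2 := by
    have e1 : Q x ζ ζ ≤ Q x ξ ξ + 3 * q * η * ‖ξ‖ ^ 2 := by
      have : 3 * ‖Q x‖ * η * ‖ξ‖ ^ 2 ≤ 3 * q * η * ‖ξ‖ ^ 2 := by
        gcongr; exact hq x hx
      linarith [(abs_le.1 h4).1]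
    nlinarith
  have h6 : ‖fderiv ℝ Γ x (ξ - ζ)‖ ≤ g * (η * ‖ξ‖) :=
    ((fderiv ℝ Γ x).le_opNorm _).trans (by gcongr; exact hg x hx)
  have h7 : ‖Γ y - Γ x‖ ≤ ‖fderiv ℝ Γ x ζ‖ + (g + 1) * (η * ‖ξ‖) := by
    have : Γ y - Γ x = fderiv ℝ Γ x ζ + fderiv ℝ Γ x (ξ - ζ)
        + (Γ y - Γ x - fderiv ℝ Γ x ξ) := by
      have e1 : fderiv ℝ Γ x (ξ - ζ) = fderiv ℝ Γ x ξ - fderiv ℝ Γ x ζ := map_sub _ _ _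
      rw [e1]; abel
    rw [this]
    refine (norm_add₃_le).trans ?_
    linarith
  have h8 : ‖fderiv ℝ Γ x ζ‖ ≤ g * (2 * ‖ξ‖) := by
    refine ((fderiv ℝ Γ x).le_opNorm _).trans ?_
    have : ‖ζ‖ ≤ 2 * ‖ξ‖ := by
      calc ‖ζ‖ = ‖ξ - (ξ - ζ)‖ := by congr 1; abel
        _ ≤ ‖ξ‖ + ‖ξ - ζ‖ := norm_sub_le _ _
        _ ≤ 2 * ‖ξ‖ := by nlinarith [norm_nonneg ξ]
    gcongr
    exact hg x hx
  have h9 : ‖Γ y - Γ x‖ ^ 2 ≤ ‖fderiv ℝ Γ x ζ‖ ^ 2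
      + ((2 * g + g + 1) * (g + 1) + 2 * g * (g + 1)) * η * ‖ξ‖ ^ 2 := by
    have e1 : ‖Γ y - Γ x‖ ^ 2 ≤ (‖fderiv ℝ Γ x ζ‖ + (g + 1) * (η * ‖ξ‖)) ^ 2 := by gcongr
    have e2 : ‖fderiv ℝ Γ x ζ‖ * ((g + 1) * (η * ‖ξ‖)) ≤
        g * (2 * ‖ξ‖) * ((g + 1) * (η * ‖ξ‖)) := by gcongr
    have e3 : (g + 1) * (η * ‖ξ‖) * ((g + 1) * (η * ‖ξ‖)) ≤
        (g + 1) * (1 * ‖ξ‖) * ((g + 1) * (η * ‖ξ‖)) := by gcongr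
    have e4 : 0 ≤ g * (g + 1) * η * ‖ξ‖ ^ 2 := by positivity
    nlinarith
  have h10 : η * C * ‖ξ‖ ^ 2 ≤ ε * ‖ξ‖ ^ 2 := by gcongr
  have h11 : 0 ≤ (2 * g * (g + 1) + 1) * η * ‖ξ‖ ^ 2 := by positivity
  rw [hC] at h10
  nlinarith

/-- Coercivity of `Q` on tangent vectors passes to short chords. -/
theorem exists_delta_coercive {h : E → F} {R : E → F →L[ℝ] E} {K : Set E}
    (hK : IsCompact K) (hh : ∀ x ∈ K, ContDiffAt ℝ 1 h x) (h0 : ∀ x ∈ K, h x = 0)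
    (hRc : ContinuousOn R K) (hR : ∀ x ∈ K, ∀ y, fderiv ℝ h x (R x y) = y)
    {Q : E → E →L[ℝ] E →L[ℝ] ℝ} (hQ : ContinuousOn Q K) {c : ℝ} (hc : 0 < c)
    (hb : ∀ x ∈ K, ∀ ξ, fderiv ℝ h x ξ = 0 → c * ‖ξ‖ ^ 2 ≤ Q x ξ ξ) :
    ∃ δ > 0, ∀ x ∈ K, ∀ y ∈ K, dist y x < δ →
      c / 2 * ‖y - x‖ ^ 2 ≤ Q x (y - x) (y - x) := by
  -- Coercivity is the output bound for the identity map with `κ = 1/c`; the error `‖y - x‖²/2` is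
  -- absorbed on the left.
  obtain ⟨δ, hδ, H⟩ := exists_delta_output_bound hK hh h0 hRc hR hQ (Γ := fun x : E => x)
    (fun x _ => contDiffAt_id) (κ := c⁻¹) (by positivity) (fun x hx ξ hξ => by
      have := hb x hx ξ hξ
      rw [fderiv_fun_id, ContinuousLinearMap.id_apply, inv_mul_eq_div, le_div_iff₀ hc]
      linarith) (ε := 1 / 2) (by norm_num)
  refine ⟨δ, hδ, fun x hx y hy hxy => ?_⟩
  have h1 := H x hx y hy hxy
  have h2 : c * (1 / 2 * ‖y - x‖ ^ 2) ≤ c * (c⁻¹ * Q x (y - x) (y - x)) := by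
    refine mul_le_mul_of_nonneg_left ?_ hc.le
    linarith
  rw [mul_inv_cancel_left₀ hc.ne'] at h2
  linarith

end StaticEstimates

/-! ### The contraction inequality on short chords. -/

section EnergyRate

variable {E F V : Type*} [NormedAddCommGroup E] [NormedSpace ℝ E]
  [NormedAddCommGroup F] [NormedSpace ℝ F] [NormedAddCommGroup V] [NormedSpace ℝ V]

theorem norm_le_two_mul_of_norm_sub_le {E : Type*} [NormedAddCommGroup E] {ξ ζ : E} {η : ℝ}
    (hη : η ≤ 1)
    (h : ‖ξ - ζ‖ ≤ η * ‖ξ‖) : ‖ζ‖ ≤ 2 * ‖ξ‖ := by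
  calc ‖ζ‖ = ‖ξ - (ξ - ζ)‖ := by congr 1; abel
    _ ≤ ‖ξ‖ + ‖ξ - ζ‖ := norm_sub_le _ _
    _ ≤ 2 * ‖ξ‖ := by nlinarith [norm_nonneg ξ]

/-- Comparison of the increment of a parametrised vector field along a short chord with its
derivative in a nearby tangent direction, both paired with a bilinear form. -/
theorem abs_bilin_increment_sub_le (B : E →L[ℝ] E →L[ℝ] ℝ) (D : E →L[ℝ] V →L[ℝ] E)
    (G₀ G₁ : V →L[ℝ] E) {q g d η : ℝ} (hB : ‖B‖ ≤ q) (hG : ‖G₀‖ ≤ g) (hD : ‖D‖ ≤ d)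
    {ξ ζ : E} (hη1 : η ≤ 1) (hξη : ‖ξ‖ ≤ η) (hξζ : ‖ξ - ζ‖ ≤ η * ‖ξ‖)
    (hlin : ‖G₁ - G₀ - D ξ‖ ≤ η * ‖ξ‖) (v w : V) :
    |B ξ (G₁ (v + w) - G₀ v) - B ζ (D ζ v + G₀ w)| ≤
      η * (q * (3 * d + 1) * (‖v‖ * ‖ξ‖ ^ 2) + q * (1 + d + g) * (‖ξ‖ * ‖w‖)) := by
  have hq : 0 ≤ q := (norm_nonneg B).trans hB
  have hg : 0 ≤ g := (norm_nonneg G₀).trans hG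
  have hd : 0 ≤ d := (norm_nonneg D).trans hD
  have hη : 0 ≤ η := (norm_nonneg _).trans hξη
  have hζ := norm_le_two_mul_of_norm_sub_le hη1 hξζ
  have hBB : ∀ a b : E, |B a b| ≤ q * ‖a‖ * ‖b‖ := fun a b =>
    (B.le_opNorm₂ a b).trans (by gcongr)
  have hDD : ∀ a : E, ‖D a‖ ≤ d * ‖a‖ := fun a => (D.le_opNorm a).trans (by gcongr)
  have hinc : ‖G₁ - G₀‖ ≤ (1 + d) * ‖ξ‖ := by
    calc ‖G₁ - G₀‖ = ‖(G₁ - G₀ - D ξ) + D ξ‖ := by congr 1; abel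
      _ ≤ η * ‖ξ‖ + d * ‖ξ‖ := (norm_add_le _ _).trans (add_le_add hlin (hDD ξ))
      _ ≤ (1 + d) * ‖ξ‖ := by nlinarith [norm_nonneg ξ]
  -- Each of the five terms contains one factor of order `η`: the linearisation error, the defect `ξ
  -- - ζ`, or, in the fourth term, the length of `ξ` itself.
  have key : B ξ (G₁ (v + w) - G₀ v) - B ζ (D ζ v + G₀ w)
      = B ξ ((G₁ - G₀ - D ξ) v) + B ξ (D (ξ - ζ) v) + B (ξ - ζ) (D ζ v)
        + B ξ ((G₁ - G₀) w) + B (ξ - ζ) (G₀ w) := by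
    simp only [map_add, map_sub, _root_.sub_apply]
    ring
  have b1 : |B ξ ((G₁ - G₀ - D ξ) v)| ≤ q * ‖ξ‖ * (η * ‖ξ‖ * ‖v‖) :=
    (hBB _ _).trans (by gcongr; exact ((G₁ - G₀ - D ξ).le_opNorm v).trans (by gcongr))
  have b2 : |B ξ (D (ξ - ζ) v)| ≤ q * ‖ξ‖ * (d * (η * ‖ξ‖) * ‖v‖) :=
    (hBB _ _).trans (by
      gcongr
      exact ((D (ξ - ζ)).le_opNorm v).trans (by gcongr; exact (hDD _).trans (by gcongr)))
  have b3 : |B (ξ - ζ) (D ζ v)| ≤ q * (η * ‖ξ‖) * (d * (2 * ‖ξ‖) * ‖v‖) :=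
    (hBB _ _).trans (by
      gcongr
      exact ((D ζ).le_opNorm v).trans (by gcongr; exact (hDD _).trans (by gcongr)))
  have b4 : |B ξ ((G₁ - G₀) w)| ≤ q * η * ((1 + d) * ‖ξ‖ * ‖w‖) :=
    (hBB _ _).trans (by gcongr; exact ((G₁ - G₀).le_opNorm w).trans (by gcongr))
  have b5 : |B (ξ - ζ) (G₀ w)| ≤ q * (η * ‖ξ‖) * (g * ‖w‖) :=
    (hBB _ _).trans (by gcongr; exact (G₀.le_opNorm w).trans (by gcongr))
  rw [key]
  refine (abs_add_le _ _).trans ?_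
  refine (add_le_add_left ((abs_add_le _ _).trans
    (add_le_add_left ((abs_add_three _ _ _).trans (add_le_add (add_le_add b1 b2) b3)) _)) _).trans ?_
  refine (add_le_add (add_le_add le_rfl b4) b5).trans (le_of_eq ?_)
  ring

/-- The infinitesimal contraction inequality on tangent vectors passes to short chords, up to an
arbitrarily small error. -/
theorem exists_delta_energy_rate {h : E → F} {R : E → F →L[ℝ] E} {K Y : Set E}
    (hK : IsCompact K) (hY : IsCompact Y) (hh : ∀ x ∈ K, ContDiffAt ℝ 1 h x)
    (h0 : ∀ x ∈ K, h x = 0)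
    (hRc : ContinuousOn R K) (hR : ∀ x ∈ K, ∀ y, fderiv ℝ h x (R x y) = y)
    {Q : E → E →L[ℝ] E →L[ℝ] ℝ} (hQ : ∀ x ∈ K, ContDiffAt ℝ 1 Q x)
    {G : E × E → V →L[ℝ] E} (hG : ∀ x ∈ K, ∀ z ∈ Y, ContDiffAt ℝ 1 G (x, z))
    {𝒱 Ω : Set V} {lam μ : ℝ} (hlam : 0 < lam)
    (hlmi : ∀ x ∈ K, ∀ z ∈ Y, ∀ v ∈ 𝒱, ∀ w ∈ Ω, ∀ ξ, fderiv ℝ h x ξ = 0 →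
      fderiv ℝ Q x (G (x, z) v) ξ ξ + 2 * Q x ξ (fderiv ℝ G (x, z) (ξ, 0) v + G (x, z) w)
        ≤ -(2 * lam) * Q x ξ ξ + μ * ‖w‖ ^ 2)
    {ε : ℝ} (hε : 0 < ε) :
    ∃ δ > 0, ∀ x ∈ K, ∀ y ∈ K, dist y x < δ → ∀ z ∈ Y, ∀ v ∈ 𝒱, ∀ w ∈ Ω,
      fderiv ℝ Q x (G (x, z) v) (y - x) (y - x) + 2 * Q x (y - x) (G (y, z) (v + w) - G (x, z) v)
        ≤ -(2 * lam) * Q x (y - x) (y - x) + μ * ‖w‖ ^ 2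
          + ε * (1 + ‖v‖) * ‖y - x‖ ^ 2 + ε * ‖w‖ ^ 2 := by
  have hKY : IsCompact (K ×ˢ Y) := hK.prod hY
  have hG' : ∀ p ∈ K ×ˢ Y, ContDiffAt ℝ 1 G p := fun p hp => hG p.1 hp.1 p.2 hp.2
  obtain ⟨q, hq0, hq⟩ := exists_norm_le_of_continuousOn (F := E →L[ℝ] E →L[ℝ] ℝ) hK
    fun x hx => (hQ x hx).continuousAt.continuousWithinAt
  obtain ⟨e, he0, he⟩ := exists_norm_fderiv_le hK hQ
  obtain ⟨g, hg0, hg⟩ := exists_norm_le_of_continuousOn (F := V →L[ℝ] E) hKY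
    fun x hx => (hG' x hx).continuousAt.continuousWithinAt
  obtain ⟨d, hd0, hd⟩ := exists_norm_fderiv_le hKY hG'
  -- Every error is `η` times a constant times `(1 + ‖v‖) ‖ξ‖²` or `‖w‖²`. Linearity in `‖v‖`
  -- matters: inputs are only integrable in time, and the error rate has to be integrable too.
  set C := 3 * (e * g) + 2 * (q * (3 * d + 1)) + q * (1 + d + g) + 2 * lam * (3 * q) + 1 with hC
  have hCpos : 0 < C := by positivity
  set η := min 1 (ε / C) with hηdef
  have hη : 0 < η := by positivity
  have hη1 : η ≤ 1 := min_le_left _ _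
  have hηC : η * C ≤ ε := by
    calc η * C ≤ ε / C * C := by gcongr; exact min_le_right _ _
      _ = ε := by field_simp
  obtain ⟨δ₁, hδ₁, H₁⟩ := exists_delta_tangent_defect hK hh h0 hRc hη
  obtain ⟨δ₂, hδ₂, H₂⟩ := uniformly_differentiable_of_contDiffAt hKY hG' hη
  refine ⟨min η (min δ₁ δ₂), by positivity, fun x hx y hy hxy z hz v hv w hw => ?_⟩
  have hxη : ‖y - x‖ ≤ η := by
    rw [← dist_eq_norm]; exact (hxy.trans_le (min_le_left _ _)).le
  have hxy' := hxy.trans_le (min_le_right _ _)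
  have h1 := H₁ x hx y hy (hxy'.trans_le (min_le_left _ _))
  have h2 := H₂ (x, z) ⟨hx, hz⟩ (y, z) (by
    rw [Prod.dist_eq, dist_self]
    exact max_lt (hxy'.trans_le (min_le_right _ _)) hδ₂)
  have hpair : ((y, z) : E × E) - (x, z) = (y - x, 0) := by simp
  have hnp : ‖((y - x, 0) : E × E)‖ = ‖y - x‖ := by simp [Prod.norm_def]
  rw [hpair, hnp] at h2
  set ξ := y - x with hξ
  set ζ := ξ - R x (fderiv ℝ h x ξ) with hζ
  have hξζ : ‖ξ - ζ‖ ≤ η * ‖ξ‖ := by simpa [hζ] using h1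
  have hker : fderiv ℝ h x ζ = 0 := by rw [hζ, map_sub, hR x hx, sub_self]
  have h3 := hlmi x hx z hz v hv w hw ζ hker
  have h4 := abs_bilin_sub_le (Q x) hη1 hξζ
  have h5 := abs_bilin_sub_le (fderiv ℝ Q x (G (x, z) v)) hη1 hξζ
  have hD : ‖(fderiv ℝ G (x, z)).comp (ContinuousLinearMap.inl ℝ E E)‖ ≤ d := by
    refine ContinuousLinearMap.opNorm_le_bound _ hd0 fun a => ?_
    have hna : ‖((a, 0) : E × E)‖ = ‖a‖ := by simp [Prod.norm_def]
    have := ((fderiv ℝ G (x, z)).le_opNorm (a, 0)).trans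
      (mul_le_mul_of_nonneg_right (hd (x, z) ⟨hx, hz⟩) (norm_nonneg _))
    rwa [hna] at this
  have h6 := abs_bilin_increment_sub_le (Q x)
    ((fderiv ℝ G (x, z)).comp (ContinuousLinearMap.inl ℝ E E)) (G (x, z)) (G (y, z))
    (hq x hx) (hg (x, z) ⟨hx, hz⟩) hD hη1 hxη hξζ h2 v w
  have hDz : (fderiv ℝ G (x, z)).comp (ContinuousLinearMap.inl ℝ E E) ζ
    = fderiv ℝ G (x, z) (ζ, 0) := rfl
  rw [hDz] at h6
  have b1 : 3 * ‖Q x‖ * η * ‖ξ‖ ^ 2 ≤ 3 * q * η * ‖ξ‖ ^ 2 := by gcongr; exact hq x hx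
  have b2 : 3 * ‖fderiv ℝ Q x (G (x, z) v)‖ * η * ‖ξ‖ ^ 2
      ≤ 3 * (e * (g * ‖v‖)) * η * ‖ξ‖ ^ 2 := by
    gcongr
    refine (ContinuousLinearMap.le_opNorm (F := E →L[ℝ] E →L[ℝ] ℝ) (fderiv ℝ Q x) _).trans ?_
    gcongr
    · exact he x hx
    · exact ((G (x, z)).le_opNorm v).trans (by gcongr; exact hg (x, z) ⟨hx, hz⟩)
  -- Splitting the mixed error `‖ξ‖ ‖w‖` is the source of the separate term `ε ‖w‖²` in the
  -- conclusion.
  have b3 : 2 * (‖ξ‖ * ‖w‖) ≤ ‖ξ‖ ^ 2 + ‖w‖ ^ 2 := by nlinarith [sq_nonneg (‖ξ‖ - ‖w‖)]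
  have hv0 := norm_nonneg v
  have c1 := (abs_le.1 h4).1
  have c2 := (abs_le.1 h5).2
  have c3 := (abs_le.1 h6).2
  have c4 : η * C * ((1 + ‖v‖) * ‖ξ‖ ^ 2) ≤ ε * ((1 + ‖v‖) * ‖ξ‖ ^ 2) := by gcongr
  have c5 : η * C * ‖w‖ ^ 2 ≤ ε * ‖w‖ ^ 2 := by gcongr
  have c6 : η * (q * (1 + d + g)) * (2 * (‖ξ‖ * ‖w‖)) ≤
      η * (q * (1 + d + g)) * (‖ξ‖ ^ 2 + ‖w‖ ^ 2) := by gcongr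
  have c7 : 2 * lam * (Q x ξ ξ - Q x ζ ζ) ≤ 2 * lam * (3 * q * η * ‖ξ‖ ^ 2) := by
    have := (abs_le.1 h4).2
    gcongr
    linarith
  have c8 : η * (3 * (e * g) + 2 * (q * (3 * d + 1))) * (‖v‖ * ‖ξ‖ ^ 2)
      + η * (q * (1 + d + g)) * (‖ξ‖ ^ 2 + ‖w‖ ^ 2) + 2 * lam * (3 * q * η * ‖ξ‖ ^ 2)
      ≤ η * C * ((1 + ‖v‖) * ‖ξ‖ ^ 2) + η * C * ‖w‖ ^ 2 := by
    have n1 : 0 ≤ η * (3 * (e * g) + 2 * (q * (3 * d + 1)) + 1) * ‖ξ‖ ^ 2 := by positivity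
    have n2 : 0 ≤ η * (q * (1 + d + g) + 2 * lam * (3 * q) + 1) * (‖v‖ * ‖ξ‖ ^ 2) := by
      positivity
    have n3 : 0 ≤ η * (3 * (e * g) + 2 * (q * (3 * d + 1)) + 2 * lam * (3 * q) + 1) * ‖w‖ ^ 2 := by
      positivity
    rw [hC]
    linarith
  linarith

end EnergyRate

/-! ### Smooth right inverses of surjective linear maps. -/

section RightInverse

variable {E F : Type*} [NormedAddCommGroup E] [NormedSpace ℝ E] [FiniteDimensional ℝ E]
  [NormedAddCommGroup F] [InnerProductSpace ℝ F] [FiniteDimensional ℝ F]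

/-- Near a surjective linear map, a right inverse can be chosen depending smoothly on the map. -/
theorem exists_smooth_rightInverse :
    ∃ J : (E →L[ℝ] F) → (F →L[ℝ] E), ∀ A : E →L[ℝ] F, Function.Surjective A →
      ContDiffAt ℝ ∞ J A ∧ ∀ᶠ A' in 𝓝 A, ∀ w, A' (J A' w) = w := by
  have : CompleteSpace (F →L[ℝ] F) := FiniteDimensional.complete ℝ _
  let b := Module.finBasis ℝ E
  let β : F →L[ℝ] F →L[ℝ] ℝ := (isBoundedBilinearMap_inner (𝕜 := ℝ) (E := F)).toContinuousLinearMap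
  have hβ : ∀ x y, β x y = inner ℝ x y := fun _ _ => rfl
  -- `t A` is the adjoint `A*` for the inner product on `E` that makes `b` orthonormal. So `P A = A
  -- A*` satisfies `⟨P A w, w⟩ = ∑ⱼ ⟨A bⱼ, w⟩²`, which is positive for `w ≠ 0` when `A` is onto, and
  -- the right inverse is `A* (A A*)⁻¹`.
  let t : (E →L[ℝ] F) → (F →L[ℝ] E) := fun A => ∑ j, (β (A (b j))).smulRight (b j)
  have ht : ContDiff ℝ ∞ t := by
    refine ContDiff.sum fun j _ => ContDiff.smulRight ?_ contDiff_const
    exact β.contDiff.comp ((ContinuousLinearMap.apply ℝ F (b j)).contDiff)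
  let P : (E →L[ℝ] F) → (F →L[ℝ] F) := fun A => A.comp (t A)
  have hP : ContDiff ℝ ∞ P := contDiff_id.clm_comp ht
  have hunit : ∀ A : E →L[ℝ] F, Function.Surjective A → IsUnit (P A) := by
    intro A hA
    have hinj : Function.Injective (P A) := by
      rw [injective_iff_map_eq_zero]
      intro w hw
      have h1 : P A w = ∑ j, (inner ℝ (A (b j)) w) • A (b j) := by
        simp [P, t, hβ, _root_.sum_apply]
      have h2 : ∑ j, (inner ℝ (A (b j)) w : ℝ) ^ 2 = 0 := by
        have : inner ℝ (P A w) w = (0 : ℝ) := by rw [hw, inner_zero_left]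
        rw [h1, sum_inner] at this
        rw [← this]
        refine Finset.sum_congr rfl fun j _ => ?_
        rw [real_inner_smul_left, sq]
      have h3 : ∀ j, (inner ℝ (A (b j)) w : ℝ) = 0 := fun j => by
        have := (Finset.sum_eq_zero_iff_of_nonneg fun j _ => sq_nonneg _).1 h2 j (Finset.mem_univ j)
        exact pow_eq_zero_iff (two_ne_zero) |>.1 this
      obtain ⟨e, rfl⟩ := hA w
      have h4 : (((β.flip (A e)).comp A : E →L[ℝ] ℝ) : E →ₗ[ℝ] ℝ) = 0 := by
        refine b.ext fun j => ?_
        simpa [hβ] using h3 j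
      have h5 : (inner ℝ (A e) (A e) : ℝ) = 0 := by
        simpa [hβ] using LinearMap.congr_fun h4 e
      exact inner_self_eq_zero.1 h5
    have hsurj := LinearMap.injective_iff_surjective (f := (P A : F →ₗ[ℝ] F)).1 hinj
    exact ContinuousLinearMap.isUnit_iff_bijective.2 ⟨hinj, hsurj⟩
  refine ⟨fun A => (t A).comp (Ring.inverse (P A)), fun A hA => ⟨?_, ?_⟩⟩
  · have h1 : ContDiffAt ℝ ∞ (fun A => Ring.inverse (P A)) A := by
      obtain ⟨u, hu⟩ := hunit A hA
      have : ContDiffAt ℝ ∞ Ring.inverse (P A) := by rw [← hu]; exact contDiffAt_ringInverse ℝ u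
      exact this.comp A hP.contDiffAt
    exact ht.contDiffAt.clm_comp h1
  · have h1 : ∀ᶠ A' in 𝓝 A, IsUnit (P A') :=
      hP.continuous.continuousAt.eventually (Units.isOpen.mem_nhds (hunit A hA))
    filter_upwards [h1] with A' hA' w
    have : (P A' * Ring.inverse (P A')) w = w := by rw [Ring.mul_inverse_cancel _ hA']; rfl
    exact this

end RightInverse

/-! ### Trajectories confined to a level set. -/

section Trajectories

variable {E F V : Type*} [NormedAddCommGroup E] [NormedSpace ℝ E] [FiniteDimensional ℝ E]
  [NormedAddCommGroup F] [NormedSpace ℝ F] [NormedAddCommGroup V] [NormedSpace ℝ V]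

theorem exists_contDiff_cutoff {K U : Set E} (hK : IsCompact K) (hU : IsOpen U) (hKU : K ⊆ U) :
    ∃ χ : E → ℝ, ContDiff ℝ ∞ χ ∧ HasCompactSupport χ ∧ tsupport χ ⊆ U ∧ ∀ x ∈ K, χ x = 1 := by
  obtain ⟨W, hW, hKW, hWU, hWc⟩ := exists_open_between_and_isCompact_closure hK hU hKU
  obtain ⟨χ, hχ, -, hs, h1⟩ := exists_contMDiff_support_eq_eq_one_iff (n := (⊤ : ℕ∞))
    (modelWithCornersSelf ℝ E) hW hK.isClosed hKW
  have hts : tsupport χ = closure W := by rw [tsupport, hs]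
  exact ⟨χ, hχ.contDiff, by rwa [HasCompactSupport, hts], by rwa [hts], fun x hx => (h1 x).1 hx⟩

theorem contDiff_cutoff_smul {E : Type*} [NormedAddCommGroup E] [NormedSpace ℝ E] {U : Set E}
    {χ : E → ℝ} {φ : E → F} (hχ : ContDiff ℝ ∞ χ)
    (hs : tsupport χ ⊆ U) (hφ : ∀ x ∈ U, ContDiffAt ℝ 1 φ x) :
    ContDiff ℝ 1 fun x => χ x • φ x := by
  rw [contDiff_iff_contDiffAt]
  intro x
  by_cases hx : x ∈ tsupport χ
  · exact (hχ.of_le (by simp)).contDiffAt.smul (hφ x (hs hx))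
  · have h1 : (fun x => χ x • φ x) =ᶠ[𝓝 x] fun _ => 0 := by
      filter_upwards [notMem_tsupport_iff_eventuallyEq.1 hx] with y hy
      rw [hy]; simp
    exact contDiffAt_const.congr_of_eventuallyEq h1

/-- Trajectories of a tangent control system that stay in the zero set of `h` on a whole time
interval and satisfy the state equation as long as they lie in a prescribed compact set. -/
theorem exists_trajectory {h : E → F} {X : Set E} (hX : ∀ x, x ∈ X ↔ h x = 0)
    (hh : ContDiff ℝ ∞ h) {R : E → F →L[ℝ] E} (hR1 : ∀ x ∈ X, ContDiffAt ℝ 1 R x)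
    (hR : ∀ x ∈ X, ∀ᶠ y in 𝓝 x, ∀ w, fderiv ℝ h y (R y w) = w)
    {G : E × E → V →L[ℝ] E} (hG : ∀ x ∈ X, ∀ z ∈ X, ContDiffAt ℝ 1 G (x, z))
    (htan : ∀ x ∈ X, ∀ z ∈ X, ∀ v, fderiv ℝ h x (G (x, z) v) = 0)
    {K : Set E} (hK : IsCompact K) (hKX : K ⊆ X) {T : ℝ} (hT : 0 ≤ T)
    {z : ℝ → E} (hz : ContinuousOn z (Icc 0 T)) (hzX : ∀ t ∈ Icc 0 T, z t ∈ X)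
    {v : ℝ → V} (hv : IntervalIntegrable v volume 0 T) {y₀ : E} (hy₀ : y₀ ∈ X) :
    ∃ y y' : ℝ → E, HasAEDeriv 0 T y y' ∧ y 0 = y₀ ∧ (∀ t ∈ Icc 0 T, y t ∈ X) ∧
      ∀ t ∈ Icc 0 T, y t ∈ K → y' t = G (y t, z t) (v t) := by
  have huIcc : uIcc 0 T = Icc 0 T := uIcc_of_le hT
  -- Off `X` the field need not be tangent to the level sets of `h`. Subtracting `R Dh G` makes it
  -- so near `X` and changes nothing on `X`, where `Dh G = 0`.
  set N : E × E → V →L[ℝ] E := fun p =>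
    G p - (R p.1).comp ((fderiv ℝ h p.1).comp (G p)) with hN
  have hNC : ∀ x ∈ X, ∀ z ∈ X, ContDiffAt ℝ 1 N (x, z) := by
    intro x hx z hz
    have h1 : ContDiffAt ℝ 1 (fun p : E × E => R p.1) (x, z) :=
      (hR1 x hx).comp (x, z) contDiffAt_fst
    have h2 : ContDiff ℝ 1 (fderiv ℝ h) := hh.fderiv_right (m := 1) (by norm_cast)
    have h3 : ContDiffAt ℝ 1 (fun p : E × E => fderiv ℝ h p.1) (x, z) :=
      h2.contDiffAt.comp (x, z) contDiffAt_fst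
    exact (hG x hx z hz).sub (h1.clm_comp (h3.clm_comp (hG x hx z hz)))
  set U : Set (E × E) := {p | ∀ᶠ q in 𝓝 p, ContDiffAt ℝ 1 N q ∧
    ∀ w, fderiv ℝ h q.1 (R q.1 w) = w} with hU
  have hUo : IsOpen U := isOpen_setOfPred_eventually_nhds
  have hXU : X ×ˢ X ⊆ U := by
    rintro ⟨x, z⟩ ⟨hx, hz⟩
    exact ((hNC x hx z hz).eventually (by simp)).and
      ((continuous_fst.tendsto (x, z)).eventually (hR x hx))
  have hUs : ∀ p ∈ U, ContDiffAt ℝ 1 N p ∧ ∀ w, fderiv ℝ h p.1 (R p.1 w) = w :=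
    fun p hp =>
    Eventually.self_of_nhds (p := fun q : E × E => ContDiffAt ℝ 1 N q ∧
      ∀ w, fderiv ℝ h q.1 (R q.1 w) = w) hp
  have hZ : IsCompact (z '' Icc 0 T) := isCompact_Icc.image_of_continuousOn hz
  have hKZ : K ×ˢ (z '' Icc 0 T) ⊆ U := by
    refine Subset.trans (prod_mono hKX ?_) hXU
    rintro _ ⟨t, ht, rfl⟩
    exact hzX t ht
  obtain ⟨χ, hχ, hχc, hχU, hχ1⟩ := exists_contDiff_cutoff (hK.prod hZ) hUo hKZ
  -- The cutoff makes the field bounded and globally Lipschitz, hence solvable on all of `[0, T]`;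
  -- where `y t ∈ K` it equals `1`, so the original equation holds there.
  set Gc : E × E → V →L[ℝ] E := fun p => χ p • N p with hGc
  have hGcC : ContDiff ℝ 1 Gc := contDiff_cutoff_smul hχ hχU fun p hp => (hUs p hp).1
  have hGcs : HasCompactSupport Gc := hχc.smul_right
  obtain ⟨L, hL⟩ := ContDiff.lipschitzWith_of_hasCompactSupport hGcs hGcC one_ne_zero
  obtain ⟨C, hC⟩ := hGcs.exists_bound_of_continuous hGcC.continuous
  have htanc : ∀ p w, fderiv ℝ h p.1 (Gc p w) = 0 := by
    intro p w
    by_cases hp : p ∈ tsupport χ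
    · have h1 := (hUs p (hχU hp)).2
      simp [hGc, hN, h1]
    · have : χ p = 0 := image_eq_zero_of_notMem_tsupport hp
      simp [hGc, this]
  set zc : ℝ → E := IccExtend hT ((Icc 0 T).domRestrict z) with hzc
  have hzcc : Continuous zc := (continuousOn_iff_continuous_domRestrict.1 hz).Icc_extend'
  have hzcI : ∀ t ∈ Icc 0 T, zc t = z t := fun t ht => by
    rw [hzc, IccExtend_of_mem hT _ ht]; rfl
  have hint : ∀ η : ℝ → E, Continuous η →
      IntervalIntegrable (fun t => Gc (η t, zc t) (v t)) volume 0 T := by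
    intro η hη
    refine (hv.norm.const_mul C).mono_fun ?_ ?_
    · have hc : Continuous fun t => Gc (η t, zc t) := hGcC.continuous.comp (hη.prodMk hzcc)
      have := hv.def'.aestronglyMeasurable
      exact (isBoundedBilinearMap_apply (𝕜 := ℝ) (E := V)
        (F := E)).continuous.comp_aestronglyMeasurable
        (hc.aestronglyMeasurable.prodMk this)
    · refine Eventually.of_forall fun t => ?_
      refine ((Gc (η t, zc t)).le_opNorm (v t)).trans ?_
      refine (mul_le_mul_of_nonneg_right (hC _) (norm_nonneg _)).trans ?_
      exact Real.le_norm_self _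
  obtain ⟨y, hyc, hy⟩ := exists_caratheodory_solution hT (H := fun t x => Gc (x, zc t) (v t))
    (L := fun t => L * ‖v t‖) hint (hv.norm.const_mul _) (fun t => by positivity)
    (fun t x x' => by
      rw [← _root_.sub_apply]
      refine ((Gc (x, zc t) - Gc (x', zc t)).le_opNorm (v t)).trans ?_
      have := hL.dist_le_mul (x, zc t) (x', zc t)
      rw [dist_eq_norm, Prod.dist_eq, dist_self, max_eq_left dist_nonneg, dist_eq_norm] at this
      calc _ ≤ L * ‖x - x'‖ * ‖v t‖ := by gcongr
        _ = _ := by ring) y₀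
  have hy0 : y 0 = y₀ := by simpa using hy 0 ⟨le_rfl, hT⟩
  have hAE : HasAEDeriv 0 T y (fun t => Gc (y t, zc t) (v t)) :=
    HasAEDeriv.of_integral (hint y hyc) fun t ht => by rw [hy0]; exact hy t (huIcc ▸ ht)
  refine ⟨y, _, hAE, hy0, fun t ht => ?_, fun t ht htK => ?_⟩
  -- `h` is constant along `y`, because `Dh` annihilates the modified field everywhere.
  · have h1 := (hAE.comp (φ := h) fun t _ => (hh.of_le (by simp)).contDiffAt).eq_left_of_deriv_eq_zero
      (Eventually.of_forall fun t _ => htanc (y t, zc t) (v t)) t (huIcc ▸ ht)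
    rw [hX, h1, hy0]
    exact (hX _).1 hy₀
  · have h1 : χ (y t, zc t) = 1 := hχ1 _ ⟨htK, t, ht, (hzcI t ht).symm⟩
    simp only [hGc, h1, one_smul, hN]
    rw [hzcI t ht]
    simp [htan (y t) (hKX htK) (z t) (hzX t ht) (v t)]

end Trajectories

/-! ### Riemann sums and the discrete energy of a path. -/

section RiemannSums

theorem exists_riemann_sum_le {φ : ℝ → ℝ} (hφ : ContinuousOn φ (Icc 0 1)) {ε : ℝ} (hε : 0 < ε) :
    ∃ N₀ : ℕ, ∀ N : ℕ, N₀ < N →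
      ∑ j ∈ Finset.range N, φ (j / N) / N ≤ (∫ s in (0 : ℝ)..1, φ s) + ε := by
  have hu := isCompact_Icc.uniformContinuousOn_of_continuous hφ
  obtain ⟨δ, hδ, H⟩ := Metric.uniformContinuousOn_iff.1 hu ε hε
  obtain ⟨N₀, hN₀⟩ := exists_nat_one_div_lt hδ
  refine ⟨N₀ + 1, fun N hN => ?_⟩
  have hN0 : 0 < N := by omega
  have hNr : (0 : ℝ) < N := by exact_mod_cast hN0
  have hNδ : (1 : ℝ) / N < δ := by
    refine lt_of_le_of_lt ?_ hN₀
    gcongr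
    exact_mod_cast hN.le
  have hmem : ∀ j < N, (j : ℝ) / N ∈ Icc (0 : ℝ) 1 ∧ ((j + 1 : ℕ) : ℝ) / N ∈ Icc (0 : ℝ) 1 := by
    intro j hj
    have h1 : (j : ℝ) ≤ N := by exact_mod_cast hj.le
    have h2 : ((j + 1 : ℕ) : ℝ) ≤ N := by exact_mod_cast hj
    exact ⟨⟨by positivity, (div_le_one hNr).2 h1⟩, ⟨by positivity, (div_le_one hNr).2 h2⟩⟩
  have hsub : ∀ j < N, Icc ((j : ℝ) / N) (((j + 1 : ℕ) : ℝ) / N) ⊆ Icc 0 1 := fun j hj s hs =>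
    ⟨(hmem j hj).1.1.trans hs.1, hs.2.trans (hmem j hj).2.2⟩
  have hle : ∀ j : ℕ, (j : ℝ) / N ≤ ((j + 1 : ℕ) : ℝ) / N := fun j => by
    gcongr; exact_mod_cast Nat.le_succ j
  have hlen : ∀ j : ℕ, ((j + 1 : ℕ) : ℝ) / N - (j : ℝ) / N = 1 / N := fun j => by
    push_cast; ring
  have hint : ∀ j < N, IntervalIntegrable φ volume ((j : ℝ) / N) (((j + 1 : ℕ) : ℝ) / N) :=
    fun j hj => ContinuousOn.intervalIntegrable_of_Icc (hle j) (hφ.mono (hsub j hj))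
  have hsum := intervalIntegral.sum_integral_adjacent_intervals (μ := volume) (f := φ)
    (a := fun j : ℕ => (j : ℝ) / N) (n := N) fun j hj => hint j hj
  simp only [Nat.cast_zero, zero_div, div_self hNr.ne'] at hsum
  rw [← hsum]
  have key : ∀ j ∈ Finset.range N, φ (j / N) / N ≤
      (∫ s in ((j : ℝ) / N)..(((j + 1 : ℕ) : ℝ) / N), φ s) + ε / N := by
    intro j hj
    have hj' := Finset.mem_range.1 hj
    have h1 : (∫ _ in ((j : ℝ) / N)..(((j + 1 : ℕ) : ℝ) / N), (φ (j / N) - ε)) ≤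
        ∫ s in ((j : ℝ) / N)..(((j + 1 : ℕ) : ℝ) / N), φ s := by
      refine intervalIntegral.integral_mono_on (hle j) intervalIntegrable_const (hint j hj') ?_
      intro s hs
      have h2 := H _ (hmem j hj').1 s (hsub j hj' hs) (by
        rw [dist_comm, Real.dist_eq, abs_of_nonneg (by linarith [hs.1])]
        have := hlen j
        linarith [hs.2])
      rw [Real.dist_eq] at h2
      linarith [(abs_lt.1 h2).2]
    rw [intervalIntegral.integral_const, hlen, smul_eq_mul] at h1
    have h3 : 1 / (N : ℝ) * (φ (j / N) - ε) = φ (j / N) / N - ε / N := by ring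
    linarith
  refine (Finset.sum_le_sum key).trans ?_
  rw [Finset.sum_add_distrib, Finset.sum_const, Finset.card_range, nsmul_eq_mul,
    mul_div_cancel₀ _ hNr.ne']

variable {E : Type*} [NormedAddCommGroup E] [NormedSpace ℝ E]

/-- Chords of a `C¹` path are uniformly approximated by its derivative. -/
theorem exists_delta_chord {c : ℝ → E} (hc : ContDiffOn ℝ 1 c (Icc 0 1)) {η : ℝ} (hη : 0 < η) :
    ∃ δ > 0, ∀ s ∈ Icc (0 : ℝ) 1, ∀ s' ∈ Icc (0 : ℝ) 1, s ≤ s' → s' - s < δ →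
      ‖c s' - c s - (s' - s) • derivWithin c (Icc 0 1) s‖ ≤ η * (s' - s) := by
  have hd : ContinuousOn (derivWithin c (Icc 0 1)) (Icc 0 1) :=
    hc.continuousOn_derivWithin (uniqueDiffOn_Icc one_pos) le_rfl
  have hu := isCompact_Icc.uniformContinuousOn_of_continuous hd
  obtain ⟨δ, hδ, H⟩ := Metric.uniformContinuousOn_iff.1 hu η hη
  refine ⟨δ, hδ, fun s hs s' hs' hss hlt => ?_⟩
  set m := derivWithin c (Icc 0 1) s with hm
  have hsub : Icc s s' ⊆ Icc 0 1 := fun r hr => ⟨hs.1.trans hr.1, hr.2.trans hs'.2⟩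
  -- The mean value inequality is applied to `c r - r c'(s)`, whose derivative has norm at most `η`.
  have h1 : ∀ r ∈ Icc s s', HasDerivWithinAt (fun r => c r - r • m)
      (derivWithin c (Icc 0 1) r - m) (Icc s s') r := by
    intro r hr
    have e1 : HasDerivWithinAt c (derivWithin c (Icc 0 1) r) (Icc s s') r :=
      (((hc.differentiableOn one_ne_zero) r (hsub hr)).hasDerivWithinAt).mono hsub
    have e2 : HasDerivWithinAt (fun r : ℝ => r • m) ((1 : ℝ) • m) (Icc s s') r :=
      (hasDerivWithinAt_id r _).smul_const m
    rw [one_smul] at e2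
    exact e1.sub e2
  have h2 := (convex_Icc s s').norm_image_sub_le_of_norm_hasDerivWithin_le (C := η) h1
    (fun r hr => by
      have := H r (hsub hr) s hs (by
        rw [Real.dist_eq, abs_of_nonneg (by linarith [hr.1])]; linarith [hr.2])
      rw [dist_eq_norm] at this
      exact this.le) (left_mem_Icc.2 hss) (right_mem_Icc.2 hss)
  rw [Real.norm_eq_abs, abs_of_nonneg (by linarith)] at h2
  convert h2 using 2
  rw [sub_smul]; abel

/-- Discrete energies of the subdivisions of a `C¹` path. -/
theorem exists_chord_energy_le {c : ℝ → E} (hc : ContDiffOn ℝ 1 c (Icc 0 1))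
    {Q : E → E →L[ℝ] E →L[ℝ] ℝ} (hQ : ∀ s ∈ Icc (0 : ℝ) 1, ContinuousAt Q (c s))
    {ε : ℝ} (hε : 0 < ε) :
    ∃ N₀ : ℕ, ∀ N : ℕ, N₀ < N → ∀ j < N,
      (N : ℝ) ^ 2 * Q (c (j / N)) (c ((j + 1 : ℕ) / N) - c (j / N))
          (c ((j + 1 : ℕ) / N) - c (j / N))
        ≤ Q (c (j / N)) (derivWithin c (Icc 0 1) (j / N)) (derivWithin c (Icc 0 1) (j / N)) + ε ∧
      ‖c ((j + 1 : ℕ) / N) - c (j / N)‖ ≤ (‖derivWithin c (Icc 0 1) (j / N)‖ + 1) / N := by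
  have hd : ContinuousOn (derivWithin c (Icc 0 1)) (Icc 0 1) :=
    hc.continuousOn_derivWithin (uniqueDiffOn_Icc one_pos) le_rfl
  obtain ⟨M, hM⟩ := isCompact_Icc.exists_bound_of_continuousOn hd
  have hM0 : 0 ≤ M := (norm_nonneg _).trans (hM 0 (by simp))
  have hQc : ContinuousOn Q (c '' Icc 0 1) := by
    rintro _ ⟨s, hs, rfl⟩
    exact (hQ s hs).continuousWithinAt
  obtain ⟨q, hq0, hq⟩ := exists_norm_le_of_continuousOn (F := E →L[ℝ] E →L[ℝ] ℝ)
    (isCompact_Icc.image_of_continuousOn hc.continuousOn) hQc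
  set η := min 1 (ε / (q * (2 * M + 1) + 1)) with hη
  have hη0 : 0 < η := by positivity
  have hη1 : η ≤ 1 := min_le_left _ _
  have hηε : η * (q * (2 * M + 1) + 1) ≤ ε := by
    calc _ ≤ ε / (q * (2 * M + 1) + 1) * (q * (2 * M + 1) + 1) := by
          gcongr; exact min_le_right _ _
      _ = ε := by field_simp
  obtain ⟨δ, hδ, H⟩ := exists_delta_chord hc hη0
  obtain ⟨N₀, hN₀⟩ := exists_nat_one_div_lt hδ
  refine ⟨N₀ + 1, fun N hN j hj => ?_⟩
  have hN0 : 0 < N := by omega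
  have hNr : (0 : ℝ) < N := by exact_mod_cast hN0
  have hNδ : (1 : ℝ) / N < δ := by
    refine lt_of_le_of_lt ?_ hN₀
    gcongr
    exact_mod_cast hN.le
  have h1 : (j : ℝ) ≤ N := by exact_mod_cast hj.le
  have h2 : ((j + 1 : ℕ) : ℝ) ≤ N := by exact_mod_cast hj
  have hs : (j : ℝ) / N ∈ Icc (0 : ℝ) 1 := ⟨by positivity, (div_le_one hNr).2 h1⟩
  have hs' : ((j + 1 : ℕ) : ℝ) / N ∈ Icc (0 : ℝ) 1 := ⟨by positivity, (div_le_one hNr).2 h2⟩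
  have hlen : ((j + 1 : ℕ) : ℝ) / N - (j : ℝ) / N = 1 / N := by push_cast; ring
  have h3 := H _ hs _ hs' (by gcongr; omega) (by rw [hlen]; exact hNδ)
  rw [hlen] at h3
  set m := derivWithin c (Icc 0 1) ((j : ℝ) / N)
  set Δ := c ((j + 1 : ℕ) / N) - c (j / N)
  have hm : ‖m‖ ≤ M := hM _ hs
  have hB : ‖Q (c (j / N))‖ ≤ q := hq _ (mem_image_of_mem c hs)
  set B := Q (c (j / N))
  -- `N Δ` is a difference quotient close to `m`, so `N² B Δ Δ` is close to `B m m`.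
  have h4 : ‖(N : ℝ) • Δ - m‖ ≤ η := by
    have e1 : (N : ℝ) • Δ - m = (N : ℝ) • (Δ - (1 / (N : ℝ)) • m) := by
      rw [smul_sub (N : ℝ) Δ, smul_smul, mul_one_div_cancel hNr.ne', one_smul]
    rw [e1, norm_smul, Real.norm_eq_abs, abs_of_pos hNr]
    calc (N : ℝ) * ‖Δ - (1 / (N : ℝ)) • m‖ ≤ N * (η * (1 / N)) := by gcongr
      _ = η := by field_simp
  have h5 : ‖(N : ℝ) • Δ‖ ≤ ‖m‖ + 1 := by
    calc ‖(N : ℝ) • Δ‖ = ‖((N : ℝ) • Δ - m) + m‖ := by congr 1; abel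
      _ ≤ η + ‖m‖ := (norm_add_le _ _).trans (by gcongr)
      _ ≤ _ := by linarith
  refine ⟨?_, ?_⟩
  · have e1 : (N : ℝ) ^ 2 * B Δ Δ = B ((N : ℝ) • Δ) ((N : ℝ) • Δ) := by
      simp; ring
    have e2 : B ((N : ℝ) • Δ) ((N : ℝ) • Δ) - B m m
        = B ((N : ℝ) • Δ) ((N : ℝ) • Δ - m) + B ((N : ℝ) • Δ - m) m := by
      simp only [map_sub, _root_.sub_apply]; ring
    have e3 : B ((N : ℝ) • Δ) ((N : ℝ) • Δ - m) ≤ q * (M + 1) * η :=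
      (Real.le_norm_self _).trans ((B.le_opNorm₂ _ _).trans (by gcongr; linarith))
    have e4 : B ((N : ℝ) • Δ - m) m ≤ q * η * M :=
      (Real.le_norm_self _).trans ((B.le_opNorm₂ _ _).trans (by gcongr))
    rw [e1]
    nlinarith
  · rw [norm_smul, Real.norm_eq_abs, abs_of_pos hNr] at h5
    rw [le_div_iff₀ hNr]
    linarith

end RiemannSums

/-- Continuation principle: an a priori bound `f ≤ B` on an initial interval that improves itself
to `f ≤ b < B` holds throughout. -/
theorem le_of_self_improving_bound {f : ℝ → ℝ} {T b B : ℝ} (hf : ContinuousOn f (Icc 0 T))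
    (h0 : f 0 ≤ b) (hbB : b < B)
    (H : ∀ t ∈ Icc 0 T, (∀ τ ∈ Icc 0 t, f τ ≤ B) → f t ≤ b) : ∀ t ∈ Icc 0 T, f t ≤ b := by
  by_cases hbad : ∃ t ∈ Icc 0 T, B ≤ f t
  · exfalso
    have hcl : IsCompact (Icc 0 T ∩ f ⁻¹' Ici B) :=
      isCompact_Icc.of_isClosed_subset (hf.preimage_isClosed_of_isClosed isClosed_Icc isClosed_Ici)
        inter_subset_left
    -- At the first time with `f ≥ B`, the bound `f ≤ b` holds strictly before, hence by continuity
    -- also there, which contradicts `b < B`.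
    obtain ⟨t, ht⟩ := hcl.exists_isLeast (by obtain ⟨t, h1, h2⟩ := hbad; exact ⟨t, h1, h2⟩)
    have htI := ht.1.1
    have htB : B ≤ f t := ht.1.2
    have hlt : ∀ τ ∈ Ico 0 t, f τ < B := by
      intro τ hτ
      by_contra hcon
      have := ht.2 ⟨⟨hτ.1, hτ.2.le.trans htI.2⟩, not_lt.1 hcon⟩
      linarith [hτ.2]
    have hpos : 0 < t := by
      rcases htI.1.eq_or_lt with h | h
      · rw [← h] at htB; linarith
      · exact h
    have hle : ∀ τ ∈ Ico 0 t, f τ ≤ b := fun τ hτ =>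
      H τ ⟨hτ.1, hτ.2.le.trans htI.2⟩ fun r hr => (hlt r ⟨hr.1, hr.2.trans_lt hτ.2⟩).le
    have hcont : Tendsto f (𝓝[Ico 0 t] t) (𝓝 (f t)) :=
      (hf t htI).mono fun r hr => ⟨hr.1, hr.2.le.trans htI.2⟩
    have hne : (𝓝[Ico 0 t] t).NeBot := by
      rw [← mem_closure_iff_nhdsWithin_neBot, closure_Ico hpos.ne]
      exact right_mem_Icc.2 hpos.le
    have := le_of_tendsto hcont (eventually_mem_nhdsWithin.mono hle)
    linarith
  · push Not at hbad
    exact fun t ht => H t ht fun τ hτ => (hbad τ ⟨hτ.1, hτ.2.trans ht.2⟩).le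

/-! ### Contracting systems and chains of trajectories. -/

section Contraction

variable {E F V : Type*} [NormedAddCommGroup E] [NormedSpace ℝ E]
  [NormedAddCommGroup F] [NormedSpace ℝ F] [NormedAddCommGroup V] [NormedSpace ℝ V]

/-- Product rule for a quadratic form based at a moving point; symmetry merges the two terms in the
derivative of the chord. -/
theorem HasAEDeriv.chord_energy {T : ℝ} {Q : E → E →L[ℝ] E →L[ℝ] ℝ} {x x' y y' : ℝ → E}
    (hx : HasAEDeriv 0 T x x') (hy : HasAEDeriv 0 T y y')
    (hQ : ∀ t ∈ uIcc 0 T, ContDiffAt ℝ 1 Q (x t))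
    (hsymm : ∀ t ∈ uIcc 0 T, ∀ ξ ζ, Q (x t) ξ ζ = Q (x t) ζ ξ) :
    HasAEDeriv 0 T (fun t => Q (x t) (y t - x t) (y t - x t))
      (fun t => fderiv ℝ Q (x t) (x' t) (y t - x t) (y t - x t)
        + 2 * Q (x t) (y t - x t) (y' t - x' t)) := by
  refine ⟨?_, ?_⟩
  · refine ((hx.prodMk hy).comp (φ := fun p : E × E => Q p.1 (p.2 - p.1) (p.2 - p.1)) ?_).ac
    intro t ht
    have h1 : ContDiffAt ℝ 1 (fun p : E × E => Q p.1) (x t, y t) :=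
      (hQ t ht).comp (x t, y t) contDiffAt_fst
    have h2 : ContDiffAt ℝ 1 (fun p : E × E => p.2 - p.1) (x t, y t) :=
      contDiffAt_snd.sub contDiffAt_fst
    exact (h1.clm_apply h2).clm_apply h2
  · filter_upwards [hx.deriv, hy.deriv] with t h1 h2 ht
    have e1 : HasDerivAt (fun t => Q (x t)) (fderiv ℝ Q (x t) (x' t)) t :=
      (((hQ t ht).differentiableAt one_ne_zero).hasFDerivAt).comp_hasDerivAt t (h1 ht)
    have e2 : HasDerivAt (fun t => y t - x t) (y' t - x' t) t := (h2 ht).sub (h1 ht)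
    have e3 := (e1.clm_apply e2).clm_apply e2
    convert e3 using 1
    simp only [_root_.add_apply]
    rw [hsymm t ht (y' t - x' t) (y t - x t)]
    ring

/-- A tangent control system `x' = G(x, z) v` on the zero set `X` of `h`, together with a Finsler
energy `Q` that satisfies an infinitesimal contraction inequality. `R` is a right inverse of the
derivative of `h`. -/
structure ContractingSystem (X : Set E) (h : E → F) (R : E → F →L[ℝ] E)
    (G : E × E → V →L[ℝ] E) (Q : E → E →L[ℝ] E →L[ℝ] ℝ) (𝒱 Ω : Set V) (c lam μ : ℝ) : Prop where
  mem_iff : ∀ x, x ∈ X ↔ h x = 0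
  h_smooth : ContDiff ℝ ∞ h
  R_C1 : ∀ x ∈ X, ContDiffAt ℝ 1 R x
  R_right : ∀ x ∈ X, ∀ᶠ y in 𝓝 x, ∀ w, fderiv ℝ h y (R y w) = w
  G_C1 : ∀ x ∈ X, ∀ z ∈ X, ContDiffAt ℝ 1 G (x, z)
  G_tangent : ∀ x ∈ X, ∀ z ∈ X, ∀ v, fderiv ℝ h x (G (x, z) v) = 0
  Q_C1 : ∀ x ∈ X, ContDiffAt ℝ 1 Q x
  Q_symm : ∀ x ∈ X, ∀ ξ ζ, Q x ξ ζ = Q x ζ ξ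
  c_pos : 0 < c
  coercive : ∀ x ∈ X, ∀ ξ, fderiv ℝ h x ξ = 0 → c * ‖ξ‖ ^ 2 ≤ Q x ξ ξ
  lam_pos : 0 < lam
  μ_pos : 0 < μ
  contraction : ∀ x ∈ X, ∀ z ∈ X, ∀ v ∈ 𝒱, ∀ w ∈ Ω, ∀ ξ, fderiv ℝ h x ξ = 0 →
    fderiv ℝ Q x (G (x, z) v) ξ ξ + 2 * Q x ξ (fderiv ℝ G (x, z) (ξ, 0) v + G (x, z) w)
      ≤ -(2 * lam) * Q x ξ ξ + μ * ‖w‖ ^ 2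

/-- Uniform estimates for chords of length less than `δ` in `K`, with error `ε`. -/
def ChordEstimates (K Y : Set E) (G : E × E → V →L[ℝ] E) (Q : E → E →L[ℝ] E →L[ℝ] ℝ)
    (𝒱 Ω : Set V) (c lam μ ε δ : ℝ) : Prop :=
  ∀ x ∈ K, ∀ y ∈ K, dist y x < δ → c / 2 * ‖y - x‖ ^ 2 ≤ Q x (y - x) (y - x) ∧
    ∀ z ∈ Y, ∀ v ∈ 𝒱, ∀ w ∈ Ω,
      fderiv ℝ Q x (G (x, z) v) (y - x) (y - x) + 2 * Q x (y - x) (G (y, z) (v + w) - G (x, z) v)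
        ≤ -(2 * lam) * Q x (y - x) (y - x) + μ * ‖w‖ ^ 2
          + ε * (1 + ‖v‖) * ‖y - x‖ ^ 2 + ε * ‖w‖ ^ 2

/-- Decay of the energy of a short chord along two trajectories. -/
theorem ChordEstimates.energy_le {K Y : Set E} {G : E × E → V →L[ℝ] E}
    {Q : E → E →L[ℝ] E →L[ℝ] ℝ} {𝒱 Ω : Set V} {c lam μ ε δ : ℝ}
    (H : ChordEstimates K Y G Q 𝒱 Ω c lam μ ε δ) (hc : 0 < c) (hlam : 0 < lam) (hμ : 0 < μ)
    (hε : 0 < ε) (hQ : ∀ x ∈ K, ContDiffAt ℝ 1 Q x)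
    (hsymm : ∀ x ∈ K, ∀ ξ ζ, Q x ξ ζ = Q x ζ ξ)
    {T d : ℝ} (hT : 0 ≤ T) {x x' y y' z : ℝ → E} {v w : ℝ → V} {ρ : ℝ → ℝ}
    (hx : HasAEDeriv 0 T x x') (hy : HasAEDeriv 0 T y y')
    (hxK : ∀ t ∈ Icc 0 T, x t ∈ K) (hyK : ∀ t ∈ Icc 0 T, y t ∈ K)
    (hzY : ∀ t ∈ Icc 0 T, z t ∈ Y) (hδ : ∀ t ∈ Icc 0 T, dist (y t) (x t) < δ)
    (hx' : ∀ t ∈ Icc 0 T, x' t = G (x t, z t) (v t))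
    (hy' : ∀ t ∈ Icc 0 T, y' t = G (y t, z t) (v t + w t))
    (hv : ∀ t ∈ Icc 0 T, v t ∈ 𝒱) (hw : ∀ t ∈ Icc 0 T, w t ∈ Ω)
    (hd : ∀ t ∈ Icc 0 T, ‖w t‖ ≤ d) (hρ : ∀ t ∈ Icc 0 T, ‖v t‖ ≤ ρ t)
    (hρi : IntervalIntegrable ρ volume 0 T) :
    Q (x T) (y T - x T) (y T - x T) ≤
      Real.exp (ε * (2 / c * ∫ t in (0 : ℝ)..T, (1 + ρ t))) *
        (Q (x 0) (y 0 - x 0) (y 0 - x 0) + (μ + ε) * d ^ 2 / (2 * lam)) := by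
  have huIcc : uIcc 0 T = Icc 0 T := uIcc_of_le hT
  have hU := hx.chord_energy hy (Q := Q) (fun t ht => hQ _ (hxK t (huIcc ▸ ht)))
    (fun t ht => hsymm _ (hxK t (huIcc ▸ ht)))
  have hρ0 : ∀ t ∈ Icc 0 T, 0 ≤ ρ t := fun t ht => (norm_nonneg _).trans (hρ t ht)
  have hri : IntervalIntegrable (fun t => ε * (2 / c) * (1 + ρ t)) volume 0 T :=
    (intervalIntegrable_const.add hρi).const_mul _
  have hd0 : 0 ≤ d := (norm_nonneg _).trans (hd 0 ⟨le_rfl, hT⟩)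
  have key := gronwall_of_ae_deriv_le hT (c := 2 * lam) (κ := (μ + ε) * d ^ 2) (by positivity)
    (by positivity) hU hri (fun t ht => by have := hρ0 t ht; positivity)
    (Eventually.of_forall fun t ht => by
      obtain ⟨h1, h2⟩ := H (x t) (hxK t ht) (y t) (hyK t ht) (hδ t ht)
      have h3 := h2 (z t) (hzY t ht) (v t) (hv t ht) (w t) (hw t ht)
      rw [hx' t ht, hy' t ht]
      set U := Q (x t) (y t - x t) (y t - x t)
      -- Coercivity turns the chord error into a multiple of `U`, that is, into a growth rate `ε
      -- (2/c)(1 + ρ)` for Grönwall.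
      have h4 : ‖y t - x t‖ ^ 2 ≤ 2 / c * U := by
        rw [div_mul_eq_mul_div, le_div_iff₀ hc]; linarith
      have h5 : ε * (1 + ‖v t‖) * ‖y t - x t‖ ^ 2 ≤ ε * (1 + ρ t) * (2 / c * U) := by
        have := hρ t ht
        have := hρ0 t ht
        gcongr
      have h6 : ‖w t‖ ^ 2 ≤ d ^ 2 := by
        have := hd t ht
        gcongr
      have h7 : (μ + ε) * ‖w t‖ ^ 2 ≤ (μ + ε) * d ^ 2 := by gcongr
      linarith)
    (by
      obtain ⟨h1, -⟩ := H (x 0) (hxK 0 ⟨le_rfl, hT⟩) (y 0) (hyK 0 ⟨le_rfl, hT⟩) (hδ 0 ⟨le_rfl, hT⟩)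
      exact le_trans (by positivity) h1)
  rw [intervalIntegral.integral_const_mul, mul_assoc] at key
  exact key

end Contraction

section Contraction

variable {E F V : Type*} [NormedAddCommGroup E] [NormedSpace ℝ E]
  [NormedAddCommGroup F] [NormedSpace ℝ F] [NormedAddCommGroup V] [NormedSpace ℝ V]
  {X : Set E} {h : E → F} {R : E → F →L[ℝ] E} {G : E × E → V →L[ℝ] E}
  {Q : E → E →L[ℝ] E →L[ℝ] ℝ} {𝒱 Ω : Set V} {c lam μ : ℝ}

theorem ContractingSystem.isClosed (S : ContractingSystem X h R G Q 𝒱 Ω c lam μ) : IsClosed X := by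
  have : X = h ⁻¹' {0} := by ext x; simp [S.mem_iff]
  rw [this]
  exact isClosed_singleton.preimage S.h_smooth.continuous

theorem ContractingSystem.exists_chordEstimates (S : ContractingSystem X h R G Q 𝒱 Ω c lam μ)
    {K Y : Set E} (hK : IsCompact K) (hKX : K ⊆ X) (hY : IsCompact Y) (hYX : Y ⊆ X)
    {ε : ℝ} (hε : 0 < ε) : ∃ δ > 0, ChordEstimates K Y G Q 𝒱 Ω c lam μ ε δ := by
  have hh : ∀ x ∈ K, ContDiffAt ℝ 1 h x := fun x _ => (S.h_smooth.of_le (by simp)).contDiffAt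
  have h0 : ∀ x ∈ K, h x = 0 := fun x hx => (S.mem_iff x).1 (hKX hx)
  have hRc : ContinuousOn R K := fun x hx => (S.R_C1 x (hKX hx)).continuousAt.continuousWithinAt
  have hR : ∀ x ∈ K, ∀ y, fderiv ℝ h x (R x y) = y := fun x hx =>
    (S.R_right x (hKX hx)).self_of_nhds
  obtain ⟨δ₁, hδ₁, H₁⟩ := exists_delta_coercive hK hh h0 hRc hR
    (fun x hx => (S.Q_C1 x (hKX hx)).continuousAt.continuousWithinAt) S.c_pos
    fun x hx => S.coercive x (hKX hx)
  obtain ⟨δ₂, hδ₂, H₂⟩ := exists_delta_energy_rate hK hY hh h0 hRc hR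
    (fun x hx => S.Q_C1 x (hKX hx)) (fun x hx z hz => S.G_C1 x (hKX hx) z (hYX hz)) S.lam_pos
    (fun x hx z hz => S.contraction x (hKX hx) z (hYX hz)) hε
  exact ⟨min δ₁ δ₂, lt_min hδ₁ hδ₂, fun x hx y hy hxy =>
    ⟨H₁ x hx y hy (hxy.trans_le (min_le_left _ _)),
      H₂ x hx y hy (hxy.trans_le (min_le_right _ _))⟩⟩

/-- A fine chain of trajectories between two given ones stays in a fixed compact set, and the
energies of its links decay. -/
theorem ContractingSystem.chain_bound (S : ContractingSystem X h R G Q 𝒱 Ω c lam μ)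
    {T ℓ R₀ ε δ D C₀ : ℝ} (hT : 0 ≤ T) (hℓ0 : 0 < ℓ) (hε : 0 < ε) {N : ℕ} (hN : 0 < N)
    {Y Y' : ℕ → ℝ → E} {K : Set E} (hK : ∀ x, x ∈ K ↔ x ∈ X ∧ ‖x‖ ≤ R₀ + 2 * ℓ)
    {v e : ℝ → V} {ρ : ℝ → ℝ}
    (hY : ∀ j ≤ N, HasAEDeriv 0 T (Y j) (Y' j)) (hYX : ∀ j ≤ N, ∀ t ∈ Icc 0 T, Y j t ∈ X)
    (hz : ∀ t ∈ Icc 0 T, ‖Y N t‖ ≤ R₀)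
    (hY' : ∀ j ≤ N, ∀ t ∈ Icc 0 T, Y j t ∈ K →
      Y' j t = G (Y j t, Y N t) (v t + ((j : ℝ) / N) • e t))
    (hv : ∀ j ≤ N, ∀ t ∈ Icc 0 T, v t + ((j : ℝ) / N) • e t ∈ 𝒱)
    (hw : ∀ t ∈ Icc 0 T, (1 / (N : ℝ)) • e t ∈ Ω)
    (hρ : ∀ j ≤ N, ∀ t ∈ Icc 0 T, ‖v t + ((j : ℝ) / N) • e t‖ ≤ ρ t)
    (hρi : IntervalIntegrable ρ volume 0 T)
    (he : ∀ t ∈ Icc 0 T, ‖e t‖ ≤ D)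
    (H : ChordEstimates K (Y N '' Icc 0 T) G Q 𝒱 Ω c lam μ ε δ) (hδ : 2 * ℓ / N < δ)
    (hinit : ∀ j < N, ‖Y (j + 1) 0 - Y j 0‖ ≤ ℓ / N)
    (hC₀ : ∀ j < N, (N : ℝ) ^ 2 * Q (Y j 0) (Y (j + 1) 0 - Y j 0) (Y (j + 1) 0 - Y j 0) ≤ C₀)
    (hexp : Real.exp (ε * (2 / c * ∫ t in (0 : ℝ)..T, (1 + ρ t))) ≤ 2)
    (hℓ : 4 / c * (C₀ + (μ + ε) * D ^ 2 / (2 * lam)) ≤ ℓ ^ 2) :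
    ∀ t ∈ Icc 0 T, (∀ j ≤ N, Y j t ∈ K) ∧ ∀ j < N, ‖Y (j + 1) t - Y j t‖ ≤ ℓ / N ∧
      Q (Y j t) (Y (j + 1) t - Y j t) (Y (j + 1) t - Y j t) ≤
        Real.exp (ε * (2 / c * ∫ t in (0 : ℝ)..T, (1 + ρ t))) *
        (Q (Y j 0) (Y (j + 1) 0 - Y j 0) (Y (j + 1) 0 - Y j 0)
          + (μ + ε) * (D / N) ^ 2 / (2 * lam)) := by
  have hNr : (0 : ℝ) < N := by exact_mod_cast hN
  have hc := S.c_pos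
  have hlam := S.lam_pos
  have hμ := S.μ_pos
  have huIcc : uIcc 0 T = Icc 0 T := uIcc_of_le hT
  have hρ0 : ∀ t ∈ Icc 0 T, 0 ≤ ρ t := fun t ht => (norm_nonneg _).trans (hρ 0 (zero_le) t ht)
  have hKX : ∀ x ∈ K, x ∈ X := fun x hx => ((hK x).1 hx).1
  -- At most `N` links of length `2ℓ/N` separate `Y j` from `Y N`, whose norm is at most `R₀`; hence
  -- the radius `R₀ + 2ℓ` of `K`.
  have inK : ∀ t ∈ Icc 0 T, (∀ j < N, ‖Y (j + 1) t - Y j t‖ ≤ 2 * ℓ / N) →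
      ∀ j ≤ N, Y j t ∈ K := by
    intro t ht hle j hj
    refine (hK _).2 ⟨hYX j hj t ht, ?_⟩
    have h1 : dist (Y j t) (Y N t) ≤ ∑ i ∈ Finset.Ico j N, 2 * ℓ / N :=
      dist_le_Ico_sum_of_dist_le (f := fun j => Y j t) hj fun {k} _ hk => by
        rw [dist_comm, dist_eq_norm]; exact hle k hk
    have h2 : ∑ i ∈ Finset.Ico j N, 2 * ℓ / N ≤ 2 * ℓ := by
      rw [Finset.sum_const, Nat.card_Ico, nsmul_eq_mul]
      calc ((N - j : ℕ) : ℝ) * (2 * ℓ / N) ≤ N * (2 * ℓ / N) := by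
            gcongr; omega
        _ = 2 * ℓ := by field_simp
    have h3 : ‖Y j t‖ ≤ ‖Y N t‖ + dist (Y j t) (Y N t) := by
      rw [dist_eq_norm]
      calc ‖Y j t‖ = ‖Y N t + (Y j t - Y N t)‖ := by congr 1; abel
        _ ≤ _ := norm_add_le _ _
    linarith [hz t ht]
  -- The bootstrap: links of length at most `2ℓ/N` up to time `t` keep the chain in `K`, where the
  -- state equation and the chord estimates hold, and energy decay returns the better bound `ℓ/N`.
  have step : ∀ t ∈ Icc 0 T, (∀ τ ∈ Icc 0 t, ∀ j < N, ‖Y (j + 1) τ - Y j τ‖ ≤ 2 * ℓ / N) →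
      ∀ j < N, ‖Y (j + 1) t - Y j t‖ ≤ ℓ / N ∧
      Q (Y j t) (Y (j + 1) t - Y j t) (Y (j + 1) t - Y j t) ≤
        Real.exp (ε * (2 / c * ∫ t in (0 : ℝ)..T, (1 + ρ t))) *
        (Q (Y j 0) (Y (j + 1) 0 - Y j 0) (Y (j + 1) 0 - Y j 0)
          + (μ + ε) * (D / N) ^ 2 / (2 * lam)) := by
    intro t ht hle j hj
    have hsub : Icc 0 t ⊆ Icc 0 T := Icc_subset_Icc_right ht.2
    have husub : uIcc 0 t ⊆ uIcc 0 T := by rwa [huIcc, uIcc_of_le ht.1]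
    have hKt : ∀ i ≤ N, ∀ τ ∈ Icc 0 t, Y i τ ∈ K := fun i hi τ hτ =>
      inK τ (hsub hτ) (hle τ hτ) i hi
    have hdist : ∀ τ ∈ Icc 0 t, dist (Y (j + 1) τ) (Y j τ) < δ := fun τ hτ => by
      rw [dist_eq_norm]; exact (hle τ hτ j hj).trans_lt hδ
    have hmain := H.energy_le hc hlam hμ hε (fun x hx => S.Q_C1 x (hKX x hx))
      (fun x hx => S.Q_symm x (hKX x hx)) ht.1 (z := Y N) (w := fun t => (1 / (N : ℝ)) • e t)
      (d := D / N)
      ((hY j hj.le).mono husub) ((hY (j + 1) hj).mono husub) (hKt j hj.le) (hKt (j + 1) hj)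
      (fun τ hτ => mem_image_of_mem _ (hsub hτ)) hdist
      (fun τ hτ => hY' j hj.le τ (hsub hτ) (hKt j hj.le τ hτ))
      (fun τ hτ => by
        rw [hY' (j + 1) hj τ (hsub hτ) (hKt (j + 1) hj τ hτ), add_assoc, ← add_smul]
        congr 3
        push_cast; ring)
      (fun τ hτ => hv j hj.le τ (hsub hτ)) (fun τ hτ => hw τ (hsub hτ))
      (fun τ hτ => by
        rw [norm_smul, Real.norm_eq_abs, abs_of_pos (by positivity), one_div_mul_eq_div]
        gcongr
        exact he τ (hsub hτ))
      (fun τ hτ => hρ j hj.le τ (hsub hτ)) (hρi.mono_set husub)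
    have hint : ∫ τ in (0 : ℝ)..t, (1 + ρ τ) ≤ ∫ τ in (0 : ℝ)..T, (1 + ρ τ) := by
      refine intervalIntegral.integral_mono_interval le_rfl ht.1 ht.2 ?_
        (intervalIntegrable_const.add hρi)
      refine (ae_restrict_iff' measurableSet_Ioc).2 (Eventually.of_forall fun τ hτ => ?_)
      have := hρ0 τ ⟨hτ.1.le, hτ.2⟩
      change 0 ≤ 1 + ρ τ
      linarith
    have h0mem : (0 : ℝ) ∈ Icc 0 t := ⟨le_rfl, ht.1⟩
    have hU0 : 0 ≤ Q (Y j 0) (Y (j + 1) 0 - Y j 0) (Y (j + 1) 0 - Y j 0) :=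
      le_trans (by positivity) (H _ (hKt j hj.le 0 h0mem) _ (hKt (j + 1) hj 0 h0mem)
        (hdist 0 h0mem)).1
    have hbound : Q (Y j t) (Y (j + 1) t - Y j t) (Y (j + 1) t - Y j t) ≤
        Real.exp (ε * (2 / c * ∫ t in (0 : ℝ)..T, (1 + ρ t))) *
        (Q (Y j 0) (Y (j + 1) 0 - Y j 0) (Y (j + 1) 0 - Y j 0)
          + (μ + ε) * (D / N) ^ 2 / (2 * lam)) := by
      refine hmain.trans ?_
      gcongr
    refine ⟨?_, hbound⟩
    have htmem : t ∈ Icc 0 t := ⟨ht.1, le_rfl⟩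
    have hco := (H _ (hKt j hj.le t htmem) _ (hKt (j + 1) hj t htmem) (hdist t htmem)).1
    set U₀ := Q (Y j 0) (Y (j + 1) 0 - Y j 0) (Y (j + 1) 0 - Y j 0)
    have h1 : c / 2 * ‖Y (j + 1) t - Y j t‖ ^ 2 ≤ 2 * (U₀ + (μ + ε) * (D / N) ^ 2 / (2 * lam)) := by
      refine hco.trans (hbound.trans ?_)
      gcongr
    -- The `4/c` of `hℓ` is the product of `2/c` from coercivity and `2` from `hexp`.
    have h2 : (N * ‖Y (j + 1) t - Y j t‖) ^ 2 ≤ ℓ ^ 2 := by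
      refine le_trans ?_ hℓ
      have h3 := hC₀ j hj
      have h4 : (N : ℝ) ^ 2 * ((μ + ε) * (D / N) ^ 2 / (2 * lam)) = (μ + ε) * D ^ 2 / (2 * lam) := by
        field_simp
      calc (N * ‖Y (j + 1) t - Y j t‖) ^ 2
          = 2 / c * (N ^ 2 * (c / 2 * ‖Y (j + 1) t - Y j t‖ ^ 2)) := by field_simp
        _ ≤ 2 / c * (N ^ 2 * (2 * (U₀ + (μ + ε) * (D / N) ^ 2 / (2 * lam)))) := by gcongr
        _ = 4 / c * (N ^ 2 * U₀ + N ^ 2 * ((μ + ε) * (D / N) ^ 2 / (2 * lam))) := by ring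
        _ ≤ _ := by rw [h4]; gcongr
    rw [le_div_iff₀ hNr, mul_comm]
    exact le_of_sq_le_sq h2 hℓ0.le
  set f : ℝ → ℝ := fun t => ‖fun j : Fin N => ‖Y (j + 1) t - Y j t‖‖ with hf
  have hfle : ∀ t b, 0 ≤ b → (f t ≤ b ↔ ∀ j < N, ‖Y (j + 1) t - Y j t‖ ≤ b) := by
    intro t b hb
    rw [hf, pi_norm_le_iff_of_nonneg hb]
    simp only [norm_norm]
    exact ⟨fun H j hj => H ⟨j, hj⟩, fun H j => H j j.2⟩
  have hfc : ContinuousOn f (Icc 0 T) := by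
    refine (continuousOn_pi.2 fun j => ?_).norm
    have h1 := (hY j j.2.le).continuousOn
    have h2 := (hY (j + 1) j.2).continuousOn
    rw [huIcc] at h1 h2
    exact (h2.sub h1).norm
  have hlt : ℓ / N < 2 * ℓ / N := by gcongr; linarith
  have hfall := le_of_self_improving_bound hfc ((hfle 0 _ (by positivity)).2 hinit) hlt
    fun t ht hτ => (hfle t _ (by positivity)).2 fun j hj =>
      (step t ht (fun τ hτ' => (hfle τ _ (by positivity)).1 (hτ τ hτ')) j hj).1
  have hall : ∀ t ∈ Icc 0 T, ∀ j < N, ‖Y (j + 1) t - Y j t‖ ≤ 2 * ℓ / N := fun t ht j hj =>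
    ((hfle t _ (by positivity)).1 (hfall t ht) j hj).trans hlt.le
  exact fun t ht => ⟨inK t ht (hall t ht),
    step t ht fun τ hτ => hall τ ⟨hτ.1, hτ.2.trans ht.2⟩⟩

end Contraction

/-! ### The output estimate along a chain. -/

section Contraction

variable {E F V W : Type*} [NormedAddCommGroup E] [NormedSpace ℝ E] [FiniteDimensional ℝ E]
  [NormedAddCommGroup F] [NormedSpace ℝ F] [NormedAddCommGroup V] [NormedSpace ℝ V]
  [NormedAddCommGroup W] [NormedSpace ℝ W]
  {X : Set E} {h : E → F} {R : E → F →L[ℝ] E} {G : E × E → V →L[ℝ] E}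
  {Q : E → E →L[ℝ] E →L[ℝ] ℝ} {𝒱 Ω : Set V} {c lam μ : ℝ}

/-- Triangle inequality and Cauchy–Schwarz. With links of size `1/N`, the factor `N` makes the
right-hand side a discrete path energy. -/
theorem sq_norm_sub_le_of_chain {A : Type*} [SeminormedAddCommGroup A] (a : ℕ → A) (N : ℕ) :
    ‖a 0 - a N‖ ^ 2 ≤ N * ∑ j ∈ Finset.range N, ‖a (j + 1) - a j‖ ^ 2 := by
  have h1 : ‖a 0 - a N‖ ≤ ∑ j ∈ Finset.range N, ‖a (j + 1) - a j‖ := by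
    rw [norm_sub_rev, ← Finset.sum_range_sub]
    exact norm_sum_le _ _
  calc ‖a 0 - a N‖ ^ 2 ≤ (∑ j ∈ Finset.range N, ‖a (j + 1) - a j‖) ^ 2 := by gcongr
    _ ≤ (Finset.range N).card * ∑ j ∈ Finset.range N, ‖a (j + 1) - a j‖ ^ 2 :=
        sq_sum_le_card_mul_sum_sq
    _ = _ := by rw [Finset.card_range]

/-- Interpolating trajectories between two given ones. -/
theorem ContractingSystem.exists_chain (S : ContractingSystem X h R G Q 𝒱 Ω c lam μ)
    {T : ℝ} (hT : 0 ≤ T) {x xs : ℝ → E} {v vs : ℝ → V}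
    (hv : IntervalIntegrable v volume 0 T) (hvs : IntervalIntegrable vs volume 0 T)
    (hx : HasAEDeriv 0 T x (fun t => G (x t, xs t) (v t)))
    (hxs : HasAEDeriv 0 T xs (fun t => G (xs t, xs t) (vs t)))
    (hxX : ∀ t ∈ Icc 0 T, x t ∈ X) (hxsX : ∀ t ∈ Icc 0 T, xs t ∈ X)
    {γ : ℝ → E} (hγX : ∀ s ∈ Icc (0 : ℝ) 1, γ s ∈ X) (hγ0 : γ 0 = x 0) (hγ1 : γ 1 = xs 0)
    {K : Set E} (hK : IsCompact K) (hKX : K ⊆ X) {N : ℕ} (hN : 0 < N) :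
    ∃ Y Y' : ℕ → ℝ → E, Y 0 = x ∧ Y N = xs ∧ ∀ j ≤ N, HasAEDeriv 0 T (Y j) (Y' j) ∧
      Y j 0 = γ ((j : ℝ) / N) ∧ (∀ t ∈ Icc 0 T, Y j t ∈ X) ∧
      ∀ t ∈ Icc 0 T, Y j t ∈ K →
        Y' j t = G (Y j t, xs t) (v t + ((j : ℝ) / N) • (vs t - v t)) := by
  have hNr : (0 : ℝ) < N := by exact_mod_cast hN
  have key : ∀ j : ℕ, ∃ y y' : ℝ → E, (j = 0 → y = x) ∧ (j = N → y = xs) ∧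
      (j ≤ N → HasAEDeriv 0 T y y' ∧ y 0 = γ ((j : ℝ) / N) ∧ (∀ t ∈ Icc 0 T, y t ∈ X) ∧
      ∀ t ∈ Icc 0 T, y t ∈ K →
        y' t = G (y t, xs t) (v t + ((j : ℝ) / N) • (vs t - v t))) := by
    intro j
    by_cases h0 : j = 0
    -- The two ends must be the given solutions themselves; only the interior members are
    -- constructed.
    · exact ⟨x, _, fun _ => rfl, fun h => absurd (h0.symm.trans h) hN.ne, fun _ =>
        ⟨hx, by simp [h0, hγ0], hxX, fun t _ _ => by simp [h0]⟩⟩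
    by_cases h1 : j = N
    · exact ⟨xs, _, fun h => absurd h h0, fun _ => rfl, fun _ =>
        ⟨hxs, by simp [h1, hγ1, hNr.ne'], hxsX, fun t _ _ => by simp [h1, hNr.ne']⟩⟩
    by_cases h2 : j ≤ N
    · have hj : (j : ℝ) ≤ N := by exact_mod_cast h2
      have hz := hxs.continuousOn
      rw [uIcc_of_le hT] at hz
      obtain ⟨y, y', hy1, hy2, hy3, hy4⟩ := exists_trajectory S.mem_iff S.h_smooth S.R_C1 S.R_right
        S.G_C1 S.G_tangent hK hKX hT hz hxsX (hv.add ((hvs.sub hv).smul ((j : ℝ) / N)))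
        (hγX ((j : ℝ) / N) ⟨by positivity, (div_le_one hNr).2 hj⟩)
      exact ⟨y, y', fun h => absurd h h0, fun h => absurd h h1, fun _ => ⟨hy1, hy2, hy3, hy4⟩⟩
    · exact ⟨x, x, fun h => absurd h h0, fun h => absurd h h1, fun h => absurd h h2⟩
  choose Y Y' h0 h1 h2 using key
  exact ⟨Y, Y', h0 0 rfl, h1 N rfl, h2⟩

/-- The distance of the outputs along two trajectories is bounded by the energy of any path that
joins their initial values and by the distance of their inputs. -/
theorem ContractingSystem.sq_norm_output_sub_le (S : ContractingSystem X h R G Q 𝒱 Ω c lam μ)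
    {T D : ℝ} (hT : 0 ≤ T) {x xs : ℝ → E} {v vs : ℝ → V}
    (hv : IntervalIntegrable v volume 0 T) (hvs : IntervalIntegrable vs volume 0 T)
    (hx : HasAEDeriv 0 T x (fun t => G (x t, xs t) (v t)))
    (hxs : HasAEDeriv 0 T xs (fun t => G (xs t, xs t) (vs t)))
    (hxX : ∀ t ∈ Icc 0 T, x t ∈ X) (hxsX : ∀ t ∈ Icc 0 T, xs t ∈ X)
    (h𝒱 : ∀ t ∈ Icc 0 T, ∀ s ∈ Icc (0 : ℝ) 1, v t + s • (vs t - v t) ∈ 𝒱)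
    (hΩ : ∀ t ∈ Icc 0 T, ∀ r : ℝ, r • (vs t - v t) ∈ Ω)
    (hD : ∀ t ∈ Icc 0 T, ‖vs t - v t‖ ≤ D)
    {γ : ℝ → E} (hγ : ContDiffOn ℝ 1 γ (Icc 0 1)) (hγX : ∀ s ∈ Icc (0 : ℝ) 1, γ s ∈ X)
    (hγ0 : γ 0 = x 0) (hγ1 : γ 1 = xs 0) {t : ℝ} (ht : t ∈ Icc 0 T)
    {Γ : E → W} (hΓ : ∀ x ∈ X, ContDiffAt ℝ 1 Γ x) {κ : ℝ} (hκ : 0 ≤ κ)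
    (hb : ∀ x ∈ X, ∀ ξ, fderiv ℝ h x ξ = 0 → ‖fderiv ℝ Γ x ξ‖ ^ 2 ≤ κ * Q x ξ ξ) :
    ‖Γ (x t) - Γ (xs t)‖ ^ 2 ≤ κ * ((∫ s in (0 : ℝ)..1,
      Q (γ s) (derivWithin γ (Icc 0 1) s) (derivWithin γ (Icc 0 1) s)) + μ * D ^ 2 / (2 * lam)) := by
  have : ProperSpace E := FiniteDimensional.proper ℝ E
  have hc := S.c_pos
  have hlam := S.lam_pos
  have hμ := S.μ_pos
  set φ : ℝ → ℝ := fun s => Q (γ s) (derivWithin γ (Icc 0 1) s) (derivWithin γ (Icc 0 1) s) with hφ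
  have hγ' : ContinuousOn (derivWithin γ (Icc 0 1)) (Icc 0 1) :=
    hγ.continuousOn_derivWithin (uniqueDiffOn_Icc one_pos) le_rfl
  have hQX : ContinuousOn Q X := fun x hx => (S.Q_C1 x hx).continuousAt.continuousWithinAt
  have hφc : ContinuousOn φ (Icc 0 1) :=
    ((hQX.comp hγ.continuousOn hγX).clm_apply hγ').clm_apply hγ'
  obtain ⟨M, hM0, hM⟩ := exists_norm_le_of_continuousOn isCompact_Icc hγ'
  obtain ⟨C₀, hC₀0, hC₀⟩ := exists_norm_le_of_continuousOn isCompact_Icc hφc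
  have hxsc : ContinuousOn xs (Icc 0 T) := by
    have := hxs.continuousOn
    rwa [uIcc_of_le hT] at this
  obtain ⟨R₀, hR₀0, hR₀⟩ := exists_norm_le_of_continuousOn isCompact_Icc hxsc
  -- `M + 1` bounds `N` times the initial links and the root closes the bootstrap. The `+ 1` in `C₀
  -- + 1` and `μ + 1` leaves room for every `ε ≤ 1`, so `ℓ` and `K` depend neither on `ε` nor on
  -- `N`.
  set ℓ := M + 1 + Real.sqrt (4 / c * ((C₀ + 1) + (μ + 1) * D ^ 2 / (2 * lam))) with hℓdef
  have hℓ0 : 0 < ℓ := by positivity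
  have hℓ : 4 / c * ((C₀ + 1) + (μ + 1) * D ^ 2 / (2 * lam)) ≤ ℓ ^ 2 := by
    have h1 : Real.sqrt (4 / c * ((C₀ + 1) + (μ + 1) * D ^ 2 / (2 * lam))) ≤ ℓ := by
      rw [hℓdef]; linarith
    calc _ = Real.sqrt (4 / c * ((C₀ + 1) + (μ + 1) * D ^ 2 / (2 * lam))) ^ 2 :=
          (Real.sq_sqrt (by positivity)).symm
      _ ≤ _ := by gcongr
  set K : Set E := X ∩ Metric.closedBall 0 (R₀ + 2 * ℓ) with hKdef
  have hK : IsCompact K := (isCompact_closedBall 0 _).inter_left S.isClosed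
  have hKX : K ⊆ X := inter_subset_left
  have hKiff : ∀ x, x ∈ K ↔ x ∈ X ∧ ‖x‖ ≤ R₀ + 2 * ℓ := fun x => by
    rw [hKdef, mem_inter_iff, mem_closedBall_zero_iff]
  have hZ : IsCompact (xs '' Icc 0 T) := isCompact_Icc.image_of_continuousOn hxsc
  have hZX : xs '' Icc 0 T ⊆ X := by
    rintro _ ⟨τ, hτ, rfl⟩
    exact hxsX τ hτ
  set ρ : ℝ → ℝ := fun t => ‖v t‖ + ‖vs t‖ with hρ
  have hρi : IntervalIntegrable ρ volume 0 T := hv.norm.add hvs.norm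
  set a := 2 / c * ∫ t in (0 : ℝ)..T, (1 + ρ t) with ha
  -- For each small `ε` a sufficiently large `N` is used, but the resulting bound no longer contains
  -- `N`, so `ε` can tend to `0`.
  have key : ∀ᶠ ε in 𝓝[>] (0 : ℝ), ‖Γ (x t) - Γ (xs t)‖ ^ 2 ≤
      κ * (Real.exp (ε * a) * (((∫ s in (0 : ℝ)..1, φ s) + 2 * ε) + (μ + ε) * D ^ 2 / (2 * lam)))
        + ε * ℓ ^ 2 := by
    have hexp : ∀ᶠ ε in 𝓝[>] (0 : ℝ), Real.exp (ε * a) ≤ 2 := by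
      have h1 : Tendsto (fun ε : ℝ => Real.exp (ε * a)) (𝓝[>] 0) (𝓝 (Real.exp (0 * a))) :=
        (Continuous.tendsto (by fun_prop) _).mono_left nhdsWithin_le_nhds
      rw [zero_mul, Real.exp_zero] at h1
      exact (h1.eventually_lt_const (by norm_num : (1 : ℝ) < 2)).mono fun _ h => h.le
    have hone : ∀ᶠ ε in 𝓝[>] (0 : ℝ), ε ≤ 1 :=
      nhdsWithin_le_nhds (eventually_le_nhds one_pos)
    filter_upwards [hexp, hone, self_mem_nhdsWithin] with ε hexp hε1 hε0
    have hε : 0 < ε := hε0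
    obtain ⟨δ₁, hδ₁, H₁⟩ := S.exists_chordEstimates hK hKX hZ hZX hε
    obtain ⟨δ₂, hδ₂, H₂⟩ := exists_delta_output_bound hK
      (fun x _ => (S.h_smooth.of_le (by simp)).contDiffAt)
      (fun x hx => (S.mem_iff x).1 (hKX hx))
      (fun x hx => (S.R_C1 x (hKX hx)).continuousAt.continuousWithinAt)
      (fun x hx => (S.R_right x (hKX hx)).self_of_nhds)
      (hQX.mono hKX) (fun x hx => hΓ x (hKX hx)) hκ (fun x hx => hb x (hKX hx)) hε
    obtain ⟨N₁, hN₁⟩ := exists_riemann_sum_le hφc hε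
    obtain ⟨N₂, hN₂⟩ := exists_chord_energy_le hγ (fun s hs => (S.Q_C1 _ (hγX s hs)).continuousAt) hε
    obtain ⟨N₃, hN₃⟩ := exists_nat_gt (2 * ℓ / min δ₁ δ₂)
    set N := max (max N₁ N₂) N₃ + 1 with hNdef
    have hN : 0 < N := by omega
    have hNr : (0 : ℝ) < N := by exact_mod_cast hN
    have hNδ : 2 * ℓ / N < min δ₁ δ₂ := by
      have h1 : (N₃ : ℝ) ≤ N := by exact_mod_cast (by omega : N₃ ≤ N)
      rw [div_lt_comm₀ hNr (by positivity)]
      exact hN₃.trans_le h1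
    obtain ⟨Y, Y', hY0, hYN, hY⟩ := S.exists_chain hT hv hvs hx hxs hxX hxsX hγX hγ0 hγ1 hK hKX hN
    have hjmem : ∀ j ≤ N, (j : ℝ) / N ∈ Icc (0 : ℝ) 1 := fun j hj =>
      ⟨by positivity, (div_le_one hNr).2 (by exact_mod_cast hj)⟩
    have hE := hN₂ N (by omega)
    have hchain := S.chain_bound (R₀ := R₀) (v := v) (e := fun t => vs t - v t) (ρ := ρ)
      (D := D) (C₀ := C₀ + 1) (δ := δ₁) hT hℓ0 hε hN hKiff
      (fun j hj => (hY j hj).1) (fun j hj => (hY j hj).2.2.1) (by rw [hYN]; exact hR₀)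
      (by rw [hYN]; exact fun j hj => (hY j hj).2.2.2)
      (fun j hj t ht => h𝒱 t ht _ (hjmem j hj)) (fun t ht => hΩ t ht _)
      (fun j hj t ht => by
        have h1 := hjmem j hj
        -- A convex combination of `v` and `v*`, hence bounded by `ρ = ‖v‖ + ‖v*‖` uniformly in `j`.
        have h2 : v t + ((j : ℝ) / N) • (vs t - v t)
            = (1 - (j : ℝ) / N) • v t + ((j : ℝ) / N) • vs t := by
          rw [smul_sub, sub_smul, one_smul]; abel
        rw [h2]
        refine (norm_add_le _ _).trans ?_
        rw [norm_smul, norm_smul, Real.norm_eq_abs, Real.norm_eq_abs,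
          abs_of_nonneg (by linarith [h1.2]), abs_of_nonneg h1.1]
        have h3 : (1 - (j : ℝ) / N) * ‖v t‖ ≤ 1 * ‖v t‖ := by
          gcongr; linarith [h1.1]
        have h4 : ((j : ℝ) / N) * ‖vs t‖ ≤ 1 * ‖vs t‖ := by
          gcongr; exact h1.2
        simp only [hρ]
        linarith)
      hρi hD (by rw [hYN]; exact H₁) (hNδ.trans_le (min_le_left _ _))
      (fun j hj => by
        rw [(hY j hj.le).2.1, (hY (j + 1) hj).2.1]
        refine (hE j hj).2.trans ?_
        gcongr
        have := hM _ (hjmem j hj.le)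
        have := Real.sqrt_nonneg (4 / c * ((C₀ + 1) + (μ + 1) * D ^ 2 / (2 * lam)))
        rw [hℓdef]
        linarith)
      (fun j hj => by
        rw [(hY j hj.le).2.1, (hY (j + 1) hj).2.1]
        have h1 := (hE j hj).1
        have h2 := (Real.le_norm_self _).trans (hC₀ _ (hjmem j hj.le))
        simp only [hφ] at h2
        linarith)
      hexp (by
        refine le_trans ?_ hℓ
        gcongr)
    obtain ⟨hYK, hlink⟩ := hchain t ht
    have hsum := sq_norm_sub_le_of_chain (fun j => Γ (Y j t)) N
    simp only [hY0, hYN] at hsum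
    refine hsum.trans ?_
    set e₁ := Real.exp (ε * a) with he₁
    -- After multiplication by the Cauchy–Schwarz factor, `N U₀` is at most the Riemann term
    -- `φ(j/N)/N` plus `ε/N`, and `N (D/N)² = D²/N`; both sum to quantities bounded in `N`.
    have hterm : ∀ j ∈ Finset.range N, N * ‖Γ (Y (j + 1) t) - Γ (Y j t)‖ ^ 2 ≤
        κ * (e₁ * ((φ (j / N) / N + ε / N) + (μ + ε) * D ^ 2 / (2 * lam) / N)) + ε * ℓ ^ 2 / N := by
      intro j hj
      have hj' := Finset.mem_range.1 hj
      obtain ⟨h1, h2⟩ := hlink j hj'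
      have h3 := H₂ _ (hYK j hj'.le) _ (hYK (j + 1) hj') (by
        rw [dist_eq_norm]
        refine (h1.trans_lt (lt_of_le_of_lt ?_ hNδ)).trans_le (min_le_right _ _)
        gcongr; linarith)
      have h4 := (hE j hj').1
      rw [← (hY j hj'.le).2.1, ← (hY (j + 1) hj').2.1] at h4
      set U₀ := Q (Y j 0) (Y (j + 1) 0 - Y j 0) (Y (j + 1) 0 - Y j 0)
      have h5 : N * U₀ ≤ φ (j / N) / N + ε / N := by
        rw [← add_div, le_div_iff₀ hNr]
        have h6 : N * U₀ * N = (N : ℝ) ^ 2 * U₀ := by ring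
        rw [h6]
        simpa only [hφ, (hY j hj'.le).2.1] using h4
      have h7 : N * ((μ + ε) * (D / N) ^ 2 / (2 * lam)) = (μ + ε) * D ^ 2 / (2 * lam) / N := by
        field_simp
      have h8 : (N : ℝ) * (ε * (ℓ / N) ^ 2) = ε * ℓ ^ 2 / N := by field_simp
      calc N * ‖Γ (Y (j + 1) t) - Γ (Y j t)‖ ^ 2
          ≤ N * (κ * (e₁ * (U₀ + (μ + ε) * (D / N) ^ 2 / (2 * lam))) + ε * (ℓ / N) ^ 2) := by
            gcongr
            refine h3.trans ?_
            gcongr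
        _ = κ * (e₁ * (N * U₀ + N * ((μ + ε) * (D / N) ^ 2 / (2 * lam))))
            + N * (ε * (ℓ / N) ^ 2) := by ring
        _ ≤ _ := by rw [h7, h8]; gcongr
    rw [Finset.mul_sum]
    refine (Finset.sum_le_sum hterm).trans ?_
    rw [Finset.sum_add_distrib, ← Finset.mul_sum, ← Finset.mul_sum, Finset.sum_add_distrib,
      Finset.sum_add_distrib]
    have hconst : ∀ b : ℝ, ∑ _j ∈ Finset.range N, b / N = b := fun b => by
      rw [Finset.sum_const, Finset.card_range, nsmul_eq_mul, mul_div_cancel₀ _ hNr.ne']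
    rw [hconst, hconst, hconst]
    have hR := hN₁ N (by omega)
    have e₁0 : 0 ≤ e₁ := (Real.exp_pos _).le
    have hR' : ∑ j ∈ Finset.range N, φ (j / N) / N + ε ≤ (∫ s in (0 : ℝ)..1, φ s) + 2 * ε := by
      linarith
    exact add_le_add (mul_le_mul_of_nonneg_left (mul_le_mul_of_nonneg_left
      (add_le_add hR' le_rfl) e₁0) hκ) le_rfl
  have hlim : Tendsto (fun ε : ℝ =>
      κ * (Real.exp (ε * a) * (((∫ s in (0 : ℝ)..1, φ s) + 2 * ε) + (μ + ε) * D ^ 2 / (2 * lam)))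
        + ε * ℓ ^ 2) (𝓝[>] 0)
      (𝓝 (κ * (Real.exp (0 * a) * (((∫ s in (0 : ℝ)..1, φ s) + 2 * 0)
        + (μ + 0) * D ^ 2 / (2 * lam))) + 0 * ℓ ^ 2)) :=
    (Continuous.tendsto (by fun_prop) _).mono_left nhdsWithin_le_nhds
  have := ge_of_tendsto hlim key
  simpa using this

end Contraction

/-! ### Matrix functions, their quadratic forms and derivatives. -/

section Matrices

variable {a b d : ℕ}

@[simp] theorem ofLp_act (A : Matrix (Fin a) (Fin b) ℝ) (v : Vec b) :
    (act A v).ofLp = A *ᵥ v.ofLp := rfl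

theorem act_add (A : Matrix (Fin a) (Fin b) ℝ) (v w : Vec b) :
    act A (v + w) = act A v + act A w := by
  ext i; simp [act, Matrix.mulVec_add]

theorem act_zero (A : Matrix (Fin a) (Fin b) ℝ) : act A 0 = 0 := by
  ext i; simp [act]

theorem add_act (A B : Matrix (Fin a) (Fin b) ℝ) (v : Vec b) :
    act (A + B) v = act A v + act B v := by
  ext i; simp [act, Matrix.add_mulVec]

theorem smul_act (r : ℝ) (A : Matrix (Fin a) (Fin b) ℝ) (v : Vec b) :
    act (r • A) v = r • act A v := by
  ext i; simp [act, Matrix.smul_mulVec]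

theorem sum_act {ι : Type*} (s : Finset ι) (A : ι → Matrix (Fin a) (Fin b) ℝ) (v : Vec b) :
    act (∑ i ∈ s, A i) v = ∑ i ∈ s, act (A i) v := by
  ext i; simp [act, Matrix.sum_mulVec]

theorem mul_act {c : ℕ} (A : Matrix (Fin a) (Fin b) ℝ) (B : Matrix (Fin b) (Fin c) ℝ) (v : Vec c) :
    act (A * B) v = act A (act B v) := by
  ext i; simp [act, Matrix.mulVec_mulVec]

theorem one_act (v : Vec a) : act (1 : Matrix (Fin a) (Fin a) ℝ) v = v := by
  ext i; simp [act]

theorem act_eq_sum_colField (Q : Vec d → Matrix (Fin a) (Fin b) ℝ) (x : Vec d) (v : Vec b) :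
    act (Q x) v = ∑ i, v i • colField Q i x := by
  ext r
  simp [act, colField, Matrix.mulVec, dotProduct, mul_comm]

theorem act_jac (F : Vec b → Vec a) (x v : Vec b) : act (jac F x) v = fderiv ℝ F x v := by
  have hv : v = ∑ j, v j • EuclideanSpace.single j (1 : ℝ) := by
    ext i
    simp [Finset.sum_apply, Pi.single_apply]
  ext i
  conv_rhs => rw [hv, map_sum]
  simp [act, jac, Matrix.mulVec, dotProduct, mul_comm]

theorem norm_sq_eq_dotProduct (v : Vec a) : ‖v‖ ^ 2 = v.ofLp ⬝ᵥ v.ofLp := by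
  rw [EuclideanSpace.real_norm_sq_eq, dotProduct]
  exact Finset.sum_congr rfl fun i _ => sq _

namespace MatContDiffAt

variable {r : WithTop ℕ∞} {x : Vec d} {c : ℕ}

theorem of_le {r' : WithTop ℕ∞} {A : Vec d → Matrix (Fin a) (Fin b) ℝ} (h : MatContDiffAt r A x)
    (hr : r' ≤ r) : MatContDiffAt r' A x := fun i j => (h i j).of_le hr

theorem transpose {A : Vec d → Matrix (Fin a) (Fin b) ℝ} (h : MatContDiffAt r A x) :
    MatContDiffAt r (fun y => (A y)ᵀ) x := fun i j => h j i

theorem mul {A : Vec d → Matrix (Fin a) (Fin b) ℝ} {B : Vec d → Matrix (Fin b) (Fin c) ℝ}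
    (hA : MatContDiffAt r A x) (hB : MatContDiffAt r B x) :
    MatContDiffAt r (fun y => A y * B y) x := by
  intro i j
  simp only [Matrix.mul_apply]
  exact ContDiffAt.sum fun k _ => (hA i k).mul (hB k j)

theorem det {A : Vec d → Matrix (Fin a) (Fin a) ℝ} (hA : MatContDiffAt r A x) :
    ContDiffAt ℝ r (fun y => (A y).det) x := by
  simp only [Matrix.det_apply']
  exact ContDiffAt.sum fun σ _ => contDiffAt_const.mul (contDiffAt_prod fun i _ => hA _ _)

/-- Cramer's rule: adjugate entries are determinants of the matrix with one row replaced by a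
constant one. -/
theorem inv {A : Vec d → Matrix (Fin a) (Fin a) ℝ} (hA : MatContDiffAt r A x)
    (h : (A x).det ≠ 0) : MatContDiffAt r (fun y => (A y)⁻¹) x := by
  intro i j
  simp only [Matrix.inv_def, Matrix.smul_apply, Ring.inverse_eq_inv', smul_eq_mul,
    Matrix.adjugate_apply]
  refine (hA.det.inv h).mul (MatContDiffAt.det fun k l => ?_)
  by_cases hk : k = j
  · subst hk
    simp only [Matrix.updateRow_self]
    exact contDiffAt_const
  · simp only [Matrix.updateRow_ne hk]
    exact hA k l

theorem colField {A : Vec d → Matrix (Fin a) (Fin b) ℝ} (hA : MatContDiffAt r A x) (i : Fin b) :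
    ContDiffAt ℝ r (colField A i) x :=
  contDiffAt_euclidean.2 fun k => hA k i

end MatContDiffAt

/-- The bilinear form on Euclidean vectors with a given matrix. -/
def matForm (A : Matrix (Fin a) (Fin a) ℝ) : Vec a →L[ℝ] Vec a →L[ℝ] ℝ :=
  ∑ i, ∑ j, (A i j • (EuclideanSpace.proj i : Vec a →L[ℝ] ℝ)).smulRight
    (EuclideanSpace.proj j : Vec a →L[ℝ] ℝ)

theorem matForm_apply (A : Matrix (Fin a) (Fin a) ℝ) (v w : Vec a) :
    matForm A v w = v.ofLp ⬝ᵥ (A *ᵥ w.ofLp) := by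
  simp only [matForm, _root_.sum_apply, _root_.smul_apply, ContinuousLinearMap.smulRight_apply,
    PiLp.proj_apply, dotProduct, Matrix.mulVec, smul_eq_mul, Finset.mul_sum]
  refine Finset.sum_congr rfl fun i _ => Finset.sum_congr rfl fun j _ => ?_
  ring

theorem MatContDiffAt.matForm {r : WithTop ℕ∞} {A : Vec d → Matrix (Fin a) (Fin a) ℝ} {x : Vec d}
    (hA : MatContDiffAt r A x) : ContDiffAt ℝ r (fun y => matForm (A y)) x :=
  ContDiffAt.sum fun i _ => ContDiffAt.sum fun j _ =>
    ((hA i j).smul contDiffAt_const).smulRight contDiffAt_const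

theorem fderiv_mulVec_apply {A : Vec d → Matrix (Fin a) (Fin b) ℝ} {x : Vec d}
    (hA : MatContDiffAt 1 A x) (ξ : Fin b → ℝ) (v : Vec d) (k : Fin a) :
    fderiv ℝ (fun y => (A y *ᵥ ξ) k) x v = (dirDeriv A v x *ᵥ ξ) k := by
  have h1 : HasFDerivAt (fun y => ∑ j, A y k j * ξ j)
      (∑ j, ξ j • fderiv ℝ (fun y => A y k j) x) x :=
    HasFDerivAt.fun_sum fun j _ => (((hA k j).differentiableAt one_ne_zero).hasFDerivAt).mul_const _
  change fderiv ℝ (fun y => ∑ j, A y k j * ξ j) x v = _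
  rw [h1.fderiv]
  simp [dirDeriv, Matrix.mulVec, dotProduct, _root_.sum_apply, mul_comm]

theorem fderiv_dotProduct_mulVec {u : Vec d → Fin a → ℝ} {M : Vec d → Matrix (Fin a) (Fin a) ℝ}
    {x : Vec d} (hu : ∀ k, DifferentiableAt ℝ (fun y => u y k) x) (hM : MatContDiffAt 1 M x)
    (v : Vec d) :
    fderiv ℝ (fun y => u y ⬝ᵥ (M y *ᵥ u y)) x v =
      (fun k => fderiv ℝ (fun y => u y k) x v) ⬝ᵥ (M x *ᵥ u x)
      + u x ⬝ᵥ (dirDeriv M v x *ᵥ u x)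
      + u x ⬝ᵥ (M x *ᵥ fun k => fderiv ℝ (fun y => u y k) x v) := by
  have hM' : ∀ k l, HasFDerivAt (fun y => M y k l) (fderiv ℝ (fun y => M y k l) x) x :=
    fun k l => ((hM k l).differentiableAt one_ne_zero).hasFDerivAt
  have h1 : HasFDerivAt (fun y => ∑ k, u y k * ∑ l, M y k l * u y l)
      (∑ k, (u x k • (∑ l, (M x k l • fderiv ℝ (fun y => u y l) x
        + u x l • fderiv ℝ (fun y => M y k l) x))
        + (∑ l, M x k l * u x l) • fderiv ℝ (fun y => u y k) x)) x :=
    HasFDerivAt.fun_sum fun k _ => (hu k).hasFDerivAt.mul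
      (HasFDerivAt.fun_sum fun l _ => (hM' k l).mul (hu l).hasFDerivAt)
  change fderiv ℝ (fun y => ∑ k, u y k * ∑ l, M y k l * u y l) x v = _
  rw [h1.fderiv]
  simp only [dotProduct, Matrix.mulVec, dirDeriv, Matrix.of_apply, _root_.sum_apply,
    _root_.add_apply, _root_.smul_apply, smul_eq_mul, ← Finset.sum_add_distrib]
  refine Finset.sum_congr rfl fun k _ => ?_
  rw [Finset.sum_add_distrib, mul_add]
  have h2 : ∀ l, u x l * fderiv ℝ (fun y => M y k l) x v
      = fderiv ℝ (fun y => M y k l) x v * u x l := fun l => mul_comm _ _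
  simp only [h2]
  ring

theorem dotProduct_symPart_mulVec (N : Matrix (Fin a) (Fin a) ℝ) (v : Fin a → ℝ) :
    v ⬝ᵥ (symPart N *ᵥ v) = 2 * (v ⬝ᵥ (N *ᵥ v)) := by
  rw [symPart, Matrix.add_mulVec, dotProduct_add, Matrix.mulVec_transpose, dotProduct_comm v (v ᵥ* N),
    ← Matrix.dotProduct_mulVec, two_mul]

end Matrices

/-! ### Smooth paths in a connected component. -/

section SmoothPaths

variable {E : Type*} [NormedAddCommGroup E] [NormedSpace ℝ E]

/-- `a` and `b` are the ends of a smooth curve in `X` that is constant outside a compact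
interval. -/
def SmoothlyJoined (X : Set E) (a b : E) : Prop :=
  ∃ (γ : ℝ → E) (L : ℝ), 0 < L ∧ ContDiff ℝ ∞ γ ∧ (∀ s, γ s ∈ X) ∧ (∀ s ≤ 0, γ s = a) ∧
    ∀ s, L ≤ s → γ s = b

namespace SmoothlyJoined

variable {X : Set E} {a b d : E}

theorem refl (ha : a ∈ X) : SmoothlyJoined X a a :=
  ⟨fun _ => a, 1, one_pos, contDiff_const, fun _ => ha, fun _ _ => rfl, fun _ _ => rfl⟩

theorem symm (h : SmoothlyJoined X a b) : SmoothlyJoined X b a := by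
  obtain ⟨γ, L, hL, hγ, hX, h0, h1⟩ := h
  exact ⟨fun s => γ (L - s), L, hL, hγ.comp (contDiff_const.sub contDiff_id), fun s => hX _,
    fun s hs => h1 _ (by linarith), fun s hs => h0 _ (by linarith)⟩

/-- Since `γ = b` after `L` and `γ' = b` before `0`, the sum `γ(s) + γ'(s - L) - b` is the
concatenation, and it is smooth without any gluing argument. -/
theorem trans (h : SmoothlyJoined X a b) (h' : SmoothlyJoined X b d) : SmoothlyJoined X a d := by
  obtain ⟨γ, L, hL, hγ, hX, h0, h1⟩ := h
  obtain ⟨γ', L', hL', hγ', hX', h0', h1'⟩ := h'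
  have e1 : ∀ s ≤ L, γ s + γ' (s - L) - b = γ s := fun s hs => by
    rw [h0' _ (by linarith)]; abel
  have e2 : ∀ s, L ≤ s → γ s + γ' (s - L) - b = γ' (s - L) := fun s hs => by
    rw [h1 _ hs]; abel
  refine ⟨fun s => γ s + γ' (s - L) - b, L + L', by positivity,
    (hγ.add (hγ'.comp (contDiff_id.sub contDiff_const))).sub contDiff_const, fun s => ?_,
    fun s hs => ?_, fun s hs => ?_⟩
  · rcases le_total s L with hs | hs
    · simp only [e1 s hs]; exact hX s
    · simp only [e2 s hs]; exact hX' _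
  · simp only [e1 s (hs.trans hL.le)]; exact h0 s hs
  · simp only [e2 s (by linarith)]; exact h1' _ (by linarith)

/-- A smooth path defined near `[0, 1]` can be reparametrised so as to be constant near its
ends. -/
theorem of_contDiffOn {γ : ℝ → E} {U : Set ℝ} (hU : IsOpen U) (hI : Icc 0 1 ⊆ U)
    (hγ : ContDiffOn ℝ ∞ γ U) (hX : ∀ s ∈ Icc (0 : ℝ) 1, γ s ∈ X) :
    SmoothlyJoined X (γ 0) (γ 1) := by
  have hmem : ∀ s, Real.smoothTransition s ∈ Icc (0 : ℝ) 1 := fun s =>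
    ⟨Real.smoothTransition.nonneg s, Real.smoothTransition.le_one s⟩
  refine ⟨fun s => γ (Real.smoothTransition s), 1, one_pos, ?_, fun s => hX _ (hmem s),
    fun s hs => by simp only [Real.smoothTransition.zero_of_nonpos hs],
    fun s hs => by simp only [Real.smoothTransition.one_of_one_le hs]⟩
  rw [contDiff_iff_contDiffAt]
  intro s
  exact ((hγ _ (hI (hmem s))).contDiffAt (hU.mem_nhds (hI (hmem s)))).comp s
    Real.smoothTransition.contDiffAt

end SmoothlyJoined

theorem SmoothlyJoined.paths_nonempty {n : ℕ} {X : Set (Vec n)} {a b : Vec n}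
    (h : SmoothlyJoined X a b) : (paths X a b).Nonempty := by
  obtain ⟨γ, L, hL, hγ, hX, h0, h1⟩ := h
  exact ⟨fun s => γ (L * s), (hγ.comp (contDiff_const.mul contDiff_id)).contDiffOn,
    fun s _ => hX _, by simpa using h0 0 le_rfl, by simpa using h1 L le_rfl⟩

variable {q : ℕ} {X : Set E}

/-- The path is a straight segment in a ball of the chart target, mapped back by the inverse chart.
-/
theorem eventually_smoothlyJoined [ChartedSpace (Vec q) X] [IsManifold (𝓡 q) ∞ X]
    (hval : ContMDiff (𝓡 q) (modelWithCornersSelf ℝ E) ∞ (Subtype.val : X → E)) (x : X) :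
    ∀ᶠ y : X in 𝓝 x, SmoothlyJoined X (x : E) y := by
  set e := extChartAt (𝓡 q) x with he
  have hopen : IsOpen e.target := isOpen_extChartAt_target x
  obtain ⟨r, hr, hball⟩ := Metric.isOpen_iff.1 hopen (e x) (mem_extChartAt_target x)
  have hcont : ContinuousAt e x := continuousAt_extChartAt x
  have hsm : ContDiffOn ℝ ∞ (fun p => ((e.symm p : X) : E)) e.target := by
    rw [← contMDiffOn_iff_contDiffOn]
    exact hval.comp_contMDiffOn (contMDiffOn_extChartAt_symm x)
  filter_upwards [hcont.preimage_mem_nhds (Metric.ball_mem_nhds _ hr),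
    extChartAt_source_mem_nhds (I := 𝓡 q) x] with y hy hys
  let ℓ : ℝ → Vec q := fun s => e x + s • (e y - e x)
  have hℓ : ContDiff ℝ ∞ ℓ := contDiff_const.add (contDiff_id.smul contDiff_const)
  have hseg : ∀ s ∈ Icc (0 : ℝ) 1, ℓ s ∈ Metric.ball (e x) r := fun s hs =>
    (convex_ball (e x) r).add_smul_sub_mem (Metric.mem_ball_self hr) hy hs
  have key := SmoothlyJoined.of_contDiffOn (X := X) (γ := fun s => ((e.symm (ℓ s) : X) : E))
    (U := ℓ ⁻¹' Metric.ball (e x) r) (Metric.isOpen_ball.preimage hℓ.continuous) hseg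
    (hsm.comp hℓ.contDiffOn fun s hs => hball hs) fun s _ => (e.symm (ℓ s)).2
  have h0 : e.symm (ℓ 0) = x := by simp [ℓ, he]
  have h1 : e.symm (ℓ 1) = y := by
    simp only [ℓ, one_smul, add_sub_cancel]
    exact e.left_inv hys
  simpa only [h0, h1] using key

/-- By local joinability, symmetry and transitivity, the points joined to `a` form a clopen subset
of `X`. -/
theorem smoothlyJoined_of_mem_connectedComponentIn [ChartedSpace (Vec q) X]
    [IsManifold (𝓡 q) ∞ X]
    (hval : ContMDiff (𝓡 q) (modelWithCornersSelf ℝ E) ∞ (Subtype.val : X → E)) {a b : E}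
    (ha : a ∈ X) (hb : b ∈ connectedComponentIn X a) : SmoothlyJoined X a b := by
  set J : Set X := {y | SmoothlyJoined X a y} with hJ
  have hcl : IsClopen J := by
    constructor
    · rw [← isOpen_compl_iff, isOpen_iff_mem_nhds]
      intro y hy
      filter_upwards [eventually_smoothlyJoined hval y] with z hz hzJ
      exact hy (SmoothlyJoined.trans hzJ hz.symm)
    · rw [isOpen_iff_mem_nhds]
      intro y hy
      filter_upwards [eventually_smoothlyJoined hval y] with z hz
      exact SmoothlyJoined.trans hy hz
  rw [connectedComponentIn_eq_image ha] at hb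
  obtain ⟨y, hy, rfl⟩ := hb
  exact hcl.connectedComponent_subset (show (⟨a, ha⟩ : X) ∈ J from SmoothlyJoined.refl ha) hy

end SmoothPaths

/-! ### The closed loop as a field linear in its inputs. -/

section Systems

variable {n m p l q : ℕ} {h : Vec n → Vec (n - q)} {sys : System n m p l}
  {S : Vec n → Matrix (Fin n) (Fin q) ℝ} {M : Vec n → Matrix (Fin q) (Fin q) ℝ}
  {k : Vec n → Vec n → Vec m} {α lam μ : ℝ}

theorem det_transpose_mul_self_ne_zero {a b : ℕ} {A : Matrix (Fin a) (Fin b) ℝ}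
    (hA : Function.Injective (act A)) : (Aᵀ * A).det ≠ 0 := by
  intro h0
  obtain ⟨v, hv, hv0⟩ := Matrix.exists_mulVec_eq_zero_iff.2 h0
  have h1 : act A (WithLp.toLp 2 v) = 0 := by
    rw [← norm_eq_zero, ← sq_eq_zero_iff, norm_sq_eq_dotProduct]
    change (A *ᵥ v) ⬝ᵥ (A *ᵥ v) = 0
    rw [Matrix.dotProduct_mulVec, ← Matrix.mulVec_transpose, Matrix.mulVec_mulVec, hv0,
      zero_dotProduct]
  have h2 := hA (h1.trans (act_zero A).symm)
  exact hv (congrArg WithLp.ofLp h2)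

namespace LieSystem

variable {x : Vec n}

theorem det_ne_zero (hsys : LieSystem h sys S) (hx : x ∈ stateSpace h) :
    ((S x)ᵀ * S x).det ≠ 0 := det_transpose_mul_self_ne_zero (hsys.S_indep x hx)

theorem proj_transpose_mul (hsys : LieSystem h sys S) (hx : x ∈ stateSpace h) :
    (proj S x)ᵀ * S x = 1 := by
  rw [proj, Matrix.transpose_mul, Matrix.transpose_nonsing_inv, Matrix.transpose_mul,
    Matrix.transpose_transpose, Matrix.mul_assoc]
  exact Matrix.nonsing_inv_mul _ (isUnit_iff_ne_zero.2 (hsys.det_ne_zero hx))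

theorem proj_C1 (hsys : LieSystem h sys S) (hx : x ∈ stateSpace h) :
    MatContDiffAt 1 (proj S) x := by
  have h1 : MatContDiffAt 1 S x := (hsys.S_smooth x hx).of_le (by simp)
  exact h1.mul ((h1.transpose.mul h1).inv (hsys.det_ne_zero hx))

theorem eq_act_of_tangent (hsys : LieSystem h sys S) (hx : x ∈ stateSpace h)
    {ξ : Vec n} (hξ : fderiv ℝ h x ξ = 0) :
    ξ = act (S x) (act (proj S x)ᵀ ξ) := by
  obtain ⟨v, rfl⟩ := (hsys.S_span x hx ξ).1 hξ
  rw [← mul_act (proj S x)ᵀ, hsys.proj_transpose_mul hx, one_act]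

end LieSystem

/-- The right-hand side of the state equation with `u = k(x, x*) + u*` as a linear function of
`(1, u*, w)`. -/
def inputField (sys : System n m p l) (k : Vec n → Vec n → Vec m) (a : Vec n × Vec n) :
    (ℝ × Vec m × Vec p) →L[ℝ] Vec n :=
  (ContinuousLinearMap.fst ℝ ℝ (Vec m × Vec p)).smulRight
      (sys.f a.1 + ∑ i, k a.1 a.2 i • colField sys.B i a.1)
    + ∑ i, ((EuclideanSpace.proj i : Vec m →L[ℝ] ℝ).comp ((ContinuousLinearMap.fst ℝ _ _).comp
        (ContinuousLinearMap.snd ℝ ℝ (Vec m × Vec p)))).smulRight (colField sys.B i a.1)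
    + ∑ j, ((EuclideanSpace.proj j : Vec p →L[ℝ] ℝ).comp ((ContinuousLinearMap.snd ℝ _ _).comp
        (ContinuousLinearMap.snd ℝ ℝ (Vec m × Vec p)))).smulRight (colField sys.Bw j a.1)

theorem inputField_apply (x z : Vec n) (s : ℝ) (u : Vec m) (w : Vec p) :
    inputField sys k (x, z) (s, u, w)
      = s • (sys.f x + act (sys.B x) (k x z)) + act (sys.B x) u + act (sys.Bw x) w := by
  simp [inputField, act_eq_sum_colField, _root_.sum_apply]

theorem rhs_eq_inputField (x z : Vec n) (u : Vec m) (w : Vec p) :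
    sys.rhs x (k x z + u) w = inputField sys k (x, z) (1, u, w) := by
  rw [inputField_apply, System.rhs, act_add, one_smul]
  abel

theorem LieSystem.inputField_C1 (hsys : LieSystem h sys S) (hk : IsFeedback (stateSpace h) k)
    {x z : Vec n} (hx : x ∈ stateSpace h) (hz : z ∈ stateSpace h) :
    ContDiffAt ℝ 1 (inputField sys k) (x, z) := by
  have hf : ContDiffAt ℝ 1 (fun a : Vec n × Vec n => sys.f a.1) (x, z) :=
    (hsys.f_C1 x hx).comp (x, z) contDiffAt_fst
  have hB : ∀ i, ContDiffAt ℝ 1 (fun a : Vec n × Vec n => colField sys.B i a.1) (x, z) := fun i =>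
    ContDiffAt.comp (g := colField sys.B i) (f := Prod.fst) (x, z)
      ((hsys.B_C1 x hx).colField i) contDiffAt_fst
  have hBw : ∀ i, ContDiffAt ℝ 1 (fun a : Vec n × Vec n => colField sys.Bw i a.1) (x, z) := fun i =>
    ContDiffAt.comp (g := colField sys.Bw i) (f := Prod.fst) (x, z)
      ((hsys.Bw_C1 x hx).colField i) contDiffAt_fst
  have hki : ∀ i, ContDiffAt ℝ 1 (fun a : Vec n × Vec n => k a.1 a.2 i) (x, z) :=
    contDiffAt_euclidean.1 (hk.C1 x hx z hz)
  refine ContDiffAt.add (ContDiffAt.add ?_ ?_) ?_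
  · exact contDiffAt_const.smulRight
      (hf.add (ContDiffAt.sum fun i _ => (hki i).smul (hB i)))
  · exact ContDiffAt.sum fun i _ => contDiffAt_const.smulRight (hB i)
  · exact ContDiffAt.sum fun i _ => contDiffAt_const.smulRight (hBw i)

theorem IsFeedback.differentiableAt {X : Set (Vec n)} (hk : IsFeedback X k) {x z : Vec n}
    (hx : x ∈ X) (hz : z ∈ X) : DifferentiableAt ℝ (fun y => k y z) x := by
  have h1 : DifferentiableAt ℝ (fun a : Vec n × Vec n => k a.1 a.2) (x, z) :=
    (hk.C1 x hx z hz).differentiableAt one_ne_zero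
  exact h1.comp (f := fun y => (y, z)) x (differentiableAt_id.prodMk (differentiableAt_const z))

/-- Only the state varies, with reference and input frozen. The vector fields contribute `A ξ` and
the feedback contributes `B K ξ`, the closed-loop linearisation that enters `𝒜`. -/
theorem LieSystem.fderiv_inputField (hsys : LieSystem h sys S) (hk : IsFeedback (stateSpace h) k)
    {x z : Vec n} (hx : x ∈ stateSpace h) (hz : z ∈ stateSpace h) (u : Vec m) (w : Vec p)
    (ξ : Vec n) :
    fderiv ℝ (inputField sys k) (x, z) (ξ, 0) (1, u, w)
      = act (matA sys x (k x z + u) w) ξ + act (sys.B x) (act (matK k x z) ξ) := by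
  have hG : HasFDerivAt (inputField sys k) (fderiv ℝ (inputField sys k) (x, z)) (x, z) :=
    ((hsys.inputField_C1 hk hx hz).differentiableAt one_ne_zero).hasFDerivAt
  have h1 : HasFDerivAt (fun y => inputField sys k (y, z))
      ((fderiv ℝ (inputField sys k) (x, z)).comp (ContinuousLinearMap.inl ℝ (Vec n) (Vec n))) x :=
    HasFDerivAt.comp (g := inputField sys k) (f := fun y => (y, z)) x hG
      (hasFDerivAt_prodMk_left x z)
  have h2 := h1.clm_apply (hasFDerivAt_const ((1 : ℝ), u, w) x)
  have hb : ∀ i, HasFDerivAt (colField sys.B i) (fderiv ℝ (colField sys.B i) x) x := fun i =>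
    (((hsys.B_C1 x hx).colField i).differentiableAt one_ne_zero).hasFDerivAt
  have hbw : ∀ i, HasFDerivAt (colField sys.Bw i) (fderiv ℝ (colField sys.Bw i) x) x := fun i =>
    (((hsys.Bw_C1 x hx).colField i).differentiableAt one_ne_zero).hasFDerivAt
  have hf : HasFDerivAt sys.f (fderiv ℝ sys.f x) x :=
    ((hsys.f_C1 x hx).differentiableAt one_ne_zero).hasFDerivAt
  have hkk := (hk.differentiableAt hx hz).hasFDerivAt
  have hki : ∀ i, HasFDerivAt (fun y => k y z i + u i)
      ((EuclideanSpace.proj i : Vec m →L[ℝ] ℝ).comp (fderiv ℝ (fun y => k y z) x)) x := fun i =>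
    ((EuclideanSpace.proj i : Vec m →L[ℝ] ℝ).hasFDerivAt.comp x hkk).add_const (u i)
  have h3 := (hf.add (HasFDerivAt.fun_sum (u := Finset.univ) fun i _ => (hki i).smul (hb i))).add
    (HasFDerivAt.fun_sum (u := Finset.univ) fun j _ => (hbw j).const_smul (w j))
  have hfun : (fun y => inputField sys k (y, z) ((1 : ℝ), u, w)) =
      fun y => sys.f y + ∑ i, (k y z i + u i) • colField sys.B i y
        + ∑ j, w j • colField sys.Bw j y := by
    funext y
    rw [← rhs_eq_inputField, System.rhs, act_eq_sum_colField, act_eq_sum_colField]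
    rfl
  rw [hfun] at h2
  have h4 := DFunLike.congr_fun (h2.unique h3) ξ
  have h5 : fderiv ℝ (inputField sys k) (x, z) (ξ, 0) (1, u, w) =
      fderiv ℝ sys.f x ξ + ∑ i, ((k x z i + u i) • fderiv ℝ (colField sys.B i) x ξ
        + (fderiv ℝ (fun y => k y z) x ξ) i • colField sys.B i x)
        + ∑ j, w j • fderiv ℝ (colField sys.Bw j) x ξ := by
    simpa [_root_.sum_apply] using h4
  rw [h5, matA, add_act, add_act, sum_act, sum_act, act_jac, act_eq_sum_colField sys.B x]
  simp only [smul_act, act_jac, Finset.sum_add_distrib, matK, PiLp.add_apply]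
  abel

end Systems

/-! ### From the matrix inequalities to a contracting system. -/

section Systems

variable {n m p l q : ℕ} {h : Vec n → Vec (n - q)} {sys : System n m p l}
  {S : Vec n → Matrix (Fin n) (Fin q) ℝ} {M : Vec n → Matrix (Fin q) (Fin q) ℝ}
  {k : Vec n → Vec n → Vec m} {α lam μ : ℝ}

/-- The Riemannian energy density `v ↦ vᵀ M v`, `v = P_Sᵀ ξ`, as a bilinear form in `ξ`. -/
def metricForm (S : Vec n → Matrix (Fin n) (Fin q) ℝ) (M : Vec n → Matrix (Fin q) (Fin q) ℝ)
    (x : Vec n) : Vec n →L[ℝ] Vec n →L[ℝ] ℝ :=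
  matForm (proj S x * M x * (proj S x)ᵀ)

theorem metricForm_apply (x ξ ζ : Vec n) : metricForm S M x ξ ζ =
    ((proj S x)ᵀ *ᵥ ξ.ofLp) ⬝ᵥ (M x *ᵥ ((proj S x)ᵀ *ᵥ ζ.ofLp)) := by
  rw [metricForm, matForm_apply, ← Matrix.mulVec_mulVec, ← Matrix.mulVec_mulVec,
    Matrix.dotProduct_mulVec, ← Matrix.mulVec_transpose]

theorem LieSystem.metricForm_C1 (hsys : LieSystem h sys S)
    (hM : IsUniformMetric (stateSpace h) M) {x : Vec n} (hx : x ∈ stateSpace h) :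
    ContDiffAt ℝ 1 (metricForm S M) x :=
  (((hsys.proj_C1 hx).mul (hM.C1 x hx)).mul (hsys.proj_C1 hx).transpose).matForm

theorem dotProduct_mulVec_comm_of_isSymm {a : ℕ} {A : Matrix (Fin a) (Fin a) ℝ} (hA : A.IsSymm)
    (v w : Fin a → ℝ) : v ⬝ᵥ (A *ᵥ w) = w ⬝ᵥ (A *ᵥ v) := by
  rw [Matrix.dotProduct_mulVec, ← Matrix.mulVec_transpose, hA.eq, dotProduct_comm]

theorem metricForm_symm (hM : IsUniformMetric (stateSpace h) M) {x : Vec n}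
    (hx : x ∈ stateSpace h) (ξ ζ : Vec n) : metricForm S M x ξ ζ = metricForm S M x ζ ξ := by
  rw [metricForm_apply, metricForm_apply, dotProduct_mulVec_comm_of_isSymm (hM.symm x hx)]

/-- `P_Sᵀ` varies with the base point as well as `M`; its derivative accounts for the term `∂_{x'}
P_Sᵀ` of `𝒜`. -/
theorem LieSystem.fderiv_metricForm (hsys : LieSystem h sys S)
    (hM : IsUniformMetric (stateSpace h) M) {x : Vec n} (hx : x ∈ stateSpace h) (v ξ : Vec n) :
    fderiv ℝ (metricForm S M) x v ξ ξ =
      ((proj S x)ᵀ *ᵥ ξ.ofLp) ⬝ᵥ (dirDeriv M v x *ᵥ ((proj S x)ᵀ *ᵥ ξ.ofLp))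
      + 2 * (((proj S x)ᵀ *ᵥ ξ.ofLp) ⬝ᵥ
        (M x *ᵥ (dirDeriv (fun y => (proj S y)ᵀ) v x *ᵥ ξ.ofLp))) := by
  have hQ : HasFDerivAt (metricForm S M) (fderiv ℝ (metricForm S M) x) x :=
    ((hsys.metricForm_C1 hM hx).differentiableAt one_ne_zero).hasFDerivAt
  have h1 := (hQ.clm_apply (hasFDerivAt_const ξ x)).clm_apply (hasFDerivAt_const ξ x)
  have h2 : fderiv ℝ (metricForm S M) x v ξ ξ
      = fderiv ℝ (fun y => metricForm S M y ξ ξ) x v := by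
    rw [h1.fderiv]; simp
  have hPT := (hsys.proj_C1 hx).transpose
  have hd : ∀ i, DifferentiableAt ℝ (fun y => ((proj S y)ᵀ *ᵥ ξ.ofLp) i) x := fun i => by
    change DifferentiableAt ℝ (fun y => ∑ j, (proj S y)ᵀ i j * ξ.ofLp j) x
    exact DifferentiableAt.fun_sum fun j _ => ((hPT i j).differentiableAt one_ne_zero).mul_const _
  simp only [metricForm_apply] at h2
  rw [h2, fderiv_dotProduct_mulVec hd (hM.C1 x hx)]
  have h3 : (fun i => fderiv ℝ (fun y => ((proj S y)ᵀ *ᵥ ξ.ofLp) i) x v)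
      = dirDeriv (fun y => (proj S y)ᵀ) v x *ᵥ ξ.ofLp :=
    funext fun i => fderiv_mulVec_apply hPT ξ.ofLp v i
  rw [h3, dotProduct_mulVec_comm_of_isSymm (hM.symm x hx)]
  ring

/-- The matrix inequality `R₁ ⪯ 0` as an infinitesimal contraction inequality. -/
theorem LieSystem.contraction (hsys : LieSystem h sys S)
    (hM : IsUniformMetric (stateSpace h) M) (hk : IsFeedback (stateSpace h) k)
    {x z : Vec n} (hx : x ∈ stateSpace h) (hz : z ∈ stateSpace h) (u : Vec m) (w w' : Vec p)
    (hR : (-(R₁ sys S k M lam μ x z u w)).PosSemidef) {ξ : Vec n} (hξ : fderiv ℝ h x ξ = 0) :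
    fderiv ℝ (metricForm S M) x (inputField sys k (x, z) (1, u, w)) ξ ξ
      + 2 * metricForm S M x ξ (fderiv ℝ (inputField sys k) (x, z) (ξ, 0) (1, u, w)
        + inputField sys k (x, z) (0, 0, w'))
      ≤ -(2 * lam) * metricForm S M x ξ ξ + μ * ‖w'‖ ^ 2 := by
  -- For tangent `ξ` one has `ξ = S a` with `a = P_Sᵀ ξ`, so the trailing factor `S` of `𝒜` turns
  -- `a` back into `ξ`.
  have hξS := congrArg WithLp.ofLp (hsys.eq_act_of_tangent hx hξ)
  simp only [ofLp_act] at hξS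
  have h1 : inputField sys k (x, z) (0, 0, w') = act (sys.Bw x) w' := by
    rw [inputField_apply, zero_smul, act_zero]; simp
  rw [hsys.fderiv_metricForm hM hx, ← rhs_eq_inputField, hsys.fderiv_inputField hk hx hz, h1,
    metricForm_apply, metricForm_apply]
  set P := (proj S x)ᵀ
  set a := P *ᵥ ξ.ofLp with ha
  have hQ := hR.dotProduct_mulVec_nonneg (Sum.elim a w'.ofLp)
  rw [star_trivial, Matrix.neg_mulVec, dotProduct_neg, R₁, Matrix.fromBlocks_mulVec,
    sumElim_dotProduct_sumElim] at hQ
  simp only [Sum.elim_comp_inl, Sum.elim_comp_inr, Matrix.add_mulVec, dotProduct_add,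
    dotProduct_symPart_mulVec, Matrix.smul_mulVec, dotProduct_smul, Matrix.neg_mulVec,
    Matrix.one_mulVec, dotProduct_neg, smul_eq_mul, ← norm_sq_eq_dotProduct] at hQ
  have h2 : w'.ofLp ⬝ᵥ ((matEw sys S x)ᵀ * M x) *ᵥ a = a ⬝ᵥ (M x * matEw sys S x) *ᵥ w'.ofLp := by
    rw [Matrix.dotProduct_mulVec, ← Matrix.mulVec_transpose, Matrix.transpose_mul,
      Matrix.transpose_transpose, (hM.symm x hx).eq, dotProduct_comm]
  have h3 : a ⬝ᵥ (M x * calA sys S k x z u w) *ᵥ a =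
      a ⬝ᵥ M x *ᵥ (dirDeriv (fun y => (proj S y)ᵀ) (sys.rhs x (k x z + u) w) x *ᵥ ξ.ofLp)
      + a ⬝ᵥ M x *ᵥ (P *ᵥ (matA sys x (k x z + u) w *ᵥ ξ.ofLp))
      + a ⬝ᵥ M x *ᵥ (P *ᵥ (sys.B x *ᵥ (matK k x z *ᵥ ξ.ofLp))) := by
    rw [calA, ← Matrix.mulVec_mulVec, ← Matrix.mulVec_mulVec, ← hξS, Matrix.add_mulVec,
      Matrix.add_mulVec, matE, ← Matrix.mulVec_mulVec, ← Matrix.mulVec_mulVec,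
      ← Matrix.mulVec_mulVec, Matrix.mulVec_add, Matrix.mulVec_add, dotProduct_add, dotProduct_add]
  rw [h2, h3, matEw, ← Matrix.mulVec_mulVec, ← Matrix.mulVec_mulVec] at hQ
  simp only [WithLp.ofLp_add, ofLp_act, Matrix.mulVec_add, dotProduct_add]
  linarith

/-- The matrix inequality `R₂ ⪰ 0` bounds the output derivative by the energy density. -/
theorem LieSystem.output_bound (hsys : LieSystem h sys S) (hk : IsFeedback (stateSpace h) k)
    (hα : 0 < α) {x z : Vec n} (hx : x ∈ stateSpace h) (hz : z ∈ stateSpace h) (u : Vec m)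
    (hR : (R₂ sys S k M α lam μ x z u).PosSemidef) {ξ : Vec n} (hξ : fderiv ℝ h x ξ = 0) :
    ‖fderiv ℝ (fun y => sys.g y (k y z + u)) x ξ‖ ^ 2 ≤ 2 * α * lam * metricForm S M x ξ ξ := by
  have hξS := hsys.eq_act_of_tangent hx hξ
  have hg : HasFDerivAt (fun a : Vec n × Vec m => sys.g a.1 a.2)
      (fderiv ℝ (fun a : Vec n × Vec m => sys.g a.1 a.2) (x, k x z + u)) (x, k x z + u) :=
    ((hsys.g_C1 x hx (k x z + u)).differentiableAt one_ne_zero).hasFDerivAt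
  set D := fderiv ℝ (fun a : Vec n × Vec m => sys.g a.1 a.2) (x, k x z + u)
  have hkk := (hk.differentiableAt hx hz).hasFDerivAt
  have e1 : HasFDerivAt (fun y => sys.g y (k y z + u))
      (D.comp ((ContinuousLinearMap.id ℝ (Vec n)).prod (fderiv ℝ (fun y => k y z) x))) x :=
    HasFDerivAt.comp (g := fun a : Vec n × Vec m => sys.g a.1 a.2)
      (f := fun y => (y, k y z + u)) x hg ((hasFDerivAt_id x).prodMk (hkk.add_const u))
  have e2 : HasFDerivAt (fun y => sys.g y (k x z + u))
      (D.comp (ContinuousLinearMap.inl ℝ (Vec n) (Vec m))) x :=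
    HasFDerivAt.comp (g := fun a : Vec n × Vec m => sys.g a.1 a.2)
      (f := fun y => (y, k x z + u)) x hg (hasFDerivAt_prodMk_left x _)
  have e3 : HasFDerivAt (fun v => sys.g x v)
      (D.comp (ContinuousLinearMap.inr ℝ (Vec n) (Vec m))) (k x z + u) :=
    HasFDerivAt.comp (g := fun a : Vec n × Vec m => sys.g a.1 a.2)
      (f := fun v => (x, v)) _ hg (hasFDerivAt_prodMk_right x _)
  set a := act (proj S x)ᵀ ξ with ha
  have e4 : fderiv ℝ (fun y => sys.g y (k y z + u)) x ξ = act (calC sys S k x z u) a := by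
    rw [calC, mul_act, ← hξS, add_act, mul_act, act_jac, matK, act_jac, act_jac, e1.fderiv,
      e2.fderiv, e3.fderiv]
    simp only [ContinuousLinearMap.comp_apply, ContinuousLinearMap.prod_apply,
      ContinuousLinearMap.id_apply, ContinuousLinearMap.inl_apply, ContinuousLinearMap.inr_apply]
    rw [← map_add]; simp
  -- Only the upper left block is used: `𝒞ᵀ 𝒞 ⪯ 2αλ M`.
  have hQ := hR.dotProduct_mulVec_nonneg (Sum.elim a.ofLp 0)
  rw [star_trivial, R₂, Matrix.fromBlocks_mulVec, sumElim_dotProduct_sumElim] at hQ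
  simp only [Sum.elim_comp_inl, Sum.elim_comp_inr, Matrix.sub_mulVec, Matrix.smul_mulVec,
    dotProduct_smul, dotProduct_sub, smul_eq_mul, zero_dotProduct, add_zero, Matrix.mulVec_zero]
    at hQ
  have e5 : a.ofLp ⬝ᵥ ((calC sys S k x z u)ᵀ * calC sys S k x z u) *ᵥ a.ofLp
      = ‖act (calC sys S k x z u) a‖ ^ 2 := by
    rw [norm_sq_eq_dotProduct, ← Matrix.mulVec_mulVec, Matrix.dotProduct_mulVec,
      ← Matrix.mulVec_transpose, Matrix.transpose_transpose]
    rfl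
  rw [e5] at hQ
  rw [e4, metricForm_apply]
  change _ ≤ 2 * α * lam * (a.ofLp ⬝ᵥ (M x *ᵥ a.ofLp))
  have e6 : ‖act (calC sys S k x z u) a‖ ^ 2 = α * (α⁻¹ * ‖act (calC sys S k x z u) a‖ ^ 2) := by
    rw [mul_inv_cancel_left₀ hα.ne']
  rw [e6]
  have e7 := mul_le_mul_of_nonneg_left (sub_nonneg.1 hQ) hα.le
  linarith

/-- With `ξ = S a`, the bounds `‖ξ‖² ≤ σ ‖a‖²` and `aᵀ M a ≥ m₁ ‖a‖²` combine; `max σ 1` is used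
because `σ` need not be positive. -/
theorem LieSystem.exists_coercive (hsys : LieSystem h sys S)
    (hM : IsUniformMetric (stateSpace h) M) :
    ∃ c : ℝ, 0 < c ∧ ∀ x ∈ stateSpace h, ∀ ξ, fderiv ℝ h x ξ = 0 →
      c * ‖ξ‖ ^ 2 ≤ metricForm S M x ξ ξ := by
  obtain ⟨m₁, m₂, hm₁, -, hb⟩ := hM.bounded
  obtain ⟨σ, hσ⟩ := hsys.S_bounded
  have hσ0 : 0 < max σ 1 := lt_max_of_lt_right one_pos
  refine ⟨m₁ / max σ 1, by positivity, fun x hx ξ hξ => ?_⟩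
  have hξS := hsys.eq_act_of_tangent hx hξ
  rw [metricForm_apply]
  set a := act (proj S x)ᵀ ξ with ha
  change _ ≤ a.ofLp ⬝ᵥ (M x *ᵥ a.ofLp)
  have h1 := (hσ x hx).dotProduct_mulVec_nonneg a.ofLp
  have h2 := (hb x hx).1.dotProduct_mulVec_nonneg a.ofLp
  have h3 : a.ofLp ⬝ᵥ ((S x)ᵀ * S x) *ᵥ a.ofLp = ‖ξ‖ ^ 2 := by
    have e : ξ.ofLp = S x *ᵥ a.ofLp := congrArg WithLp.ofLp hξS
    rw [norm_sq_eq_dotProduct, ← Matrix.mulVec_mulVec, Matrix.dotProduct_mulVec,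
      ← Matrix.mulVec_transpose, Matrix.transpose_transpose, e]
  simp only [star_trivial, Matrix.sub_mulVec, Matrix.smul_mulVec, Matrix.one_mulVec,
    dotProduct_sub, dotProduct_smul, smul_eq_mul, ← norm_sq_eq_dotProduct, h3] at h1 h2
  have h4 : ‖ξ‖ ^ 2 ≤ max σ 1 * ‖a‖ ^ 2 := by
    have : σ * ‖a‖ ^ 2 ≤ max σ 1 * ‖a‖ ^ 2 := by gcongr; exact le_max_left _ _
    linarith
  calc m₁ / max σ 1 * ‖ξ‖ ^ 2 ≤ m₁ / max σ 1 * (max σ 1 * ‖a‖ ^ 2) := by gcongr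
    _ = m₁ * ‖a‖ ^ 2 := by field_simp
    _ ≤ _ := by linarith

/-- Admissible inputs have first component `1`, the coefficient of the drift. Admissible input
differences change only the disturbance, so their norm is that of `w'`. -/
theorem LieSystem.exists_contractingSystem (hsys : LieSystem h sys S)
    (hM : IsUniformMetric (stateSpace h) M) (hk : IsFeedback (stateSpace h) k)
    (hlam : 0 < lam) (hμ : 0 < μ)
    (hR₁ : ∀ x ∈ stateSpace h, ∀ z ∈ stateSpace h, ∀ (u : Vec m) (w : Vec p),
      (-(R₁ sys S k M lam μ x z u w)).PosSemidef) :
    ∃ (R : Vec n → Vec (n - q) →L[ℝ] Vec n) (c : ℝ), ContractingSystem (stateSpace h) h R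
      (inputField sys k) (metricForm S M) {v | v.1 = 1} {w | w.1 = 0 ∧ w.2.1 = 0} c lam μ := by
  obtain ⟨c, hc, hco⟩ := hsys.exists_coercive hM
  obtain ⟨J, hJ⟩ := exists_smooth_rightInverse (E := Vec n) (F := Vec (n - q))
  have hDh : ContDiff ℝ ∞ (fderiv ℝ h) := hsys.h_smooth.fderiv_right (by simp)
  refine ⟨fun x => J (fderiv ℝ h x), c,
    { mem_iff := fun x => Iff.rfl
      h_smooth := hsys.h_smooth
      R_C1 := fun x hx => ?_
      R_right := fun x hx => ?_
      G_C1 := fun x hx z hz => hsys.inputField_C1 hk hx hz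
      G_tangent := fun x hx z hz v => ?_
      Q_C1 := fun x hx => hsys.metricForm_C1 hM hx
      Q_symm := fun x hx => metricForm_symm hM hx
      c_pos := hc
      coercive := hco
      lam_pos := hlam
      μ_pos := hμ
      contraction := ?_ }⟩
  · exact ((hJ _ (hsys.h_regular x hx)).1.comp x hDh.contDiffAt).of_le (by simp)
  · exact hDh.continuous.continuousAt.eventually (hJ _ (hsys.h_regular x hx)).2
  · obtain ⟨s, u, w⟩ := v
    rw [inputField_apply, act_eq_sum_colField, act_eq_sum_colField, act_eq_sum_colField]
    simp [hsys.f_tangent x hx, hsys.B_tangent x hx, hsys.Bw_tangent x hx]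
  · rintro x hx z hz ⟨s, u, w⟩ hs ⟨s', u', w'⟩ ⟨hs', hu'⟩ ξ hξ
    obtain rfl : s = 1 := hs
    obtain rfl : s' = 0 := hs'
    obtain rfl : u' = 0 := hu'
    have hnorm : ‖((0 : ℝ), (0 : Vec m), w')‖ = ‖w'‖ := by simp [Prod.norm_def]
    rw [hnorm]
    exact hsys.contraction hM hk hx hz u w w' (hR₁ x hx z hz u w) hξ

end Systems

theorem intervalIntegrable_clm_apply {V E : Type*} [NormedAddCommGroup V] [NormedSpace ℝ V]
    [NormedAddCommGroup E] [NormedSpace ℝ E] {T : ℝ} (hT : 0 ≤ T) {L : ℝ → V →L[ℝ] E}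
    (hL : ContinuousOn L (Icc 0 T)) {v : ℝ → V} (hv : IntervalIntegrable v volume 0 T) :
    IntervalIntegrable (fun t => L t (v t)) volume 0 T := by
  -- The extension by end values is continuous on `ℝ`, which provides measurability and a global
  -- bound.
  set L' : ℝ → V →L[ℝ] E := IccExtend hT ((Icc 0 T).domRestrict L) with hL'
  have hc : Continuous L' := (continuousOn_iff_continuous_domRestrict.1 hL).Icc_extend'
  obtain ⟨C, -, hC⟩ := exists_norm_le_of_continuousOn isCompact_Icc hL
  have hb : ∀ t, ‖L' t‖ ≤ C := fun t => hC _ (projIcc 0 T hT t).2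
  have h1 : IntervalIntegrable (fun t => L' t (v t)) volume 0 T := by
    refine (hv.norm.const_mul C).mono_fun ?_ (Eventually.of_forall fun t => ?_)
    · exact (isBoundedBilinearMap_apply (𝕜 := ℝ) (E := V)
        (F := E)).continuous.comp_aestronglyMeasurable
        (hc.aestronglyMeasurable.prodMk hv.def'.aestronglyMeasurable)
    · exact ((L' t).le_opNorm (v t)).trans ((mul_le_mul_of_nonneg_right (hb t)
        (norm_nonneg _)).trans (Real.le_norm_self _))
  refine h1.congr fun t ht => ?_
  rw [uIoc_of_le hT] at ht
  rw [hL', IccExtend_of_mem hT _ (Ioc_subset_Icc_self ht)]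
  rfl

theorem intervalIntegrable_one_prodMk {V W : Type*} [NormedAddCommGroup V] [NormedAddCommGroup W]
    {a b : ℝ} {u : ℝ → V} {w : ℝ → W} (hu : IntervalIntegrable u volume a b)
    (hw : IntervalIntegrable w volume a b) :
    IntervalIntegrable (fun t => ((1 : ℝ), u t, w t)) volume a b :=
  have h1 : IntervalIntegrable (fun _ => (1 : ℝ)) volume a b := intervalIntegrable_const
  ⟨h1.1.prodMk (hu.1.prodMk hw.1), h1.2.prodMk (hu.2.prodMk hw.2)⟩

theorem supNorm_sq_le {d : ℕ} {T : ℝ} {y : ℝ → Vec d} {b : ℝ} (hb : 0 ≤ b)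
    (h : ∀ t ∈ Icc 0 T, ‖y t‖ ^ 2 ≤ b) : supNorm T y ^ 2 ≤ ENNReal.ofReal b := by
  have h1 : supNorm T y ≤ ENNReal.ofReal (Real.sqrt b) := by
    refine iSup₂_le fun t ht => ?_
    rw [← ofReal_norm]
    exact ENNReal.ofReal_le_ofReal (Real.le_sqrt_of_sq_le (h t ht))
  calc supNorm T y ^ 2 ≤ ENNReal.ofReal (Real.sqrt b) ^ 2 := by gcongr
    _ = ENNReal.ofReal b := by
      rw [← ENNReal.ofReal_pow (Real.sqrt_nonneg b), Real.sq_sqrt hb]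

theorem norm_le_toReal_supNorm {d : ℕ} {T : ℝ} {y : ℝ → Vec d} (hy : supNorm T y ≠ ⊤) {t : ℝ}
    (ht : t ∈ Icc 0 T) : ‖y t‖ ≤ (supNorm T y).toReal := by
  have h1 : ‖y t‖ₑ ≤ supNorm T y := le_iSup₂ (f := fun t (_ : t ∈ Icc (0 : ℝ) T) => ‖y t‖ₑ) t ht
  rw [← toReal_enorm]
  exact ENNReal.toReal_mono hy h1

/-! ### The gain estimate for the control system. -/

section Systems

variable {n m p l q : ℕ} {h : Vec n → Vec (n - q)} {sys : System n m p l}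
  {S : Vec n → Matrix (Fin n) (Fin q) ℝ} {M : Vec n → Matrix (Fin q) (Fin q) ℝ}
  {k : Vec n → Vec n → Vec m} {α lam μ : ℝ}

theorem energy_eq (c : ℝ → Vec n) : energy S M c = ∫ s in (0 : ℝ)..1,
    metricForm S M (c s) (derivWithin c (Icc 0 1) s) (derivWithin c (Icc 0 1) s) := by
  simp only [energy, metricForm_apply]
  rfl

theorem LieSystem.hasAEDeriv (hsys : LieSystem h sys S) (hk : IsFeedback (stateSpace h) k)
    {T : ℝ} (hT : 0 ≤ T) {x xs : ℝ → Vec n} {u us : ℝ → Vec m} {w : ℝ → Vec p} {z : ℝ → Vec l}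
    (hx : IsSolution (stateSpace h) sys T x u w z) (hu : ∀ t ∈ Icc 0 T, u t = k (x t) (xs t) + us t)
    (hus : IntervalIntegrable us volume 0 T)
    (hxs : ContinuousOn xs (Icc 0 T)) (hxsX : ∀ t ∈ Icc 0 T, xs t ∈ stateSpace h) :
    HasAEDeriv 0 T x (fun t => inputField sys k (x t, xs t) (1, us t, w t)) := by
  have hv : IntervalIntegrable (fun t => ((1 : ℝ), us t, w t)) volume 0 T :=
    intervalIntegrable_one_prodMk hus hx.w_int
  refine HasAEDeriv.of_integral (intervalIntegrable_clm_apply hT ?_ hv) fun t ht => ?_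
  · exact fun t ht => (hsys.inputField_C1 hk (hx.mem t ht)
      (hxsX t ht)).continuousAt.comp_continuousWithinAt (f := fun t => (x t, xs t))
      ((hx.cont t ht).prodMk (hxs t ht))
  · rw [uIcc_of_le hT] at ht
    rw [hx.state t ht]
    congr 1
    refine intervalIntegral.integral_congr fun τ hτ => ?_
    rw [uIcc_of_le ht.1] at hτ
    rw [hu τ ⟨hτ.1, hτ.2.trans ht.2⟩, rhs_eq_inputField]

theorem le_of_posSemidef_R₂ (hp : 0 < p) {x z : Vec n} {u : Vec m}
    (hR : (R₂ sys S k M α lam μ x z u : Matrix (Fin q ⊕ Fin p) (Fin q ⊕ Fin p) ℝ).PosSemidef) :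
    μ ≤ α := by
  have h1 := hR.diag_nonneg (i := Sum.inr ⟨0, hp⟩)
  simp [R₂] at h1
  exact h1

/-- The gain estimate for a given path joining the initial values. -/
theorem LieSystem.sq_norm_output_sub_le (hsys : LieSystem h sys S)
    (hM : IsUniformMetric (stateSpace h) M) (hk : IsFeedback (stateSpace h) k)
    (hα : 0 < α) (hlam : 0 < lam) (hμ : 0 < μ)
    (hR₁ : ∀ x ∈ stateSpace h, ∀ z ∈ stateSpace h, ∀ (u : Vec m) (w : Vec p),
      (-(R₁ sys S k M lam μ x z u w)).PosSemidef)
    (hR₂ : ∀ x ∈ stateSpace h, ∀ z ∈ stateSpace h, ∀ u : Vec m,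
      (R₂ sys S k M α lam μ x z u).PosSemidef)
    {T : ℝ} (hT : 0 ≤ T) {x xs : ℝ → Vec n} {us : ℝ → Vec m} {w ws : ℝ → Vec p} {z zs : ℝ → Vec l}
    (hxs : IsSolution (stateSpace h) sys T xs us ws zs)
    (hx : IsSolution (stateSpace h) sys T x (fun t => k (x t) (xs t) + us t) w z) {D : ℝ}
    (hD : ∀ t ∈ Icc 0 T, ‖w t - ws t‖ ≤ D) {c : ℝ → Vec n}
    (hc : c ∈ paths (stateSpace h) (x 0) (xs 0)) {t : ℝ} (ht : t ∈ Icc 0 T) :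
    ‖z t - zs t‖ ^ 2 ≤ α * μ * D ^ 2 + 2 * α * lam * energy S M c := by
  obtain ⟨hcC, hcX, hc0, hc1⟩ := hc
  obtain ⟨R, c₀, hS⟩ := hsys.exists_contractingSystem hM hk hlam hμ hR₁
  have hus := hxs.u_int
  -- The two solutions share `u*`, so their inputs differ by `(0, 0, w* - w)`. The output map `Γ` is
  -- frozen at time `t`, with `x*(t)` and `u*(t)` as parameters; it takes the values `z(t)` at
  -- `x(t)` and `z*(t)` at `x*(t)`.
  have key := hS.sq_norm_output_sub_le hT
    (v := fun t => ((1 : ℝ), us t, w t)) (vs := fun t => ((1 : ℝ), us t, ws t))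
    (intervalIntegrable_one_prodMk hus hx.w_int)
    (intervalIntegrable_one_prodMk hus hxs.w_int)
    (hsys.hasAEDeriv hk hT hx (fun _ _ => rfl) hus hxs.cont hxs.mem)
    (hsys.hasAEDeriv hk hT hxs (fun t ht => by rw [hk.diag _ (hxs.mem t ht), zero_add]) hus
      hxs.cont hxs.mem)
    hx.mem hxs.mem (fun t _ s _ => by simp) (fun t _ r => by simp)
    (fun t ht => by simpa [Prod.norm_def, norm_sub_rev] using hD t ht)
    (hcC.of_le (by simp)) hcX hc0 hc1 ht
    (Γ := fun y => sys.g y (k y (xs t) + us t)) (fun y hy => ?_) (κ := 2 * α * lam)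
    (by positivity)
    (fun y hy ξ hξ => hsys.output_bound hk hα hy (hxs.mem t ht) (us t)
      (hR₂ y hy _ (hxs.mem t ht) (us t)) hξ)
  · rw [hx.output t ht, hxs.output t ht]
    simp only [hk.diag _ (hxs.mem t ht), zero_add] at key
    rw [energy_eq]
    -- With `κ = 2αλ`, the disturbance term `κ μ D²/(2λ)` equals `αμD²`.
    refine key.trans (le_of_eq ?_)
    field_simp
    ring
  · have h1 : ContDiffAt ℝ 1 (fun y => k y (xs t)) y :=
      (hk.C1 y hy _ (hxs.mem t ht)).comp (f := fun y => (y, xs t)) y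
        (contDiffAt_id.prodMk contDiffAt_const)
    exact (hsys.g_C1 y hy _).comp (f := fun y => (y, k y (xs t) + us t)) y
      (contDiffAt_id.prodMk (h1.add contDiffAt_const))

theorem const_mem_paths {X : Set (Vec n)} {x : Vec n} (hx : x ∈ X) :
    (fun _ => x) ∈ paths X x x :=
  ⟨contDiffOn_const, fun _ _ => hx, rfl, rfl⟩

theorem minEnergy_self {X : Set (Vec n)} {x : Vec n} (hx : x ∈ X) : minEnergy X S M x x = 0 := by
  refine le_antisymm ((iInf₂_le _ (const_mem_paths hx)).trans ?_) zero_le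
  rw [energy_eq]
  simp

theorem minEnergy_lt_top {X : Set (Vec n)} {a b : Vec n} (hab : (paths X a b).Nonempty) :
    minEnergy X S M a b < ⊤ := by
  obtain ⟨c, hc⟩ := hab
  exact (iInf₂_le c hc).trans_lt ENNReal.ofReal_lt_top

theorem IsEmbeddedLieGroup.paths_nonempty {X : Set (Vec n)} (hX : IsEmbeddedLieGroup q X)
    {a b : Vec n} (ha : a ∈ X) (hb : b ∈ connectedComponentIn X a) : (paths X a b).Nonempty := by
  obtain ⟨_, _, hG, hval, -⟩ := hX
  have : IsManifold (𝓡 q) ∞ X := hG.toContMDiffMul.toIsManifold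
  exact (smoothlyJoined_of_mem_connectedComponentIn hval ha hb).paths_nonempty

/-- Multiplication by a nonzero finite constant commutes with infima in `ℝ≥0∞`. Positivity of `κ`
matters when no path exists: the right-hand side is then `∞`, whereas `0 · ∞ = 0`. -/
theorem le_add_mul_minEnergy {X : Set (Vec n)} {a b : Vec n} {A B : ℝ≥0∞} {κ : ℝ} (hκ : 0 < κ)
    (H : ∀ c ∈ paths X a b, A ≤ B + ENNReal.ofReal κ * ENNReal.ofReal (energy S M c)) :
    A ≤ B + ENNReal.ofReal κ * minEnergy X S M a b := by
  have h0 : ENNReal.ofReal κ ≠ 0 := by simpa using hκ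
  rw [minEnergy, ENNReal.mul_iInf_of_ne h0 ENNReal.ofReal_ne_top, ENNReal.add_iInf]
  refine le_iInf fun c => ?_
  rw [ENNReal.mul_iInf_of_ne h0 ENNReal.ofReal_ne_top, ENNReal.add_iInf]
  exact le_iInf fun hc => H c hc

end Systems

end LieRCCM

end

theorem proposition1 {n m p l q : ℕ}
    (h : LieRCCM.Vec n → LieRCCM.Vec (n - q))
    (sys : LieRCCM.System n m p l)
    (S : LieRCCM.Vec n → Matrix (Fin n) (Fin q) ℝ)
    (hsys : LieRCCM.LieSystem h sys S)
    (M : LieRCCM.Vec n → Matrix (Fin q) (Fin q) ℝ)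
    (hM : LieRCCM.IsUniformMetric (LieRCCM.stateSpace h) M)
    (k : LieRCCM.Vec n → LieRCCM.Vec n → LieRCCM.Vec m)
    (hk : LieRCCM.IsFeedback (LieRCCM.stateSpace h) k)
    (α lam μ : ℝ) (hα : 0 < α) (hlam : 0 < lam) (hμ : 0 < μ)
    (hR₁ : ∀ x ∈ LieRCCM.stateSpace h, ∀ xs ∈ LieRCCM.stateSpace h,
      ∀ (us : LieRCCM.Vec m) (w : LieRCCM.Vec p),
        (-(LieRCCM.R₁ sys S k M lam μ x xs us w)).PosSemidef)
    (hR₂ : ∀ x ∈ LieRCCM.stateSpace h, ∀ xs ∈ LieRCCM.stateSpace h,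
      ∀ us : LieRCCM.Vec m,
        (LieRCCM.R₂ sys S k M α lam μ x xs us).PosSemidef) :
    LieRCCM.HasUniversalGain (LieRCCM.stateSpace h) sys k α
        (fun a b => ENNReal.ofReal (2 * α * lam) *
          LieRCCM.minEnergy (LieRCCM.stateSpace h) S M a b) ∧
      ∀ a ∈ LieRCCM.stateSpace h, ∀ b ∈ connectedComponentIn (LieRCCM.stateSpace h) a,
        LieRCCM.minEnergy (LieRCCM.stateSpace h) S M a b < ⊤ := by
  refine ⟨⟨fun x hx => ?_, ?_⟩, fun a ha b hb =>
    LieRCCM.minEnergy_lt_top (hsys.lieGroup.paths_nonempty ha hb)⟩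
  · change ENNReal.ofReal (2 * α * lam) * LieRCCM.minEnergy (LieRCCM.stateSpace h) S M x x = 0
    rw [LieRCCM.minEnergy_self hx, mul_zero]
  intro T hT xs us ws zs hxs x w z _ hx
  -- If `w - w*` is unbounded, the right-hand side is infinite because `α > 0`.
  by_cases hfin : LieRCCM.supNorm T (fun t => w t - ws t) = ⊤
  · simp [hfin, hα, ENNReal.mul_top]
  refine LieRCCM.le_add_mul_minEnergy (by positivity) fun c hc => ?_
  set D := (LieRCCM.supNorm T (fun t => w t - ws t)).toReal with hD
  have h0 : (0 : ℝ) ∈ Icc 0 T := ⟨le_rfl, hT.le⟩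
  have hμD : μ * D ^ 2 ≤ α * D ^ 2 := by
    -- For `p = 0` the lower block of `R₂` is empty and does not give `μ ≤ α`, but then `D = 0`.
    rcases Nat.eq_zero_or_pos p with rfl | hp
    · have : D = 0 := by simp [hD, LieRCCM.supNorm, Subsingleton.elim _ (0 : LieRCCM.Vec 0)]
      simp [this]
    · gcongr
      exact LieRCCM.le_of_posSemidef_R₂ hp (hR₂ _ (hx.mem 0 h0) _ (hxs.mem 0 h0) (us 0))
  have key : ∀ t ∈ Icc 0 T, ‖z t - zs t‖ ^ 2 ≤ α ^ 2 * D ^ 2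
      + 2 * α * lam * LieRCCM.energy S M c := by
    intro t ht
    have h1 := hsys.sq_norm_output_sub_le hM hk hα hlam hμ hR₁ hR₂ hT.le hxs hx
      (fun t ht => LieRCCM.norm_le_toReal_supNorm hfin ht) hc ht
    have h2 := mul_le_mul_of_nonneg_left hμD hα.le
    calc _ ≤ _ := h1
      _ ≤ _ := by rw [← hD]; linarith
  -- Nonnegativity of the bound is read off from `key` at time `0`, so the sign of the energy needs
  -- no separate proof.
  refine (LieRCCM.supNorm_sq_le ((sq_nonneg _).trans (key 0 h0)) key).trans ?_
  refine ENNReal.ofReal_add_le.trans ?_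
  rw [ENNReal.ofReal_mul (by positivity), ENNReal.ofReal_mul (by positivity),
    ENNReal.ofReal_pow hα.le, ENNReal.ofReal_pow ENNReal.toReal_nonneg,
    ENNReal.ofReal_toReal hfin]
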